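/- **Theorem (linear interpolation).** Let $d\ge 1$ and $\beta\in\mathbb R$. For finite $X\subset\mathbb Z^d$ let $J_X$ be independent Gaussian variables with mean $\mu_X$ and variance $\Delta_X^2$ (possibly $0$), and let $\mathrm{Av}$ denote the average over them. For finite $\Lambda'\subseteq\Lambda\subset\mathbb Z^d$ and $\sigma\in\{-1,1\}^{\Lambda}$ put $\sigma_X=\prod_{i\in X}\sigma_i$ (with $\sigma_\emptyset=0$), $$H_{\Lambda'}(\sigma)=-\sum_{X\subseteq\Lambda'}J_X\sigma_X,\qquad H_{\Lambda\setminus\Lambda'}(\sigma)=-\sum_{X\subseteq\Lambda,\;X\not\subseteq\Lambda'}J_X\sigma_X,\qquad X_{\Lambda,t}=tH_{\Lambda'}+H_{\Lambda\setminus\Lambda'},\quad t\in[-1,1].$$ Let $\omega_t(f)=\sum_\sigma f(\sigma)e^{-\beta X_{\Lambda,t}(\sigma)}\big/\sum_\sigma e^{-\beta X_{\Lambda,t}(\sigma)}$ and, for $k$ replicas sharing the same disorder, $\langle f\rangle_{t_1,\dots,t_k}=\mathrm{Av}\big[(\omega_{t_1}\otimes\cdots\otimes\omega_{t_k})(f)\big]$.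 For replicas $\sigma^{(1)},\sigma^{(2)},\dots$ write $$m_i=-\frac1{|\Lambda'|}\sum_{X\subseteq\Lambda'}\mu_X\sigma^{(i)}_X,\qquad c_{i,j}=\frac1{|\Lambda'|}\sum_{X\subseteq\Lambda'}\Delta_X^2\sigma^{(i)}_X\sigma^{(j)}_X,\qquad d_{\Lambda'}=\frac1{|\Lambda'|}\sum_{X\subseteq\Lambda'}\Delta_X^2,$$ and $\langle m\rangle_t=\langle m_1\rangle_t$. Call $(\mu_X,\Delta_X)$ thermodynamically stable if there is a constant $\bar c<\infty$ such that $\sum_{X\subseteq\Lambda}|\mu_X|\le\bar c|\Lambda|$ and $\sum_{X\subseteq\Lambda}\Delta_X^2\le\bar c|\Lambda|$ for every finite nonempty $\Lambda\subset\mathbb Z^d$. Define $$\begin{aligned}Q={}&\beta^4\int_{-1}^1\!\int_{-1}^1 dt\,ds\;ts\big(\langle c_{1,2}c_{3,4}\rangle_{t,t,s,s}-\langle c_{1,2}\rangle_{t,t}\langle c_{1,2}\rangle_{s,s}\big)\\&-4\beta^4\int_{-1}^1\!\int_{-1}^1 dt\,ds\;t^2\big(\langle c_{1,2}c_{2,3}\rangle_{t,t,s}-\langle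 c_{1,2}c_{3,4}\rangle_{t,t,s,t}\big)\\&+\beta^4\int_{-1}^1\!\int_{-1}^1 dt\,ds\;ts\big(\langle c_{1,2}^2\rangle_{t,s}-2\langle c_{1,2}c_{2,3}\rangle_{t,s,t}+\langle c_{1,2}c_{3,4}\rangle_{t,s,s,t}\big).\end{aligned}$$ Suppose $(\mu_X,\Delta_X)$ is thermodynamically stable, let $a>0$, and let $\Lambda'_n\subseteq\Lambda_n$ be finite subsets of $\mathbb Z^d$, each of the two sequences eventually containing every given finite set (as $\Lambda_n,\Lambda_n'\nearrow\mathbb Z^d$), with $|\Lambda'_n|/|\Lambda_n|\to a$. Then, along $(\Lambda,\Lambda')=(\Lambda_n,\Lambda'_n)$, $$\begin{aligned}\lim_{n\to\infty}\Big\{&\beta^2\int_{-1}^1\!\int_{-1}^1 dt\,ds\,\big(\langle m_1m_2\rangle_{t,s}-\langle m\rangle_t\langle m\rangle_s\big)\\&-2\beta^3\int_{-1}^1\!\int_{-1}^1 dt\,ds\;t\big(\langle m_1c_{1,2}\rangle_{t,s}+\langle c_{1,2}\rangle_{t,t}\langle m\rangle_s\big)\\&+2\beta^3\int_{-1}^1\!\int_{-1}^1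 dt\,ds\;t\big(\langle m_1c_{2,3}\rangle_{t,s,t}+\langle m_1c_{2,3}\rangle_{s,t,t}-d_{\Lambda'}\langle m\rangle_s\big)+Q\Big\}=0.\end{aligned}$$ Moreover, let $(\mu'_X,\Delta_X)$ also be thermodynamically stable, and for $\mu\in\mathbb R$ let $Q(\mu)$ denote $Q$ computed with the mean of $J_X$ replaced by $\mu\,\mu'_X$ for every $X\subseteq\Lambda'$, the means of the other couplings staying equal to $\mu_X$. Then for every interval $[\mu_1,\mu_2]$, $$\lim_{n\to\infty}\int_{\mu_1}^{\mu_2}Q(\mu)\,d\mu=0 .$$ -/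

import Mathlib

open MeasureTheory ProbabilityTheory Filter Topology
open scoped NNReal

namespace SpinGlass

/-- Sites of the lattice `ℤ^d`. -/
abbrev Site (d : ℕ) : Type := Fin d → ℤ

/-- A realisation of the disorder: one real coupling `J_X` for every finite `X ⊂ ℤ^d`. -/
abbrev Disorder (d : ℕ) : Type := Finset (Site d) → ℝ

/-- Ising configurations `σ ∈ {-1, 1}^Λ`. -/
abbrev Config {d : ℕ} (Λ : Finset (Site d)) : Type := {i : Site d // i ∈ Λ} → ℤˣ

/-- The law of the disorder: the couplings `J_X` are independent Gaussian variables with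
mean `m X` and variance `(Δ X)²` (a point mass when `Δ X = 0`). -/
noncomputable def disorderLaw {d : ℕ} (m : Finset (Site d) → ℝ) (Δ : Finset (Site d) → ℝ≥0) :
    Measure (Disorder d) :=
  Measure.infinitePi fun X => gaussianReal (m X) (Δ X ^ 2)

/-- `σ_X = ∏_{i ∈ X} σ_i` for `X ⊂ Λ`, with the convention `σ_∅ = 0`. -/
noncomputable def spinProd {d : ℕ} {Λ : Finset (Site d)} (X : Finset (Site d)) (σ : Config Λ) : ℝ :=
  if X = ∅ then 0 else ∏ i ∈ X.subtype (· ∈ Λ), (((σ i : ℤˣ) : ℤ) : ℝ)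

/-- Thermodynamic stability of the disorder with means `m X` and variances `(Δ X)²`. -/
def ThermodynamicallyStable {d : ℕ} (m : Finset (Site d) → ℝ) (Δ : Finset (Site d) → ℝ≥0) : Prop :=
  ∃ c : ℝ, ∀ Λ : Finset (Site d), Λ.Nonempty →
    (∑ X ∈ Λ.powerset, |m X|) / (Λ.card : ℝ) ≤ c ∧
    (∑ X ∈ Λ.powerset, (Δ X : ℝ) ^ 2) / (Λ.card : ℝ) ≤ c

/-- `H_{Λ'}(σ) = - ∑_{X ⊂ Λ'} J_X σ_X`, for `Λ' ⊂ Λ` and `σ ∈ {-1, 1}^Λ`. -/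
noncomputable def hamInside {d : ℕ} {Λ : Finset (Site d)} (Λ' : Finset (Site d)) (J : Disorder d)
    (σ : Config Λ) : ℝ :=
  -∑ X ∈ Λ'.powerset, J X * spinProd X σ

/-- `H_{Λ ∖ Λ'}(σ) = - ∑_{X ⊂ Λ, X ⊄ Λ'} J_X σ_X`. -/
noncomputable def hamOutside {d : ℕ} {Λ : Finset (Site d)} (Λ' : Finset (Site d)) (J : Disorder d)
    (σ : Config Λ) : ℝ :=
  -∑ X ∈ Λ.powerset with ¬ X ⊆ Λ', J X * spinProd X σ

/-- The linear interpolation `t H_{Λ'} + H_{Λ ∖ Λ'}`. -/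
noncomputable def hamLinear {d : ℕ} {Λ : Finset (Site d)} (Λ' : Finset (Site d)) (J : Disorder d)
    (t : ℝ) (σ : Config Λ) : ℝ :=
  t * hamInside Λ' J σ + hamOutside Λ' J σ

/-- The partition function `𝒵_β(t)`. -/
noncomputable def partitionFn {d : ℕ} (β : ℝ) (Λ Λ' : Finset (Site d)) (J : Disorder d)
    (t : ℝ) : ℝ :=
  ∑ σ : Config Λ, Real.exp (-β * hamLinear Λ' J t σ)

/-- The random state `ω_{t 0} ⊗ ⋯ ⊗ ω_{t (k-1)}` on `k` replicas of the system that share the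
disorder `J`, replica `j` having interpolation parameter `t j`. -/
noncomputable def randomState {d : ℕ} (β : ℝ) (Λ Λ' : Finset (Site d)) (J : Disorder d) {k : ℕ}
    (t : Fin k → ℝ) (f : (Fin k → Config Λ) → ℝ) : ℝ :=
  ∑ σ : Fin k → Config Λ,
    f σ * ∏ j, (Real.exp (-β * hamLinear Λ' J (t j) (σ j)) / partitionFn β Λ Λ' J (t j))

/-- The quenched state `⟨f⟩_{t 0, …, t (k-1)}`. -/
noncomputable def quenched {d : ℕ} (β : ℝ) (m : Finset (Site d) → ℝ) (Δ : Finset (Site d) → ℝ≥0)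
    (Λ Λ' : Finset (Site d)) {k : ℕ} (t : Fin k → ℝ) (f : (Fin k → Config Λ) → ℝ) : ℝ :=
  ∫ J, randomState β Λ Λ' J t f ∂(disorderLaw m Δ)

/-- The generalized magnetization `b_{Λ'}(σ) = - |Λ'|⁻¹ ∑_{X ⊂ Λ'} m_X σ_X`. -/
noncomputable def mag {d : ℕ} {Λ : Finset (Site d)} (m : Finset (Site d) → ℝ)
    (Λ' : Finset (Site d)) (σ : Config Λ) : ℝ :=
  (-∑ X ∈ Λ'.powerset, m X * spinProd X σ) / (Λ'.card : ℝ)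

/-- The normalized covariance `c_{Λ'}(σ, τ) = |Λ'|⁻¹ ∑_{X ⊂ Λ'} Δ_X² σ_X τ_X`. -/
noncomputable def cov {d : ℕ} {Λ : Finset (Site d)} (Δ : Finset (Site d) → ℝ≥0)
    (Λ' : Finset (Site d)) (σ τ : Config Λ) : ℝ :=
  (∑ X ∈ Λ'.powerset, (Δ X : ℝ) ^ 2 * spinProd X σ * spinProd X τ) / (Λ'.card : ℝ)

/-- `d_{Λ'} = |Λ'|⁻¹ ∑_{X ⊂ Λ'} Δ_X²`. -/
noncomputable def varDensity {d : ℕ} (Δ : Finset (Site d) → ℝ≥0) (Λ' : Finset (Site d)) : ℝ :=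
  (∑ X ∈ Λ'.powerset, (Δ X : ℝ) ^ 2) / (Λ'.card : ℝ)

/-- The means `μ m'_X` for `X ⊂ Λ'` and `m_X` for the other `X`. -/
def paramMean {d : ℕ} (m m' : Finset (Site d) → ℝ) (Λ' : Finset (Site d)) (μ : ℝ) :
    Finset (Site d) → ℝ :=
  fun X => if X ⊆ Λ' then μ * m' X else m X

/-- The magnetization and mixed terms (replicas are numbered from `0`):
`β² ∬ (⟨m₁m₂⟩_{t,s} - ⟨m⟩_t ⟨m⟩_s) - 2β³ ∬ t (⟨m₁c₁₂⟩_{t,s} + ⟨c₁₂⟩_{t,t} ⟨m⟩_s)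
+ 2β³ ∬ t (⟨m₁c₂₃⟩_{t,s,t} + ⟨m₁c₂₃⟩_{s,t,t} - d ⟨m⟩_s)`. -/
noncomputable def magneticTerms {d : ℕ} (β : ℝ) (m : Finset (Site d) → ℝ)
    (Δ : Finset (Site d) → ℝ≥0) (Λ Λ' : Finset (Site d)) : ℝ :=
  β ^ 2 * (∫ t in (-1 : ℝ)..1, ∫ s in (-1 : ℝ)..1,
      (quenched β m Δ Λ Λ' ![t, s] (fun σ => mag m Λ' (σ 0) * mag m Λ' (σ 1))
        - quenched β m Δ Λ Λ' ![t] (fun σ => mag m Λ' (σ 0))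
          * quenched β m Δ Λ Λ' ![s] (fun σ => mag m Λ' (σ 0))))
  - 2 * β ^ 3 * (∫ t in (-1 : ℝ)..1, ∫ s in (-1 : ℝ)..1,
      t * (quenched β m Δ Λ Λ' ![t, s] (fun σ => mag m Λ' (σ 0) * cov Δ Λ' (σ 0) (σ 1))
        + quenched β m Δ Λ Λ' ![t, t] (fun σ => cov Δ Λ' (σ 0) (σ 1))
          * quenched β m Δ Λ Λ' ![s] (fun σ => mag m Λ' (σ 0))))
  + 2 * β ^ 3 * (∫ t in (-1 : ℝ)..1, ∫ s in (-1 : ℝ)..1,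
      t * (quenched β m Δ Λ Λ' ![t, s, t] (fun σ => mag m Λ' (σ 0) * cov Δ Λ' (σ 1) (σ 2))
        + quenched β m Δ Λ Λ' ![s, t, t] (fun σ => mag m Λ' (σ 0) * cov Δ Λ' (σ 1) (σ 2))
        - varDensity Δ Λ' * quenched β m Δ Λ Λ' ![s] (fun σ => mag m Λ' (σ 0))))

/-- The quartic covariance terms (replicas are numbered from `0`):
`β⁴ ∬ ts (⟨c₁₂c₃₄⟩_{t,t,s,s} - ⟨c₁₂⟩_{t,t} ⟨c₁₂⟩_{s,s})
- 4β⁴ ∬ t² (⟨c₁₂c₂₃⟩_{t,t,s} - ⟨c₁₂c₃₄⟩_{t,t,s,t})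
+ β⁴ ∬ ts (⟨c₁₂²⟩_{t,s} - 2⟨c₁₂c₂₃⟩_{t,s,t} + ⟨c₁₂c₃₄⟩_{t,s,s,t})`. -/
noncomputable def quarticTerms {d : ℕ} (β : ℝ) (m : Finset (Site d) → ℝ)
    (Δ : Finset (Site d) → ℝ≥0) (Λ Λ' : Finset (Site d)) : ℝ :=
  β ^ 4 * (∫ t in (-1 : ℝ)..1, ∫ s in (-1 : ℝ)..1,
      t * s * (quenched β m Δ Λ Λ' ![t, t, s, s]
          (fun σ => cov Δ Λ' (σ 0) (σ 1) * cov Δ Λ' (σ 2) (σ 3))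
        - quenched β m Δ Λ Λ' ![t, t] (fun σ => cov Δ Λ' (σ 0) (σ 1))
          * quenched β m Δ Λ Λ' ![s, s] (fun σ => cov Δ Λ' (σ 0) (σ 1))))
  - 4 * β ^ 4 * (∫ t in (-1 : ℝ)..1, ∫ s in (-1 : ℝ)..1,
      t ^ 2 * (quenched β m Δ Λ Λ' ![t, t, s]
          (fun σ => cov Δ Λ' (σ 0) (σ 1) * cov Δ Λ' (σ 1) (σ 2))
        - quenched β m Δ Λ Λ' ![t, t, s, t]
          (fun σ => cov Δ Λ' (σ 0) (σ 1) * cov Δ Λ' (σ 2) (σ 3))))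
  + β ^ 4 * (∫ t in (-1 : ℝ)..1, ∫ s in (-1 : ℝ)..1,
      t * s * (quenched β m Δ Λ Λ' ![t, s] (fun σ => cov Δ Λ' (σ 0) (σ 1) ^ 2)
        - 2 * quenched β m Δ Λ Λ' ![t, s, t]
          (fun σ => cov Δ Λ' (σ 0) (σ 1) * cov Δ Λ' (σ 1) (σ 2))
        + quenched β m Δ Λ Λ' ![t, s, s, t]
          (fun σ => cov Δ Λ' (σ 0) (σ 1) * cov Δ Λ' (σ 2) (σ 3))))

end SpinGlass

/-! The theorem comes from evaluating in two ways the variance of log Z(1) − log Z(−1), the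
difference of the log-partition functions at the two ends of the interpolation.

Upper bound: log Z(±1) is |β|-Lipschitz in each coupling, so the Efron–Stein inequality
`variance_le_of_coord_lipschitz` bounds its variance by β² ∑_{X ⊆ Λ} Δ_X², which stability makes
O(|Λ|).

Exact value: the difference equals β ∫ ∑_{X ⊆ Λ'} J_X ω_t(σ_X) dt over [-1, 1]. Writing J_X = μ_X +
(J_X − μ_X) splits it into β times `meanPart` plus β times `noisePart`. Gaussian integration by
parts trades each factor J_X − μ_X for a derivative in J_X, and each derivative of a Gibbs average
produces further replicas (`covariance_noise_noise`, `covariance_mean_noise`). The outcome is that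
β² Var(`noisePart`) equals |Λ'|² Q plus a term of order |Λ'|, while β² Var(`meanPart`) and the cross
covariance together give |Λ'|² times the magnetic terms. Dividing by |Λ'|², the full expression is
O(|Λ|/|Λ'|² + 1/|Λ'|), which tends to 0 because |Λ'|/|Λ| → a > 0 and |Λ'| → ∞.

For Q alone the fluctuations of `meanPart` must be shown to be o(|Λ'|²) on average over μ. In the
parameter μ, log Z(t) is convex with derivative −βt|Λ'| ω_t(m'), where m' is the magnetization
density of the means μ'_X, and its variance is O(|Λ|). A random convex function with small
fluctuations has a derivative with small fluctuations after averaging over the parameter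
(`integral_variance_deriv_le`): the derivative is compared with a difference quotient of step h, and
the error is paid for by the integrated second difference. This gives ∫ Var(ω_t(m')) dμ → 0 for t ≠
0, dominated convergence integrates it over t, and writing β times `noisePart` as the full
difference minus β times `meanPart` transfers the estimate to Q. -/

namespace SpinGlass

/-! ### Gibbs averages and log-partition functions on a finite set. -/

section Gibbs

variable {S : Type*} [Fintype S]

/-- The average of `f` for the probability weights proportional to `exp (h σ)`. -/
noncomputable def gibbsAvg (h f : S → ℝ) : ℝ :=
  (∑ σ, f σ * Real.exp (h σ)) / ∑ σ, Real.exp (h σ)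

/-- The logarithm of the sum of the weights `exp (h σ)`. -/
noncomputable def logPart (h : S → ℝ) : ℝ := Real.log (∑ σ, Real.exp (h σ))

theorem sum_exp_pos [Nonempty S] (h : S → ℝ) : 0 < ∑ σ, Real.exp (h σ) :=
  Finset.sum_pos (fun _ _ => Real.exp_pos _) Finset.univ_nonempty

theorem gibbsAvg_const_mul (h : S → ℝ) (c : ℝ) (f : S → ℝ) :
    gibbsAvg h (fun σ => c * f σ) = c * gibbsAvg h f := by
  simp only [gibbsAvg, mul_assoc, ← Finset.mul_sum, mul_div_assoc]

theorem gibbsAvg_sum {ι : Type*} (s : Finset ι) (h : S → ℝ) (f : ι → S → ℝ) :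
    gibbsAvg h (fun σ => ∑ i ∈ s, f i σ) = ∑ i ∈ s, gibbsAvg h (f i) := by
  simp only [gibbsAvg, Finset.sum_mul, ← Finset.sum_div]
  rw [Finset.sum_comm]

theorem gibbsAvg_const [Nonempty S] (h : S → ℝ) (c : ℝ) : gibbsAvg h (fun _ => c) = c := by
  rw [gibbsAvg, ← Finset.mul_sum, mul_div_assoc, div_self (sum_exp_pos h).ne', mul_one]

theorem gibbsAvg_mono [Nonempty S] (h : S → ℝ) {f g : S → ℝ} (hfg : ∀ σ, f σ ≤ g σ) :
    gibbsAvg h f ≤ gibbsAvg h g := by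
  have := sum_exp_pos h
  unfold gibbsAvg
  gcongr
  exact hfg _

theorem abs_gibbsAvg_le [Nonempty S] (h : S → ℝ) {f : S → ℝ} {C : ℝ} (hf : ∀ σ, |f σ| ≤ C) :
    |gibbsAvg h f| ≤ C := by
  rw [abs_le]
  constructor
  · rw [← gibbsAvg_const h (-C)]
    exact gibbsAvg_mono h fun σ => (abs_le.1 (hf σ)).1
  · rw [← gibbsAvg_const h C]
    exact gibbsAvg_mono h fun σ => (abs_le.1 (hf σ)).2

theorem continuous_gibbsAvg [Nonempty S] {α : Type*} [TopologicalSpace α] {h : α → S → ℝ}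
    (hh : ∀ σ, Continuous fun x => h x σ) (f : S → ℝ) : Continuous fun x => gibbsAvg (h x) f := by
  unfold gibbsAvg
  exact Continuous.div (by fun_prop) (by fun_prop) fun x => (sum_exp_pos (h x)).ne'

theorem continuous_logPart [Nonempty S] {α : Type*} [TopologicalSpace α] {h : α → S → ℝ}
    (hh : ∀ σ, Continuous fun x => h x σ) : Continuous fun x => logPart (h x) := by
  unfold logPart
  exact Continuous.log (by fun_prop) fun x => (sum_exp_pos (h x)).ne'

theorem hasDerivAt_sum_mul_exp (a b f : S → ℝ) (y : ℝ) :
    HasDerivAt (fun y => ∑ σ, f σ * Real.exp (a σ + y * b σ))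
      (∑ σ, f σ * b σ * Real.exp (a σ + y * b σ)) y := by
  refine HasDerivAt.fun_sum fun σ _ => ?_
  have h1 : HasDerivAt (fun y => a σ + y * b σ) (b σ) y := by
    simpa using ((hasDerivAt_id y).mul_const (b σ)).const_add (a σ)
  refine (h1.exp.const_mul (f σ)).congr_deriv ?_
  ring

/-- The quotient rule turns a derivative into a truncated correlation; the product of two averages
is what later becomes a pair of replicas. -/
theorem hasDerivAt_gibbsAvg [Nonempty S] (a b f : S → ℝ) (y : ℝ) :
    HasDerivAt (fun y => gibbsAvg (fun σ => a σ + y * b σ) f)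
      (gibbsAvg (fun σ => a σ + y * b σ) (fun σ => f σ * b σ)
        - gibbsAvg (fun σ => a σ + y * b σ) f * gibbsAvg (fun σ => a σ + y * b σ) b) y := by
  have hZ := (sum_exp_pos fun σ => a σ + y * b σ).ne'
  have h2 : HasDerivAt (fun y => ∑ σ, Real.exp (a σ + y * b σ))
      (∑ σ, b σ * Real.exp (a σ + y * b σ)) y := by
    simpa using hasDerivAt_sum_mul_exp a b (fun _ => 1) y
  unfold gibbsAvg
  refine ((hasDerivAt_sum_mul_exp a b f y).fun_div h2 hZ).congr_deriv ?_
  have key : ∀ p q r Z : ℝ, Z ≠ 0 → (p * Z - q * r) / Z ^ 2 = p / Z - q / Z * (r / Z) := by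
    intro p q r Z hZ
    field_simp
  exact key _ _ _ _ hZ

theorem hasDerivAt_logPart [Nonempty S] (a b : S → ℝ) (y : ℝ) :
    HasDerivAt (fun y => logPart (fun σ => a σ + y * b σ))
      (gibbsAvg (fun σ => a σ + y * b σ) b) y := by
  have h2 : HasDerivAt (fun y => ∑ σ, Real.exp (a σ + y * b σ))
      (∑ σ, b σ * Real.exp (a σ + y * b σ)) y := by
    simpa using hasDerivAt_sum_mul_exp a b (fun _ => 1) y
  exact h2.log (sum_exp_pos fun σ => a σ + y * b σ).ne'

/-- Convexity of the log-partition function: it lies above its tangents. -/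
theorem logPart_add_gibbsAvg_le [Nonempty S] (h b : S → ℝ) :
    logPart h + gibbsAvg h b ≤ logPart (fun σ => h σ + b σ) := by
  have hZ := sum_exp_pos h
  have hZ' := sum_exp_pos fun σ => h σ + b σ
  set c := gibbsAvg h b with hc
  -- Jensen's inequality by hand: exp (b − c) ≥ 1 + (b − c), and b − c has Gibbs mean zero.
  have key : Real.exp c * ∑ σ, Real.exp (h σ) ≤ ∑ σ, Real.exp (h σ + b σ) := by
    have h0 : ∑ σ, (b σ - c) * Real.exp (h σ) = 0 := by
      simp only [sub_mul, Finset.sum_sub_distrib, ← Finset.mul_sum]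
      rw [hc, gibbsAvg, div_mul_cancel₀ _ hZ.ne', sub_self]
    calc Real.exp c * ∑ σ, Real.exp (h σ)
        = Real.exp c * ∑ σ, (b σ - c + 1) * Real.exp (h σ) := by
          simp only [add_mul, Finset.sum_add_distrib, h0, one_mul, zero_add]
      _ ≤ Real.exp c * ∑ σ, Real.exp (b σ - c) * Real.exp (h σ) := by
          gcongr with σ
          exact Real.add_one_le_exp _
      _ = ∑ σ, Real.exp (h σ + b σ) := by
          rw [Finset.mul_sum]
          refine Finset.sum_congr rfl fun σ _ => ?_
          rw [← Real.exp_add, ← Real.exp_add]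
          ring_nf
  have := Real.log_le_log (by positivity) key
  rwa [Real.log_mul (Real.exp_pos c).ne' hZ.ne', Real.log_exp, add_comm] at this

/-- The tangent inequality is applied from both ends. This is the source of the coordinatewise
Lipschitz constants needed for Efron–Stein. -/
theorem abs_logPart_sub_le [Nonempty S] {h h' : S → ℝ} {C : ℝ} (hC : ∀ σ, |h σ - h' σ| ≤ C) :
    |logPart h - logPart h'| ≤ C := by
  have key : ∀ h h' : S → ℝ, (∀ σ, |h σ - h' σ| ≤ C) → logPart h - logPart h' ≤ C := by
    intro h h' hC
    have h1 := logPart_add_gibbsAvg_le h (fun σ => h' σ - h σ)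
    have h2 := abs_le.1 (abs_gibbsAvg_le h (f := fun σ => h' σ - h σ) (C := C)
      fun σ => by rw [abs_sub_comm]; exact hC σ)
    simp only [add_sub_cancel] at h1
    linarith [h2.1]
  rw [abs_le]
  have h1 := key h h' hC
  have h2 := key h' h fun σ => by rw [abs_sub_comm]; exact hC σ
  constructor <;> linarith

/-- Replicas are independent once the disorder is fixed, so a sum over product configurations
distributes over the product. -/
theorem sum_pi_prod_mul_gibbs {k : ℕ} (h f : Fin k → S → ℝ) :
    ∑ σ : Fin k → S, (∏ j, f j (σ j)) *
        ∏ j, (Real.exp (h j (σ j)) / ∑ τ, Real.exp (h j τ)) = ∏ j, gibbsAvg (h j) (f j) := by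
  classical
  simp only [gibbsAvg, Finset.sum_div]
  rw [Finset.prod_univ_sum]
  simp only [Fintype.piFinset_univ, ← Finset.prod_mul_distrib, mul_div_assoc]

end Gibbs

end SpinGlass

namespace SpinGlass

/-! ### One Gaussian variable: integration by parts and Lipschitz variance bound. -/

section OneDimensional

variable {m : ℝ} {v : ℝ≥0}

theorem integrable_gaussianReal_iff (hv : v ≠ 0) {f : ℝ → ℝ} :
    Integrable f (gaussianReal m v) ↔ Integrable fun y => gaussianPDFReal m v y * f y := by
  rw [gaussianReal_of_var_ne_zero m hv, integrable_withDensity_iff_integrable_smul'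
    (measurable_gaussianPDF m v) (ae_of_all _ fun _ => gaussianPDF_lt_top)]
  simp only [toReal_gaussianPDF, smul_eq_mul]

theorem hasDerivAt_gaussianPDFReal (hv : v ≠ 0) (y : ℝ) :
    HasDerivAt (gaussianPDFReal m v) (-((y - m) / v) * gaussianPDFReal m v y) y := by
  have hv' : (v : ℝ) ≠ 0 := by exact_mod_cast hv
  have h1 : HasDerivAt (fun y : ℝ => -(y - m) ^ 2 / (2 * v)) (-((y - m) / v)) y := by
    refine (((((hasDerivAt_id y).sub_const m).pow 2).neg).div_const (2 * (v : ℝ))).congr_deriv ?_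
    simp
    field_simp
  rw [gaussianPDFReal_def]
  refine (h1.exp.const_mul _).congr_deriv ?_
  ring

/-- Gaussian integration by parts in one variable. -/
theorem integral_sub_mul_gaussianReal {f f' : ℝ → ℝ} (hf : ∀ y, HasDerivAt f (f' y) y)
    (h0 : Integrable f (gaussianReal m v))
    (h1 : Integrable (fun y => (y - m) * f y) (gaussianReal m v))
    (h2 : Integrable f' (gaussianReal m v)) :
    ∫ y, (y - m) * f y ∂(gaussianReal m v) = v * ∫ y, f' y ∂(gaussianReal m v) := by
  -- In the degenerate case the law is a point mass at m, where y − m vanishes; there is no density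
  -- to differentiate.
  by_cases hv : v = 0
  · subst hv
    simp
  have hv' : (v : ℝ) ≠ 0 := by exact_mod_cast hv
  rw [integrable_gaussianReal_iff hv] at h0 h1 h2
  rw [integral_gaussianReal_eq_integral_smul hv, integral_gaussianReal_eq_integral_smul hv]
  have key := integral_mul_deriv_eq_deriv_mul_of_integrable (u := f) (u' := f')
    (v := gaussianPDFReal m v) (v' := fun y => -((y - m) / v) * gaussianPDFReal m v y)
    (fun y _ => hf y) (fun y _ => hasDerivAt_gaussianPDFReal hv y)
    ((h1.const_mul (-(v : ℝ)⁻¹)).congr (ae_of_all _ fun y => by simp; ring))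
    (h2.congr (ae_of_all _ fun y => by simp; ring))
    (h0.congr (ae_of_all _ fun y => by simp; ring))
  simp only [smul_eq_mul]
  have e1 : ∫ y, gaussianPDFReal m v y * ((y - m) * f y)
      = -v * ∫ y, f y * (-((y - m) / v) * gaussianPDFReal m v y) := by
    rw [← integral_const_mul]
    refine integral_congr_ae (ae_of_all _ fun y => ?_)
    simp only
    field_simp
  rw [e1, key]
  simp only [mul_comm (gaussianPDFReal m v _)]
  ring

theorem integral_sub_sq_gaussianReal :
    ∫ y, (y - m) ^ 2 ∂(gaussianReal m v) = v := by
  have := variance_fun_id_gaussianReal (μ := m) (v := v)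
  rw [variance_eq_integral (by fun_prop)] at this
  simpa [integral_id_gaussianReal] using this

theorem memLp_sub_gaussianReal (p : ℝ≥0) :
    MemLp (fun y => y - m) p (gaussianReal m v) :=
  (memLp_id_gaussianReal p).sub (memLp_const m)

/-- A Lipschitz function of a Gaussian variable has variance at most the square of its Lipschitz
constant times the variance of the variable. -/
theorem integral_sub_sq_le_of_lipschitz {F : ℝ → ℝ} {L : ℝ} (hF : Measurable F)
    (hL : ∀ y y', |F y - F y'| ≤ L * |y - y'|) (c : ℝ) :
    MemLp F 2 (gaussianReal m v) ∧
    ∫ y, (F y - c) ^ 2 ∂(gaussianReal m v)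
      ≤ L ^ 2 * v + (∫ y, F y ∂(gaussianReal m v) - c) ^ 2 := by
  have hg := memLp_sub_gaussianReal (m := m) (v := v) 2
  have hd : MemLp (fun y => F y - F m) 2 (gaussianReal m v) := by
    refine hg.of_le_mul (c := L) (by fun_prop) (ae_of_all _ fun y => ?_)
    simpa using hL y m
  have hF2 : MemLp F 2 (gaussianReal m v) := by
    exact (hd.add (memLp_const (F m))).ae_eq (ae_of_all _ fun y => by simp)
  refine ⟨hF2, ?_⟩
  have hi := hd.integrable (by norm_num)
  have hi2 := hd.integrable_sq
  have e1 : ∫ y, (F y - F m) ∂(gaussianReal m v) = ∫ y, F y ∂(gaussianReal m v) - F m := by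
    rw [integral_sub (hF2.integrable (by norm_num)) (integrable_const _)]
    simp
  -- Recentring at F(m): the Lipschitz bound then compares with (y − m)², whose mean is exactly v,
  -- and the square of the mean of F − F(m) is discarded with the right sign.
  have e2 : ∫ y, (F y - c) ^ 2 ∂(gaussianReal m v)
      = ∫ y, (F y - F m) ^ 2 ∂(gaussianReal m v)
        + 2 * (F m - c) * (∫ y, F y ∂(gaussianReal m v) - F m) + (F m - c) ^ 2 := by
    have : ∀ y, (F y - c) ^ 2 = (F y - F m) ^ 2 + 2 * (F m - c) * (F y - F m) + (F m - c) ^ 2 :=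
      fun y => by ring
    have a1 : Integrable (fun y => 2 * (F m - c) * (F y - F m)) (gaussianReal m v) :=
      hi.const_mul _
    have a2 : Integrable (fun y => (F y - F m) ^ 2 + 2 * (F m - c) * (F y - F m))
      (gaussianReal m v) := hi2.add a1
    rw [integral_congr_ae (ae_of_all _ this), integral_add a2 (integrable_const _),
      integral_add hi2 a1, integral_const_mul, e1]
    simp
  have e3 : ∫ y, (F y - F m) ^ 2 ∂(gaussianReal m v) ≤ L ^ 2 * v := by
    rw [← integral_sub_sq_gaussianReal (m := m) (v := v), ← integral_const_mul]
    refine integral_mono hi2 (hg.integrable_sq.const_mul _) fun y => ?_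
    have := hL y m
    have := pow_le_pow_left₀ (abs_nonneg _) this 2
    rwa [mul_pow, sq_abs, sq_abs] at this
  rw [e2]
  nlinarith [sq_nonneg (∫ y, F y ∂(gaussianReal m v) - F m)]

end OneDimensional

theorem memLp_sub_infinitePi {ι : Type*} (m : ι → ℝ) (v : ι → ℝ≥0) (p : ℝ≥0) (i : ι) :
    MemLp (fun x : ι → ℝ => x i - m i) p
      (Measure.infinitePi fun i => gaussianReal (m i) (v i)) :=
  (memLp_sub_gaussianReal p).comp_measurePreserving
    (measurePreserving_eval_infinitePi (fun i => gaussianReal (m i) (v i)) i)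

/-! ### Families of independent Gaussians: resampling, integration by parts, Efron–Stein. -/

section Resampling

variable {ι : Type*} [DecidableEq ι]

/-- Resampling one coordinate of a product measure leaves it unchanged. -/
theorem measurePreserving_update (ν : ι → Measure ℝ) [∀ i, IsProbabilityMeasure (ν i)] (i : ι) :
    MeasurePreserving (fun p : (ι → ℝ) × ℝ => Function.update p.1 i p.2)
      ((Measure.infinitePi ν).prod (ν i)) (Measure.infinitePi ν) := by
  have hm : Measurable fun p : (ι → ℝ) × ℝ => Function.update p.1 i p.2 := by
    refine measurable_pi_iff.2 fun j => ?_
    by_cases h : j = i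
    · subst h
      simpa using measurable_snd
    · simp only [Function.update_of_ne h]
      exact (measurable_pi_apply j).comp measurable_fst
  refine ⟨hm, Measure.eq_infinitePi ν fun s t ht => ?_⟩
  have hst : MeasurableSet (Set.pi (s : Set ι) t) :=
    MeasurableSet.pi s.countable_toSet fun i _ => ht i
  rw [Measure.map_apply hm hst]
  -- The constraint on coordinate i, if there is one, moves to the fresh variable, so the preimage
  -- of a box is again a box.
  have : (fun p : (ι → ℝ) × ℝ => Function.update p.1 i p.2) ⁻¹' (Set.pi (s : Set ι) t)
      = (Set.pi ((s.erase i : Finset ι) : Set ι) t) ×ˢ (if i ∈ s then t i else Set.univ) := by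
    ext p
    simp only [Set.mem_preimage, Set.mem_pi, Set.mem_prod, Finset.mem_coe, Finset.mem_erase]
    constructor
    · intro h
      refine ⟨fun j hj => ?_, ?_⟩
      · simpa [Function.update_of_ne hj.1] using h j hj.2
      · split_ifs with hi
        · simpa using h i hi
        · trivial
    · rintro ⟨h1, h2⟩ j hj
      by_cases h : j = i
      · subst h
        simpa [hj] using h2
      · simpa [Function.update_of_ne h] using h1 j ⟨h, hj⟩
  rw [this, Measure.prod_prod, Measure.infinitePi_pi _ fun i _ => ht i]
  split_ifs with hi
  · rw [Finset.prod_erase_mul _ _ hi]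
  · rw [Finset.erase_eq_of_notMem hi, measure_univ, mul_one]

theorem integral_infinitePi_update (ν : ι → Measure ℝ) [∀ i, IsProbabilityMeasure (ν i)] (i : ι)
    {f : (ι → ℝ) → ℝ} (hf : Integrable f (Measure.infinitePi ν)) :
    ∫ x, f x ∂(Measure.infinitePi ν)
      = ∫ x, ∫ y, f (Function.update x i y) ∂(ν i) ∂(Measure.infinitePi ν) := by
  have hmp := measurePreserving_update ν i
  have h1 : ∫ x, f x ∂(Measure.infinitePi ν)
      = ∫ p : (ι → ℝ) × ℝ, f (Function.update p.1 i p.2) ∂((Measure.infinitePi ν).prod (ν i)) := by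
    conv_lhs => rw [← hmp.map_eq]
    rw [integral_map hmp.measurable.aemeasurable]
    rw [hmp.map_eq]
    exact hf.aestronglyMeasurable
  rw [h1]
  exact integral_prod _ (hmp.integrable_comp_of_integrable hf)

theorem ae_integrable_update (ν : ι → Measure ℝ) [∀ i, IsProbabilityMeasure (ν i)] (i : ι)
    {f : (ι → ℝ) → ℝ} (hf : Integrable f (Measure.infinitePi ν)) :
    ∀ᵐ x ∂(Measure.infinitePi ν), Integrable (fun y => f (Function.update x i y)) (ν i) :=
  ((measurePreserving_update ν i).integrable_comp_of_integrable hf).prod_right_ae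

/-- `f'` is the partial derivative of `f` in the direction of the coordinate `i`. -/
def HasCoordDeriv (i : ι) (f f' : (ι → ℝ) → ℝ) : Prop :=
  ∀ x y, HasDerivAt (fun z => f (Function.update x i z)) (f' (Function.update x i y)) y

theorem HasCoordDeriv.mul {i : ι} {f f' g g' : (ι → ℝ) → ℝ} (hf : HasCoordDeriv i f f')
    (hg : HasCoordDeriv i g g') :
    HasCoordDeriv i (fun x => f x * g x) (fun x => f' x * g x + f x * g' x) :=
  fun x y => (hf x y).fun_mul (hg x y)

theorem HasCoordDeriv.sub {i : ι} {f f' g g' : (ι → ℝ) → ℝ} (hf : HasCoordDeriv i f f')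
    (hg : HasCoordDeriv i g g') :
    HasCoordDeriv i (fun x => f x - g x) (fun x => f' x - g' x) :=
  fun x y => (hf x y).fun_sub (hg x y)

theorem HasCoordDeriv.add {i : ι} {f f' g g' : (ι → ℝ) → ℝ} (hf : HasCoordDeriv i f f')
    (hg : HasCoordDeriv i g g') :
    HasCoordDeriv i (fun x => f x + g x) (fun x => f' x + g' x) :=
  fun x y => (hf x y).fun_add (hg x y)

theorem HasCoordDeriv.const_mul {i : ι} {f f' : (ι → ℝ) → ℝ} (c : ℝ) (hf : HasCoordDeriv i f f') :
    HasCoordDeriv i (fun x => c * f x) (fun x => c * f' x) :=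
  fun x y => (hf x y).const_mul c

theorem HasCoordDeriv.congr {i : ι} {f f' g' : (ι → ℝ) → ℝ} (hf : HasCoordDeriv i f f')
    (h : ∀ x, f' x = g' x) : HasCoordDeriv i f g' :=
  fun x y => (hf x y).congr_deriv (h _)

theorem hasCoordDeriv_const (i : ι) (c : ℝ) : HasCoordDeriv i (fun _ => c) (fun _ => 0) :=
  fun _ y => hasDerivAt_const y c

/-- The case i = j creates the diagonal term when two integrations by parts are performed in
succession. -/
theorem hasCoordDeriv_sub_const (i j : ι) (c : ℝ) :
    HasCoordDeriv i (fun x => x j - c) (fun _ => if i = j then 1 else 0) := by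
  intro x y
  by_cases h : i = j
  · subst h
    simpa using (hasDerivAt_id y).sub_const c
  · simpa [Function.update_of_ne (Ne.symm h), h] using hasDerivAt_const y (x j - c)

variable (m : ι → ℝ) (v : ι → ℝ≥0)

/-- Gaussian integration by parts for a family of independent Gaussian variables. -/
theorem integral_sub_mul_infinitePi {i : ι} {f f' : (ι → ℝ) → ℝ} (hf : HasCoordDeriv i f f')
    (h0 : Integrable f (Measure.infinitePi fun i => gaussianReal (m i) (v i)))
    (h1 : Integrable (fun x => (x i - m i) * f x)
      (Measure.infinitePi fun i => gaussianReal (m i) (v i)))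
    (h2 : Integrable f' (Measure.infinitePi fun i => gaussianReal (m i) (v i))) :
    ∫ x, (x i - m i) * f x ∂(Measure.infinitePi fun i => gaussianReal (m i) (v i))
      = v i * ∫ x, f' x ∂(Measure.infinitePi fun i => gaussianReal (m i) (v i)) := by
  rw [integral_infinitePi_update _ i h1, integral_infinitePi_update _ i h2, ← integral_const_mul]
  refine integral_congr_ae ?_
  filter_upwards [ae_integrable_update _ i h0, ae_integrable_update _ i h1,
    ae_integrable_update _ i h2] with x k0 k1 k2
  simp only [Function.update_self] at k1 ⊢
  exact integral_sub_mul_gaussianReal (hf x) k0 k1 k2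

/-- The Efron–Stein inequality for functions of finitely many independent Gaussian variables that
are Lipschitz in each variable. -/
theorem variance_le_of_coord_lipschitz (L : ι → ℝ) (S : Finset ι) :
    ∀ f : (ι → ℝ) → ℝ, Measurable f → (∀ x x', (∀ i ∈ S, x i = x' i) → f x = f x') →
      (∀ x i y y', |f (Function.update x i y) - f (Function.update x i y')| ≤ L i * |y - y'|) →
      MemLp f 2 (Measure.infinitePi fun i => gaussianReal (m i) (v i)) ∧
      Var[f; Measure.infinitePi fun i => gaussianReal (m i) (v i)]
        ≤ ∑ i ∈ S, L i ^ 2 * v i := by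
  induction S using Finset.induction_on with
  | empty =>
    intro f _ hd _
    have hc : f = fun _ => f 0 := funext fun x => hd _ _ (by simp)
    rw [hc]
    refine ⟨memLp_const _, ?_⟩
    rw [variance_eq_integral (by fun_prop)]
    simp
  | insert i S hi ih =>
    intro f hf hd hL
    set P := Measure.infinitePi fun i => gaussianReal (m i) (v i) with hP
    set γ := gaussianReal (m i) (v i) with hγ
    have hu : ∀ x : ι → ℝ, Measurable fun y : ℝ => Function.update x i y :=
      fun x => measurable_update x
    have hfu : ∀ x, Measurable fun y => f (Function.update x i y) := fun x => hf.comp (hu x)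
    have h1 := fun (x : ι → ℝ) (c : ℝ) =>
      integral_sub_sq_le_of_lipschitz (m := m i) (v := v i) (hfu x) (hL x i) c
    have hint : ∀ x, Integrable (fun y => f (Function.update x i y)) γ :=
      fun x => (h1 x 0).1.integrable (by norm_num)
    -- Averaging out coordinate i leaves a function of the coordinates in S that keeps the same
    -- Lipschitz constants, so the induction hypothesis applies to it.
    set g : (ι → ℝ) → ℝ := fun x => ∫ y, f (Function.update x i y) ∂γ with hg
    have hgm : Measurable g := by
      have : StronglyMeasurable fun p : (ι → ℝ) × ℝ => f (Function.update p.1 i p.2) :=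
        (hf.comp (measurePreserving_update (fun i => gaussianReal (m i) (v i)) i).measurable).stronglyMeasurable
      exact this.integral_prod_right.measurable
    have hgd : ∀ x x', (∀ j ∈ S, x j = x' j) → g x = g x' := by
      intro x x' h
      refine integral_congr_ae (ae_of_all _ fun y => hd _ _ fun j hj => ?_)
      by_cases hji : j = i
      · subst hji; simp
      · simpa [Function.update_of_ne hji] using h j (Finset.mem_of_mem_insert_of_ne hj hji)
    have hgL : ∀ x j y y',
        |g (Function.update x j y) - g (Function.update x j y')| ≤ L j * |y - y'| := by
      intro x j y y'
      have hLj : 0 ≤ L j * |y - y'| := (abs_nonneg _).trans (hL x j y y')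
      simp only [hg]
      by_cases hji : j = i
      · subst hji
        simpa using hLj
      · rw [← integral_sub (hint _) (hint _)]
        have : ‖∫ z, (f (Function.update (Function.update x j y) i z)
            - f (Function.update (Function.update x j y') i z)) ∂γ‖
            ≤ (L j * |y - y'|) * γ.real Set.univ := by
          refine norm_integral_le_of_norm_le_const (ae_of_all _ fun z => ?_)
          rw [Function.update_comm hji, Function.update_comm hji]
          exact hL _ _ _ _
        simpa using this
    obtain ⟨hg2, hgv⟩ := ih g hgm hgd hgL
    -- Square integrability of f is not assumed. It follows from that of g, since f − g is at most
    -- L_i (|x_i − m_i| + E|y − m_i|).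
    have hfg : MemLp (fun x => f x - g x) 2 P := by
      have hb : MemLp (fun x : ι → ℝ => |x i - m i| + ∫ y, |y - m i| ∂γ) 2 P :=
        (memLp_sub_infinitePi m v 2 i).abs.add (memLp_const _)
      refine hb.of_le_mul (c := L i) (by fun_prop) (ae_of_all _ fun x => ?_)
      have hx : f x - g x = (f (Function.update x i (x i)) - f (Function.update x i (m i)))
          - ∫ y, (f (Function.update x i y) - f (Function.update x i (m i))) ∂γ := by
        rw [integral_sub (hint x) (integrable_const _)]
        simp [hg]
      have hy : ‖∫ y, (f (Function.update x i y) - f (Function.update x i (m i))) ∂γ‖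
          ≤ ∫ y, L i * |y - m i| ∂γ := by
        refine norm_integral_le_of_norm_le ?_ (ae_of_all _ fun y => hL x i y (m i))
        exact (((memLp_sub_gaussianReal 2).integrable (by norm_num)).abs).const_mul _
      have hp : 0 ≤ |x i - m i| + ∫ y, |y - m i| ∂γ := by positivity
      rw [Real.norm_eq_abs, Real.norm_eq_abs, abs_of_nonneg hp, hx, mul_add, ← integral_const_mul]
      refine (abs_sub _ _).trans ?_
      gcongr
      · exact hL x i _ _
      · exact hy
    have hf2 : MemLp f 2 P := by exact (hfg.add hg2).ae_eq (ae_of_all _ fun x => by simp)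
    refine ⟨hf2, ?_⟩
    have hmean : ∫ x, f x ∂P = ∫ x, g x ∂P :=
      integral_infinitePi_update (fun i => gaussianReal (m i) (v i)) i
        (hf2.integrable (by norm_num))
    rw [variance_eq_integral hf.aemeasurable, Finset.sum_insert hi]
    rw [variance_eq_integral hgm.aemeasurable] at hgv
    set c := ∫ x, f x ∂P
    rw [← hmean] at hgv
    have hfc : Integrable (fun x => (f x - c) ^ 2) P := (hf2.sub (memLp_const c)).integrable_sq
    have hgc : Integrable (fun x => (g x - c) ^ 2) P := (hg2.sub (memLp_const c)).integrable_sq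
    have hmp := measurePreserving_update (fun i => gaussianReal (m i) (v i)) i
    rw [integral_infinitePi_update (fun i => gaussianReal (m i) (v i)) i hfc]
    -- Conditional decomposition of the variance: the fluctuation in coordinate i costs L_i² v_i and
    -- what remains is the variance of g around the common mean c.
    calc ∫ x, ∫ y, (f (Function.update x i y) - c) ^ 2 ∂γ ∂P
        ≤ ∫ x, (L i ^ 2 * v i + (g x - c) ^ 2) ∂P := by
          refine integral_mono (hmp.integrable_comp_of_integrable hfc).integral_prod_left
            ((integrable_const _).add hgc) fun x => (h1 x c).2
      _ = L i ^ 2 * v i + ∫ x, (g x - c) ^ 2 ∂P := by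
          rw [integral_add (integrable_const _) hgc]
          simp
      _ ≤ _ := by linarith

end Resampling

end SpinGlass

namespace SpinGlass

theorem memLp_two_of_abs_le {Ω : Type*} [MeasurableSpace Ω] {P : Measure Ω} {X G : Ω → ℝ}
    (hX : Measurable X) (hG : MemLp G 2 P)
    (h : ∀ ω, |X ω| ≤ G ω) : MemLp X 2 P :=
  hG.mono hX.aestronglyMeasurable
    (ae_of_all _ fun ω => (h ω).trans (le_abs_self _))

/-! ### Variances, and covariances of integrals over a parameter. -/

section Covariance

variable {Ω : Type*} [MeasurableSpace Ω] {P : Measure Ω}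
  {α : Type*} [MeasurableSpace α] {T : Measure α} [IsFiniteMeasure T]

theorem measurable_integral_param {φ : α → Ω → ℝ} (hφ : Measurable (Function.uncurry φ)) :
    Measurable fun ω => ∫ t, φ t ω ∂T :=
  (StronglyMeasurable.integral_prod_left (f := φ) hφ.stronglyMeasurable).measurable

theorem memLp_integral_param {φ : α → Ω → ℝ} (hφ : Measurable (Function.uncurry φ)) {G : Ω → ℝ}
    (hG : MemLp G 2 P) (hφG : ∀ t ω, |φ t ω| ≤ G ω) :
    MemLp (fun ω => ∫ t, φ t ω ∂T) 2 P := by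
  refine memLp_two_of_abs_le (measurable_integral_param hφ) (hG.mul_const (T.real Set.univ))
    fun ω => ?_
  exact norm_integral_le_of_norm_le_const (f := fun t => φ t ω) (ae_of_all _ fun t => hφG t ω)

variable [IsProbabilityMeasure P]

/-- Parallelogram identity for variances, with the nonnegative variance of X − Y dropped. -/
theorem variance_add_le {X Y : Ω → ℝ} (hX : MemLp X 2 P) (hY : MemLp Y 2 P) :
    Var[fun ω => X ω + Y ω; P] ≤ 2 * Var[X; P] + 2 * Var[Y; P] := by
  have h1 := variance_fun_add hX hY
  have h2 := variance_fun_sub hX hY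
  have h3 := variance_nonneg (fun ω => X ω - Y ω) P
  linarith

theorem variance_sub_le {X Y : Ω → ℝ} (hX : MemLp X 2 P) (hY : MemLp Y 2 P) :
    Var[fun ω => X ω - Y ω; P] ≤ 2 * Var[X; P] + 2 * Var[Y; P] := by
  have h1 := variance_fun_add hX hY
  have h2 := variance_fun_sub hX hY
  have h3 := variance_nonneg (fun ω => X ω + Y ω) P
  linarith

theorem integral_integral_param {φ : α → Ω → ℝ} (hφ : Measurable (Function.uncurry φ)) {G : Ω → ℝ}
    (hG : Integrable G P) (hφG : ∀ t ω, |φ t ω| ≤ G ω) :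
    Integrable (fun t => ∫ ω, φ t ω ∂P) T ∧
    ∫ ω, ∫ t, φ t ω ∂T ∂P = ∫ t, ∫ ω, φ t ω ∂P ∂T := by
  have hi : Integrable (Function.uncurry fun ω t => φ t ω) (P.prod T) := by
    refine (hG.comp_fst T).mono (hφ.comp measurable_swap).aestronglyMeasurable
      (ae_of_all _ fun p => ?_)
    exact (hφG p.2 p.1).trans (le_abs_self _)
  exact ⟨hi.integral_prod_right, integral_integral_swap hi⟩

/-- The covariance of two integrals over a parameter is the double integral of the covariances. -/
theorem covariance_integral {φ ψ : α → Ω → ℝ} (hφ : Measurable (Function.uncurry φ))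
    (hψ : Measurable (Function.uncurry ψ)) {G : Ω → ℝ} (hG : MemLp G 2 P)
    (hφG : ∀ t ω, |φ t ω| ≤ G ω) (hψG : ∀ t ω, |ψ t ω| ≤ G ω) :
    cov[fun ω => ∫ t, φ t ω ∂T, fun ω => ∫ s, ψ s ω ∂T; P]
      = ∫ t, ∫ s, cov[φ t, ψ s; P] ∂T ∂T := by
  have hG1 := hG.integrable (by norm_num)
  have hφ2 : ∀ t, MemLp (φ t) 2 P := fun t =>
    memLp_two_of_abs_le (hφ.comp measurable_prodMk_left) hG (hφG t)
  have hψ2 : ∀ t, MemLp (ψ t) 2 P := fun t =>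
    memLp_two_of_abs_le (hψ.comp measurable_prodMk_left) hG (hψG t)
  obtain ⟨i1, e1⟩ := integral_integral_param (T := T) hφ hG1 hφG
  obtain ⟨i2, e2⟩ := integral_integral_param (T := T) hψ hG1 hψG
  have hm : Measurable (Function.uncurry fun (p : α × α) ω => φ p.1 ω * ψ p.2 ω) :=
    (hφ.comp ((measurable_fst.comp measurable_fst).prodMk measurable_snd)).mul
      (hψ.comp ((measurable_snd.comp measurable_fst).prodMk measurable_snd))
  obtain ⟨i3, e3⟩ := integral_integral_param (T := T.prod T) hm hG.integrable_sq (fun p ω => by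
    rw [abs_mul, sq]
    exact mul_le_mul (hφG _ _) (hψG _ _) (abs_nonneg _) ((abs_nonneg _).trans (hφG p.1 ω)))
  have i4 : Integrable (fun p : α × α => (∫ ω, φ p.1 ω ∂P) * ∫ ω, ψ p.2 ω ∂P) (T.prod T) :=
    i1.mul_prod i2
  rw [covariance_eq_sub (memLp_integral_param hφ hG hφG) (memLp_integral_param hψ hG hψG)]
  have e5 : ∫ t, ∫ s, cov[φ t, ψ s; P] ∂T ∂T
      = ∫ p : α × α, ((∫ ω, φ p.1 ω * ψ p.2 ω ∂P) - (∫ ω, φ p.1 ω ∂P) * ∫ ω, ψ p.2 ω ∂P)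
        ∂(T.prod T) := by
    refine Eq.trans ?_ (integral_prod _ (i3.sub i4)).symm
    refine integral_congr_ae (ae_of_all _ fun t => integral_congr_ae (ae_of_all _ fun s => ?_))
    exact covariance_eq_sub (hφ2 t) (hψ2 s)
  rw [e5, integral_sub i3 i4, ← e3, e1, e2, integral_prod_mul (fun t => ∫ ω, φ t ω ∂P)
    (fun s => ∫ ω, ψ s ω ∂P)]
  congr 1
  refine integral_congr_ae (ae_of_all _ fun ω => ?_)
  exact (integral_prod_mul (fun t => φ t ω) (fun s => ψ s ω)).symm

end Covariance

/-! ### Integrals over the square of interpolation parameters. -/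

section SquareIntegral

/-- The integral over the square `[-1, 1]²`. -/
noncomputable def squareIntegral (F : ℝ → ℝ → ℝ) : ℝ :=
  ∫ t in (-1 : ℝ)..1, ∫ s in (-1 : ℝ)..1, F t s

variable {F G : ℝ → ℝ → ℝ}

theorem squareIntegral_add (hF : Continuous (Function.uncurry F))
    (hG : Continuous (Function.uncurry G)) :
    squareIntegral (fun t s => F t s + G t s) = squareIntegral F + squareIntegral G := by
  unfold squareIntegral
  rw [← intervalIntegral.integral_add]
  · refine intervalIntegral.integral_congr fun t _ => ?_
    exact intervalIntegral.integral_add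
      ((hF.comp (by fun_prop : Continuous fun s => (t, s))).intervalIntegrable _ _)
      ((hG.comp (by fun_prop : Continuous fun s => (t, s))).intervalIntegrable _ _)
  · exact (intervalIntegral.continuous_parametric_intervalIntegral_of_continuous' hF _
      _).intervalIntegrable _ _
  · exact (intervalIntegral.continuous_parametric_intervalIntegral_of_continuous' hG _
      _).intervalIntegrable _ _

theorem squareIntegral_const_mul (c : ℝ) (F : ℝ → ℝ → ℝ) :
    squareIntegral (fun t s => c * F t s) = c * squareIntegral F := by
  simp only [squareIntegral, intervalIntegral.integral_const_mul]

theorem squareIntegral_sub (hF : Continuous (Function.uncurry F))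
    (hG : Continuous (Function.uncurry G)) :
    squareIntegral (fun t s => F t s - G t s) = squareIntegral F - squareIntegral G := by
  have hG' : Continuous (Function.uncurry fun t s => (-1) * G t s) :=
    (continuous_const (y := (-1 : ℝ))).mul hG
  have := squareIntegral_add hF hG'
  rw [squareIntegral_const_mul] at this
  simpa [sub_eq_add_neg] using this

theorem squareIntegral_swap (hF : Continuous (Function.uncurry F)) :
    squareIntegral (fun t s => F s t) = squareIntegral F := by
  refine intervalIntegral_intervalIntegral_swap (F := fun t s => F s t) ?_
  have hc : Continuous (Function.uncurry fun t s => F s t) := hF.comp continuous_swap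
  refine (hc.continuousOn.integrableOn_compact (isCompact_uIcc.prod isCompact_uIcc)).mono_set
    (Set.prod_mono Set.uIoc_subset_uIcc Set.uIoc_subset_uIcc)

/-- By oddness in t. For this reason the d_{Λ'} term of the magnetic part contributes nothing, and
it is irrelevant that d_{Λ'} counts X = ∅ although σ_∅ = 0. -/
theorem squareIntegral_mul_eq_zero (g : ℝ → ℝ) : squareIntegral (fun t s => t * g s) = 0 := by
  simp only [squareIntegral, intervalIntegral.integral_const_mul,
    intervalIntegral.integral_mul_const]
  simp

theorem squareIntegral_mono (hF : Continuous (Function.uncurry F))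
    (hG : Continuous (Function.uncurry G)) (h : ∀ t s, F t s ≤ G t s) :
    squareIntegral F ≤ squareIntegral G := by
  refine intervalIntegral.integral_mono_on (by norm_num) ?_ ?_ fun t _ =>
    intervalIntegral.integral_mono_on (by norm_num)
      ((hF.comp (by fun_prop : Continuous fun s => (t, s))).intervalIntegrable _ _)
      ((hG.comp (by fun_prop : Continuous fun s => (t, s))).intervalIntegrable _ _)
      fun s _ => h t s
  · exact (intervalIntegral.continuous_parametric_intervalIntegral_of_continuous' hF _
      _).intervalIntegrable _ _
  · exact (intervalIntegral.continuous_parametric_intervalIntegral_of_continuous' hG _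
      _).intervalIntegrable _ _

theorem abs_squareIntegral_le {C : ℝ} (h : ∀ t s, |F t s| ≤ C) : |squareIntegral F| ≤ 4 * C := by
  have h1 : ∀ t, |∫ s in (-1 : ℝ)..1, F t s| ≤ 2 * C := by
    intro t
    have := intervalIntegral.norm_integral_le_of_norm_le_const (a := (-1 : ℝ)) (b := 1)
      (f := F t) (C := C) fun s _ => h t s
    norm_num at this
    linarith
  have := intervalIntegral.norm_integral_le_of_norm_le_const (a := (-1 : ℝ)) (b := 1)
    (f := fun t => ∫ s in (-1 : ℝ)..1, F t s) (C := 2 * C) fun t _ => h1 t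
  norm_num at this
  unfold squareIntegral
  linarith

end SquareIntegral

/-! ### Fluctuations of the derivative of a random convex function. -/

section Convexity

variable {Ω : Type*} [MeasurableSpace Ω] {P : Measure Ω} [IsProbabilityMeasure P]

/-- A second difference is the increment over h of the first difference g, so its integral
telescopes to two boundary integrals of length h, on which |g| ≤ Lh. The bound does not depend on b
− a. -/
theorem integral_second_difference_le {f : ℝ → ℝ} {L : ℝ} (hf : ∀ x y, |f x - f y| ≤ L * |x - y|)
    (a b : ℝ) {h : ℝ} (hh : 0 < h) :
    ∫ x in a..b, (f (x + h) - 2 * f x + f (x - h)) ≤ 2 * L * h ^ 2 := by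
  have hL : 0 ≤ L := by simpa using (abs_nonneg _).trans (hf 1 0)
  have hc : Continuous f := by
    have : LipschitzWith ⟨L, hL⟩ f := LipschitzWith.of_dist_le_mul fun x y => hf x y
    exact this.continuous
  set g : ℝ → ℝ := fun x => f x - f (x - h) with hg
  have hgc : Continuous g := by fun_prop
  have hgi : ∀ a b, IntervalIntegrable g volume a b := fun a b => hgc.intervalIntegrable a b
  have hgb : ∀ x, |g x| ≤ L * h := fun x => by
    have := hf x (x - h)
    rwa [sub_sub_cancel, abs_of_pos hh] at this
  have hb : ∀ c, |∫ x in c..(c + h), g x| ≤ L * h * h := fun c => by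
    have := intervalIntegral.norm_integral_le_of_norm_le_const (a := c) (b := c + h)
      (f := g) (C := L * h) fun s _ => hgb s
    rwa [add_sub_cancel_left, abs_of_pos hh] at this
  have e : ∫ x in a..b, (f (x + h) - 2 * f x + f (x - h))
      = (∫ x in b..(b + h), g x) - ∫ x in a..(a + h), g x := by
    have e1 : ∫ x in a..b, (f (x + h) - 2 * f x + f (x - h))
        = ∫ x in a..b, (g (x + h) - g x) := by
      refine intervalIntegral.integral_congr fun x _ => ?_
      simp only [hg, add_sub_cancel_right]
      ring
    rw [e1, intervalIntegral.integral_sub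
      ((by fun_prop : Continuous fun x => g (x + h)).intervalIntegrable _ _) (hgi _ _),
      intervalIntegral.integral_comp_add_right]
    have h1 := intervalIntegral.integral_add_adjacent_intervals (hgi (a + h) b) (hgi b (b + h))
    have h2 := intervalIntegral.integral_add_adjacent_intervals (hgi a (a + h)) (hgi (a + h) b)
    linarith
  rw [e]
  have h1 := abs_le.1 (hb b)
  have h2 := abs_le.1 (hb a)
  nlinarith [h1.2, h2.1]

/-- For a random convex function `F` with small fluctuations, the fluctuations of the derivative
`F'` are small on average over the parameter. -/
theorem integral_variance_deriv_le {F F' : ℝ → Ω → ℝ} {L V : ℝ}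
    (hF : ∀ x, MemLp (F x) 2 P) (hF' : ∀ x, Measurable (F' x))
    (htan : ∀ x y ω, F x ω + (y - x) * F' x ω ≤ F y ω) (hL : ∀ x ω, |F' x ω| ≤ L)
    (hV : ∀ x, Var[F x; P] ≤ V) (hcont : Continuous fun x => Var[F' x; P])
    {a b : ℝ} (hab : a ≤ b) {h : ℝ} (hh : 0 < h) :
    ∫ x in a..b, Var[F' x; P] ≤ 8 * V / h ^ 2 * (b - a) + 8 * L ^ 2 * h := by
  have hlip : ∀ x y ω, |F x ω - F y ω| ≤ L * |x - y| := by
    have key : ∀ x y ω, F x ω - F y ω ≤ L * |x - y| := fun x y ω => by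
      have h1 := htan x y ω
      have h2 : (x - y) * F' x ω ≤ |x - y| * L :=
        (le_abs_self _).trans ((abs_mul _ _).trans_le
          (mul_le_mul_of_nonneg_left (hL x ω) (abs_nonneg _)))
      linarith
    intro x y ω
    rw [abs_le]
    have h1 := key x y ω
    have h2 := key y x ω
    rw [abs_sub_comm] at h2
    constructor <;> linarith
  have hFi : ∀ x, Integrable (F x) P := fun x => (hF x).integrable (by norm_num)
  set f : ℝ → ℝ := fun x => ∫ ω, F x ω ∂P with hf
  have hflip : ∀ x y, |f x - f y| ≤ L * |x - y| := by
    intro x y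
    simp only [hf]
    rw [← integral_sub (hFi x) (hFi y)]
    simpa using norm_integral_le_of_norm_le_const (μ := P)
      (f := fun ω => F x ω - F y ω) (ae_of_all _ fun ω => hlip x y ω)
  have hL0 : 0 ≤ L := by simpa using (abs_nonneg _).trans (hflip 1 0)
  have hfc : Continuous f := by
    have : LipschitzWith ⟨L, hL0⟩ f := LipschitzWith.of_dist_le_mul fun x y => hflip x y
    exact this.continuous
  have hpt : ∀ x, Var[F' x; P]
      ≤ 8 * V / h ^ 2 + 4 * L / h * (f (x + h) - 2 * f x + f (x - h)) := by
    intro x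
    have hF'2 : MemLp (F' x) 2 P := memLp_two_of_abs_le (hF' x) (memLp_const L) (hL x)
    -- The backward difference quotient: its variance is controlled by V, and convexity places it
    -- below the derivative, so the error has a sign.
    set D : Ω → ℝ := fun ω => h⁻¹ * (F x ω - F (x - h) ω) with hD
    have hD2 : MemLp D 2 P := ((hF x).sub (hF (x - h))).const_mul _
    have hR2 : MemLp (fun ω => F' x ω - D ω) 2 P := hF'2.sub hD2
    have hvD : Var[D; P] ≤ 4 * V / h ^ 2 := by
      have h1 := variance_sub_le (hF x) (hF (x - h))
      have h2 : Var[fun ω => F x ω - F (x - h) ω; P] ≤ 4 * V := by linarith [hV x, hV (x - h)]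
      rw [hD, variance_const_mul, inv_pow, div_eq_inv_mul]
      gcongr
    have hsum : (fun ω => D ω + (F' x ω - D ω)) = F' x := by
      ext ω; ring
    have hv := variance_add_le hD2 hR2
    rw [hsum] at hv
    have hR : Var[fun ω => F' x ω - D ω; P]
        ≤ 2 * L / h * (f (x + h) - 2 * f x + f (x - h)) := by
      refine (variance_le_expectation_sq hR2.aestronglyMeasurable).trans ?_
      have i1 : Integrable (fun ω => F (x + h) ω - 2 * F x ω) P :=
        (hFi (x + h)).sub ((hFi x).const_mul 2)
      have i2 : Integrable (fun ω => F (x + h) ω - 2 * F x ω + F (x - h) ω) P :=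
        i1.add (hFi (x - h))
      have e : f (x + h) - 2 * f x + f (x - h)
          = ∫ ω, (F (x + h) ω - 2 * F x ω + F (x - h) ω) ∂P := by
        rw [integral_add i1 (hFi _), integral_sub (hFi _) ((hFi x).const_mul 2),
          integral_const_mul]
      rw [e, ← integral_const_mul]
      refine integral_mono hR2.integrable_sq (i2.const_mul _) fun ω => ?_
      have t1 := htan x (x - h) ω
      have t2 := htan x (x + h) ω
      have l1 := hlip x (x - h) ω
      rw [sub_sub_cancel, abs_of_pos hh] at l1
      have hDh : h * D ω = F x ω - F (x - h) ω := by
        simp only [hD]; field_simp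
      have p1 : 0 ≤ F' x ω - D ω := by
        have : 0 ≤ h * (F' x ω - D ω) := by nlinarith
        exact nonneg_of_mul_nonneg_right this hh
      have p2 : F' x ω - D ω ≤ 2 * L := by
        have h1 := (abs_le.1 (hL x ω)).2
        have h2 := (abs_le.1 l1).1
        have : 0 ≤ h * (2 * L - (F' x ω - D ω)) := by nlinarith
        linarith [nonneg_of_mul_nonneg_right this hh]
      have p3 : h * (F' x ω - D ω) ≤ F (x + h) ω - 2 * F x ω + F (x - h) ω := by nlinarith
      simp only [Pi.pow_apply]
      -- The error lies in [0, 2L], so its square is at most 2L times itself. This makes the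
      -- estimate linear in the second difference, whose integral over x is O(h²).
      calc (F' x ω - D ω) ^ 2 ≤ 2 * L * (F' x ω - D ω) := by nlinarith
        _ = 2 * L / h * (h * (F' x ω - D ω)) := by field_simp
        _ ≤ _ := by gcongr
    calc Var[F' x; P] ≤ 2 * (4 * V / h ^ 2)
          + 2 * (2 * L / h * (f (x + h) - 2 * f x + f (x - h))) := by linarith
      _ = _ := by ring
  have hsd : Continuous fun x => f (x + h) - 2 * f x + f (x - h) := by fun_prop
  calc ∫ x in a..b, Var[F' x; P]
      ≤ ∫ x in a..b, (8 * V / h ^ 2 + 4 * L / h * (f (x + h) - 2 * f x + f (x - h))) :=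
        intervalIntegral.integral_mono hab (hcont.intervalIntegrable _ _)
          ((by fun_prop : Continuous fun x =>
            8 * V / h ^ 2 + 4 * L / h * (f (x + h) - 2 * f x + f (x - h))).intervalIntegrable _ _)
          hpt
    _ = 8 * V / h ^ 2 * (b - a)
        + 4 * L / h * ∫ x in a..b, (f (x + h) - 2 * f x + f (x - h)) := by
        rw [intervalIntegral.integral_add (by simp)
          ((hsd.const_mul _).intervalIntegrable _ _), intervalIntegral.integral_const_mul,
          intervalIntegral.integral_const, smul_eq_mul]
        ring
    _ ≤ 8 * V / h ^ 2 * (b - a) + 4 * L / h * (2 * L * h ^ 2) := by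
        gcongr
        exact integral_second_difference_le hflip a b hh
    _ = _ := by field_simp; ring

end Convexity

end SpinGlass

namespace SpinGlass

variable {d : ℕ}

/-! ### The interpolating Hamiltonian as a linear function of the couplings. -/

section Hamiltonian

variable {Λ : Finset (Site d)}

/-- The convention σ_∅ = 0 is the origin of every indicator of X ≠ ∅ below. -/
theorem spinProd_sq (X : Finset (Site d)) (σ : Config Λ) :
    spinProd X σ * spinProd X σ = if X = ∅ then 0 else 1 := by
  unfold spinProd
  split_ifs with h
  · simp
  · rw [← Finset.prod_mul_distrib]
    refine Finset.prod_eq_one fun i _ => ?_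
    rcases Int.units_eq_one_or (σ i) with h | h <;> simp [h]

theorem abs_spinProd_le (X : Finset (Site d)) (σ : Config Λ) : |spinProd X σ| ≤ 1 := by
  unfold spinProd
  split_ifs with h
  · simp
  · rw [Finset.abs_prod]
    refine (Finset.prod_eq_one fun i _ => ?_).le
    rcases Int.units_eq_one_or (σ i) with h | h <;> simp [h]

/-- Collecting both parts into one sum shows each coupling once, with weight t inside Λ' and weight
1 otherwise. -/
theorem hamLinear_eq {Λ' : Finset (Site d)} (hsub : Λ' ⊆ Λ) (J : Disorder d) (t : ℝ)
    (σ : Config Λ) :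
    hamLinear Λ' J t σ
      = -∑ X ∈ Λ.powerset, J X * ((if X ⊆ Λ' then t else 1) * spinProd X σ) := by
  have h1 : Λ.powerset.filter (fun X => X ⊆ Λ') = Λ'.powerset := by
    ext X
    simp only [Finset.mem_filter, Finset.mem_powerset]
    exact ⟨fun h => h.2, fun h => ⟨h.trans hsub, h⟩⟩
  rw [← Finset.sum_filter_add_sum_filter_not _ (fun X => X ⊆ Λ'), h1]
  simp only [hamLinear, hamInside, hamOutside]
  have h2 : ∑ X ∈ Λ'.powerset, J X * ((if X ⊆ Λ' then t else 1) * spinProd X σ)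
      = t * ∑ X ∈ Λ'.powerset, J X * spinProd X σ := by
    rw [Finset.mul_sum]
    refine Finset.sum_congr rfl fun X hX => ?_
    rw [if_pos (Finset.mem_powerset.1 hX)]
    ring
  have h3 : ∑ X ∈ Λ.powerset with ¬ X ⊆ Λ', J X * ((if X ⊆ Λ' then t else 1) * spinProd X σ)
      = ∑ X ∈ Λ.powerset with ¬ X ⊆ Λ', J X * spinProd X σ := by
    refine Finset.sum_congr rfl fun X hX => ?_
    rw [if_neg (Finset.mem_filter.1 hX).2, one_mul]
  rw [h2, h3]
  ring

theorem hamLinear_update_sub {Λ' : Finset (Site d)} (hsub : Λ' ⊆ Λ) (J : Disorder d) (t : ℝ)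
    (X : Finset (Site d)) (y y' : ℝ) (σ : Config Λ) :
    hamLinear Λ' (Function.update J X y) t σ - hamLinear Λ' (Function.update J X y') t σ
      = if X ∈ Λ.powerset then -((y - y') * ((if X ⊆ Λ' then t else 1) * spinProd X σ)) else 0 := by
  rw [hamLinear_eq hsub, hamLinear_eq hsub, neg_sub_neg, ← Finset.sum_sub_distrib]
  have h0 : ∀ Y ∈ Λ.powerset, Y ≠ X →
      Function.update J X y' Y * ((if Y ⊆ Λ' then t else 1) * spinProd Y σ)
        - Function.update J X y Y * ((if Y ⊆ Λ' then t else 1) * spinProd Y σ) = 0 := by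
    intro Y _ hY
    rw [Function.update_of_ne hY, Function.update_of_ne hY, sub_self]
  split_ifs with hX h
  · rw [Finset.sum_eq_single_of_mem X hX h0]
    simp [h]
    ring
  · rw [Finset.sum_eq_single_of_mem X hX h0]
    simp [h]
    ring
  · exact Finset.sum_eq_zero fun Y hY => h0 Y hY fun h => hX (h ▸ hY)

theorem continuous_hamLinear (Λ' : Finset (Site d)) (σ : Config Λ) :
    Continuous fun p : ℝ × Disorder d => hamLinear Λ' p.2 p.1 σ := by
  unfold hamLinear hamInside hamOutside
  fun_prop

end Hamiltonian

/-! ### Random Gibbs states and the log-partition function. -/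

section States

variable (β : ℝ) (Λ Λ' : Finset (Site d))

/-- The random Gibbs state `ω_t`. -/
noncomputable def gibbsState (t : ℝ) (f : Config Λ → ℝ) (J : Disorder d) : ℝ :=
  gibbsAvg (fun σ : Config Λ => -β * hamLinear Λ' J t σ) f

/-- The logarithm of the partition function. -/
noncomputable def logPartition (t : ℝ) (J : Disorder d) : ℝ :=
  logPart (fun σ : Config Λ => -β * hamLinear Λ' J t σ)

theorem continuous_gibbsState (f : Config Λ → ℝ) :
    Continuous fun p : ℝ × Disorder d => gibbsState β Λ Λ' p.1 f p.2 :=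
  continuous_gibbsAvg (fun σ => continuous_const.mul (continuous_hamLinear Λ' σ)) f

theorem continuous_logPartition :
    Continuous fun p : ℝ × Disorder d => logPartition β Λ Λ' p.1 p.2 :=
  continuous_logPart fun σ => continuous_const.mul (continuous_hamLinear Λ' σ)

theorem measurable_gibbsState (t : ℝ) (f : Config Λ → ℝ) :
    Measurable (gibbsState β Λ Λ' t f) :=
  ((continuous_gibbsState β Λ Λ' f).comp (Continuous.prodMk_right t)).measurable

theorem abs_gibbsState_le {f : Config Λ → ℝ} {C : ℝ} (hf : ∀ σ, |f σ| ≤ C) (t : ℝ)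
    (J : Disorder d) : |gibbsState β Λ Λ' t f J| ≤ C :=
  abs_gibbsAvg_le _ hf

theorem exists_abs_le (f : Config Λ → ℝ) : ∃ C, ∀ σ, |f σ| ≤ C :=
  ⟨∑ τ, |f τ|, fun σ => Finset.single_le_sum (f := fun τ => |f τ|) (fun _ _ => abs_nonneg _)
    (Finset.mem_univ σ)⟩

theorem hasCoordDeriv_gibbsState {Λ Λ' : Finset (Site d)} (hsub : Λ' ⊆ Λ) (t : ℝ)
    (f : Config Λ → ℝ) {X : Finset (Site d)} (hX : X ∈ Λ'.powerset) :
    HasCoordDeriv X (gibbsState β Λ Λ' t f)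
      (fun J => β * t * (gibbsState β Λ Λ' t (fun σ => f σ * spinProd X σ) J
        - gibbsState β Λ Λ' t f J * gibbsState β Λ Λ' t (spinProd X) J)) := by
  intro J y
  have hX' := Finset.mem_powerset.1 hX
  -- Setting the coupling J_X to 0 as base point makes the exponent affine in z, the form required
  -- by `hasDerivAt_gibbsAvg`.
  have e : ∀ z, (fun σ : Config Λ => -β * hamLinear Λ' (Function.update J X z) t σ)
      = fun σ => -β * hamLinear Λ' (Function.update J X 0) t σ + z * (β * t * spinProd X σ) := by
    intro z
    ext σ
    have := hamLinear_update_sub hsub J t X z 0 σ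
    rw [if_pos (Finset.mem_powerset.2 (hX'.trans hsub)), if_pos hX'] at this
    linear_combination (-β) * this
  have h := hasDerivAt_gibbsAvg
    (fun σ : Config Λ => -β * hamLinear Λ' (Function.update J X 0) t σ)
    (fun σ => β * t * spinProd X σ) f y
  unfold gibbsState
  simp only [e]
  refine h.congr_deriv ?_
  rw [gibbsAvg_const_mul]
  have e2 : (fun σ => f σ * (β * t * spinProd X σ))
      = fun σ => (β * t) * (f σ * spinProd X σ) := by
    ext σ; ring
  rw [e2, gibbsAvg_const_mul]
  ring

/-- Fundamental theorem of calculus in t: the derivative of log Z(t) is the Gibbs average of −β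
H_{Λ'}. -/
theorem logPartition_sub_eq_integral {Λ Λ' : Finset (Site d)} (J : Disorder d) :
    logPartition β Λ Λ' 1 J - logPartition β Λ Λ' (-1) J
      = ∫ t in (-1 : ℝ)..1, β * ∑ X ∈ Λ'.powerset, J X * gibbsState β Λ Λ' t (spinProd X) J := by
  have h := fun t => hasDerivAt_logPart (fun σ : Config Λ => -β * hamOutside Λ' J σ)
    (fun σ => -β * hamInside Λ' J σ) t
  have e : ∀ t, (fun σ : Config Λ => -β * hamOutside Λ' J σ + t * (-β * hamInside Λ' J σ))
      = fun σ => -β * hamLinear Λ' J t σ := by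
    intro t
    ext σ
    simp only [hamLinear]
    ring
  have e2 : (fun σ : Config Λ => -β * hamInside Λ' J σ)
      = fun σ => β * ∑ X ∈ Λ'.powerset, J X * spinProd X σ := by
    ext σ
    simp only [hamInside]
    ring
  have e3 : ∀ t, gibbsAvg (fun σ : Config Λ => -β * hamLinear Λ' J t σ)
      (fun σ => -β * hamInside Λ' J σ)
      = β * ∑ X ∈ Λ'.powerset, J X * gibbsState β Λ Λ' t (spinProd X) J := by
    intro t
    rw [e2, gibbsAvg_const_mul, gibbsAvg_sum]
    simp only [gibbsAvg_const_mul, gibbsState]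
  simp only [e, e3] at h
  have hc : ∀ X, Continuous fun t => gibbsState β Λ Λ' t (spinProd X) J := fun X =>
    (continuous_gibbsState β Λ Λ' (spinProd X)).comp (Continuous.prodMk_left J)
  rw [intervalIntegral.integral_eq_sub_of_hasDerivAt (fun t _ => h t)
    (Continuous.intervalIntegrable (by fun_prop) _ _)]
  rfl

end States

/-! ### Replicated states. -/

section Replicas

variable {β : ℝ} {Λ Λ' : Finset (Site d)}

theorem randomState_prod (J : Disorder d) {k : ℕ} (t : Fin k → ℝ) (f : Fin k → Config Λ → ℝ) :
    randomState β Λ Λ' J t (fun σ => ∏ j, f j (σ j)) = ∏ j, gibbsState β Λ Λ' (t j) (f j) J :=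
  sum_pi_prod_mul_gibbs (fun j (σ : Config Λ) => -β * hamLinear Λ' J (t j) σ) f

theorem randomState_const_mul (J : Disorder d) {k : ℕ} (t : Fin k → ℝ) (c : ℝ)
    (f : (Fin k → Config Λ) → ℝ) :
    randomState β Λ Λ' J t (fun σ => c * f σ) = c * randomState β Λ Λ' J t f := by
  simp only [randomState, mul_assoc, ← Finset.mul_sum]

theorem randomState_sum {ι : Type*} (S : Finset ι) (J : Disorder d) {k : ℕ} (t : Fin k → ℝ)
    (f : ι → (Fin k → Config Λ) → ℝ) :
    randomState β Λ Λ' J t (fun σ => ∑ i ∈ S, f i σ) = ∑ i ∈ S, randomState β Λ Λ' J t (f i) := by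
  simp only [randomState, Finset.sum_mul]
  exact Finset.sum_comm

theorem randomState_one (J : Disorder d) (t : ℝ) (f : Config Λ → ℝ) :
    randomState β Λ Λ' J ![t] (fun σ => f (σ 0)) = gibbsState β Λ Λ' t f J := by
  simpa using randomState_prod (β := β) (Λ' := Λ') J ![t] ![f]

theorem randomState_two (J : Disorder d) (t s : ℝ) (f g : Config Λ → ℝ) :
    randomState β Λ Λ' J ![t, s] (fun σ => f (σ 0) * g (σ 1))
      = gibbsState β Λ Λ' t f J * gibbsState β Λ Λ' s g J := by
  simpa [Fin.prod_univ_two] using randomState_prod (β := β) (Λ' := Λ') J ![t, s] ![f, g]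

theorem randomState_three (J : Disorder d) (t s r : ℝ) (f g h : Config Λ → ℝ) :
    randomState β Λ Λ' J ![t, s, r] (fun σ => f (σ 0) * g (σ 1) * h (σ 2))
      = gibbsState β Λ Λ' t f J * gibbsState β Λ Λ' s g J * gibbsState β Λ Λ' r h J := by
  simpa [Fin.prod_univ_three] using randomState_prod (β := β) (Λ' := Λ') J ![t, s, r] ![f, g, h]

theorem randomState_four (J : Disorder d) (t s r q : ℝ) (f g h i : Config Λ → ℝ) :
    randomState β Λ Λ' J ![t, s, r, q] (fun σ => f (σ 0) * g (σ 1) * h (σ 2) * i (σ 3))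
      = gibbsState β Λ Λ' t f J * gibbsState β Λ Λ' s g J * gibbsState β Λ Λ' r h J
        * gibbsState β Λ Λ' q i J := by
  simpa [Fin.prod_univ_four] using
    randomState_prod (β := β) (Λ' := Λ') J ![t, s, r, q] ![f, g, h, i]

theorem continuous_randomState {k : ℕ} (f : (Fin k → Config Λ) → ℝ) :
    Continuous fun p : (Fin k → ℝ) × Disorder d => randomState β Λ Λ' p.2 p.1 f := by
  have h : ∀ (j : Fin k) (σ : Config Λ),
      Continuous fun p : (Fin k → ℝ) × Disorder d => hamLinear Λ' p.2 (p.1 j) σ := fun j σ =>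
    (continuous_hamLinear Λ' σ).comp
      (g := fun p : ℝ × Disorder d => hamLinear Λ' p.2 p.1 σ)
      (f := fun p : (Fin k → ℝ) × Disorder d => (p.1 j, p.2)) (((continuous_apply j).comp continuous_fst).prodMk continuous_snd)
  unfold randomState partitionFn
  refine continuous_finsetSum _ fun σ _ => continuous_const.mul ?_
  refine continuous_finsetProd _ fun j _ => Continuous.div ?_ ?_ fun p => (sum_exp_pos _).ne'
  · exact (continuous_const.mul (h j _)).rexp
  · exact continuous_finsetSum _ fun τ _ => (continuous_const.mul (h j τ)).rexp

theorem abs_randomState_le (J : Disorder d) {k : ℕ} (t : Fin k → ℝ)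
    {f : (Fin k → Config Λ) → ℝ} {C : ℝ} (hf : ∀ σ, |f σ| ≤ C) :
    |randomState β Λ Λ' J t f| ≤ C := by
  set w : (Fin k → Config Λ) → ℝ := fun σ =>
    ∏ j, (Real.exp (-β * hamLinear Λ' J (t j) (σ j)) / partitionFn β Λ Λ' J (t j)) with hw
  have hw0 : ∀ σ, 0 ≤ w σ := fun σ => Finset.prod_nonneg fun j _ =>
    div_nonneg (Real.exp_pos _).le (sum_exp_pos _).le
  -- Normalization of the weights is the product formula applied to constant functions equal to 1.
  have hw1 : ∑ σ, w σ = 1 := by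
    have h1 := randomState_prod (β := β) (Λ' := Λ') J t fun _ (_ : Config Λ) => (1 : ℝ)
    simpa only [randomState, gibbsState, gibbsAvg_const, Finset.prod_const_one, one_mul] using h1
  calc |randomState β Λ Λ' J t f| ≤ ∑ σ, |f σ * w σ| := Finset.abs_sum_le_sum_abs _ _
    _ ≤ ∑ σ, C * w σ := by
      refine Finset.sum_le_sum fun σ _ => ?_
      rw [abs_mul, abs_of_nonneg (hw0 σ)]
      exact mul_le_mul_of_nonneg_right (hf σ) (hw0 σ)
    _ = C := by rw [← Finset.mul_sum, hw1, mul_one]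

end Replicas

end SpinGlass

namespace SpinGlass

variable {d : ℕ}

/-! ### Replica observables as sums over pairs of interaction sets. -/

section Overlaps

variable (β : ℝ) (m : Finset (Site d) → ℝ) (Δ : Finset (Site d) → ℝ≥0) (Λ Λ' : Finset (Site d))

/-- The state of a product `σ_X σ_Y`. -/
noncomputable def pairState (X Y : Finset (Site d)) (t : ℝ) (J : Disorder d) : ℝ :=
  gibbsState β Λ Λ' t (fun σ => spinProd X σ * spinProd Y σ) J

/-- `|Λ'|` times the state of `c_{1,2}`. -/
noncomputable def overlap (t s : ℝ) (J : Disorder d) : ℝ :=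
  ∑ X ∈ Λ'.powerset, (Δ X : ℝ) ^ 2 *
    (gibbsState β Λ Λ' t (spinProd X) J * gibbsState β Λ Λ' s (spinProd X) J)

/-- `|Λ'|²` times the state of `c_{1,2} c_{2,3}`. -/
noncomputable def chainOverlap (t s r : ℝ) (J : Disorder d) : ℝ :=
  ∑ X ∈ Λ'.powerset, ∑ Y ∈ Λ'.powerset, (Δ X : ℝ) ^ 2 * (Δ Y : ℝ) ^ 2 *
    (gibbsState β Λ Λ' t (spinProd X) J * pairState β Λ Λ' X Y s J
      * gibbsState β Λ Λ' r (spinProd Y) J)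

/-- `|Λ'|²` times the state of `c_{1,2}²`. -/
noncomputable def squareOverlap (t s : ℝ) (J : Disorder d) : ℝ :=
  ∑ X ∈ Λ'.powerset, ∑ Y ∈ Λ'.powerset, (Δ X : ℝ) ^ 2 * (Δ Y : ℝ) ^ 2 *
    (pairState β Λ Λ' X Y t J * pairState β Λ Λ' X Y s J)

/-- `|Λ'|` times the state of `m_1 c_{1,2}`. -/
noncomputable def magOverlap (t s : ℝ) (J : Disorder d) : ℝ :=
  ∑ X ∈ Λ'.powerset, (Δ X : ℝ) ^ 2 *
    (gibbsState β Λ Λ' t (fun σ => mag m Λ' σ * spinProd X σ) J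
      * gibbsState β Λ Λ' s (spinProd X) J)

variable {β m Δ Λ Λ'}

theorem pairState_comm (X Y : Finset (Site d)) :
    pairState β Λ Λ' X Y = pairState β Λ Λ' Y X := by
  unfold pairState
  simp only [mul_comm (spinProd X _)]

theorem overlap_comm (t s : ℝ) : overlap β Δ Λ Λ' t s = overlap β Δ Λ Λ' s t := by
  ext J
  simp only [overlap, mul_comm (gibbsState β Λ Λ' t _ J)]

theorem chainOverlap_comm (t s r : ℝ) :
    chainOverlap β Δ Λ Λ' t s r = chainOverlap β Δ Λ Λ' r s t := by
  ext J
  unfold chainOverlap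
  rw [Finset.sum_comm]
  refine Finset.sum_congr rfl fun X _ => Finset.sum_congr rfl fun Y _ => ?_
  rw [pairState_comm]
  ring

theorem cov_eq (σ τ : Config Λ) : cov Δ Λ' σ τ
    = ∑ X ∈ Λ'.powerset, ((Δ X : ℝ) ^ 2 / Λ'.card) * (spinProd X σ * spinProd X τ) := by
  unfold cov
  rw [Finset.sum_div]
  exact Finset.sum_congr rfl fun X _ => by ring

/-- This and the next five lemmas expand c and, for products of two of them, c² over interaction
sets, so that each summand factorizes over replicas. A replica shared by two covariances produces a
`pairState`. -/
theorem randomState_cov (J : Disorder d) (t s : ℝ) :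
    randomState β Λ Λ' J ![t, s] (fun σ => cov Δ Λ' (σ 0) (σ 1))
      = overlap β Δ Λ Λ' t s J / Λ'.card := by
  simp only [cov_eq, randomState_sum, randomState_const_mul, randomState_two, overlap,
    Finset.sum_div]
  exact Finset.sum_congr rfl fun X _ => by ring

theorem randomState_cov_mul_cov (J : Disorder d) (t s r q : ℝ) :
    randomState β Λ Λ' J ![t, s, r, q] (fun σ => cov Δ Λ' (σ 0) (σ 1) * cov Δ Λ' (σ 2) (σ 3))
      = overlap β Δ Λ Λ' t s J * overlap β Δ Λ Λ' r q J / (Λ'.card : ℝ) ^ 2 := by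
  have e : ∀ σ : Fin 4 → Config Λ, cov Δ Λ' (σ 0) (σ 1) * cov Δ Λ' (σ 2) (σ 3)
      = ∑ X ∈ Λ'.powerset, ∑ Y ∈ Λ'.powerset,
        ((Δ X : ℝ) ^ 2 * (Δ Y : ℝ) ^ 2 / (Λ'.card : ℝ) ^ 2) *
        (spinProd X (σ 0) * spinProd X (σ 1) * spinProd Y (σ 2) * spinProd Y (σ 3)) := by
    intro σ
    rw [cov_eq, cov_eq, Finset.sum_mul_sum]
    exact Finset.sum_congr rfl fun X _ => Finset.sum_congr rfl fun Y _ => by ring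
  simp only [e, randomState_sum, randomState_const_mul, randomState_four]
  unfold overlap
  rw [Finset.sum_mul_sum]
  simp only [Finset.sum_div]
  exact Finset.sum_congr rfl fun X _ => Finset.sum_congr rfl fun Y _ => by ring

theorem randomState_cov_chain (J : Disorder d) (t s r : ℝ) :
    randomState β Λ Λ' J ![t, s, r] (fun σ => cov Δ Λ' (σ 0) (σ 1) * cov Δ Λ' (σ 1) (σ 2))
      = chainOverlap β Δ Λ Λ' t s r J / (Λ'.card : ℝ) ^ 2 := by
  have e : ∀ σ : Fin 3 → Config Λ, cov Δ Λ' (σ 0) (σ 1) * cov Δ Λ' (σ 1) (σ 2)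
      = ∑ X ∈ Λ'.powerset, ∑ Y ∈ Λ'.powerset,
        ((Δ X : ℝ) ^ 2 * (Δ Y : ℝ) ^ 2 / (Λ'.card : ℝ) ^ 2) *
        (spinProd X (σ 0) * (spinProd X (σ 1) * spinProd Y (σ 1)) * spinProd Y (σ 2)) := by
    intro σ
    rw [cov_eq, cov_eq, Finset.sum_mul_sum]
    exact Finset.sum_congr rfl fun X _ => Finset.sum_congr rfl fun Y _ => by ring
  simp only [e, randomState_sum, randomState_const_mul]
  unfold chainOverlap pairState
  simp only [Finset.sum_div]
  refine Finset.sum_congr rfl fun X _ => Finset.sum_congr rfl fun Y _ => ?_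
  rw [randomState_three J t s r (spinProd X) (fun σ => spinProd X σ * spinProd Y σ) (spinProd Y)]
  ring

theorem randomState_cov_sq (J : Disorder d) (t s : ℝ) :
    randomState β Λ Λ' J ![t, s] (fun σ => cov Δ Λ' (σ 0) (σ 1) ^ 2)
      = squareOverlap β Δ Λ Λ' t s J / (Λ'.card : ℝ) ^ 2 := by
  have e : ∀ σ : Fin 2 → Config Λ, cov Δ Λ' (σ 0) (σ 1) ^ 2
      = ∑ X ∈ Λ'.powerset, ∑ Y ∈ Λ'.powerset,
        ((Δ X : ℝ) ^ 2 * (Δ Y : ℝ) ^ 2 / (Λ'.card : ℝ) ^ 2) *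
        ((spinProd X (σ 0) * spinProd Y (σ 0)) * (spinProd X (σ 1) * spinProd Y (σ 1))) := by
    intro σ
    rw [sq, cov_eq, Finset.sum_mul_sum]
    exact Finset.sum_congr rfl fun X _ => Finset.sum_congr rfl fun Y _ => by ring
  simp only [e, randomState_sum, randomState_const_mul]
  unfold squareOverlap pairState
  simp only [Finset.sum_div]
  refine Finset.sum_congr rfl fun X _ => Finset.sum_congr rfl fun Y _ => ?_
  rw [randomState_two J t s (fun σ => spinProd X σ * spinProd Y σ)
    (fun σ => spinProd X σ * spinProd Y σ)]
  ring

theorem randomState_mag_mul_cov (J : Disorder d) (t s r : ℝ) :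
    randomState β Λ Λ' J ![t, s, r] (fun σ => mag m Λ' (σ 0) * cov Δ Λ' (σ 1) (σ 2))
      = gibbsState β Λ Λ' t (mag m Λ') J * overlap β Δ Λ Λ' s r J / (Λ'.card : ℝ) := by
  have e : ∀ σ : Fin 3 → Config Λ, mag m Λ' (σ 0) * cov Δ Λ' (σ 1) (σ 2)
      = ∑ X ∈ Λ'.powerset, ((Δ X : ℝ) ^ 2 / (Λ'.card : ℝ)) *
        (mag m Λ' (σ 0) * spinProd X (σ 1) * spinProd X (σ 2)) := by
    intro σ
    rw [cov_eq, Finset.mul_sum]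
    exact Finset.sum_congr rfl fun X _ => by ring
  simp only [e, randomState_sum, randomState_const_mul, randomState_three]
  unfold overlap
  rw [Finset.mul_sum]
  simp only [Finset.sum_div]
  exact Finset.sum_congr rfl fun X _ => by ring

theorem randomState_mag_cov (J : Disorder d) (t s : ℝ) :
    randomState β Λ Λ' J ![t, s] (fun σ => mag m Λ' (σ 0) * cov Δ Λ' (σ 0) (σ 1))
      = magOverlap β m Δ Λ Λ' t s J / (Λ'.card : ℝ) := by
  have e : ∀ σ : Fin 2 → Config Λ, mag m Λ' (σ 0) * cov Δ Λ' (σ 0) (σ 1)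
      = ∑ X ∈ Λ'.powerset, ((Δ X : ℝ) ^ 2 / (Λ'.card : ℝ)) *
        ((mag m Λ' (σ 0) * spinProd X (σ 0)) * spinProd X (σ 1)) := by
    intro σ
    rw [cov_eq, Finset.mul_sum]
    exact Finset.sum_congr rfl fun X _ => by ring
  simp only [e, randomState_sum, randomState_const_mul]
  unfold magOverlap
  simp only [Finset.sum_div]
  refine Finset.sum_congr rfl fun X _ => ?_
  rw [randomState_two J t s (fun σ => mag m Λ' σ * spinProd X σ) (spinProd X)]
  ring

end Overlaps

/-! ### Gaussian integration by parts under the disorder law. -/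

section IntegrationByParts

instance isProbabilityMeasure_disorderLaw (m : Finset (Site d) → ℝ) (Δ : Finset (Site d) → ℝ≥0) :
    IsProbabilityMeasure (disorderLaw m Δ) := by
  unfold disorderLaw
  infer_instance

/-- Bounded measurable functions of the disorder. -/
def BddMeasurable (f : Disorder d → ℝ) : Prop := Measurable f ∧ ∃ C, ∀ J, |f J| ≤ C

namespace BddMeasurable

variable {f g : Disorder d → ℝ}

theorem const (c : ℝ) : BddMeasurable fun _ : Disorder d => c :=
  ⟨measurable_const, |c|, fun _ => le_rfl⟩

theorem mul (hf : BddMeasurable f) (hg : BddMeasurable g) :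
    BddMeasurable fun J => f J * g J := by
  obtain ⟨hf, C, hC⟩ := hf
  obtain ⟨hg, D, hD⟩ := hg
  refine ⟨hf.mul hg, C * D, fun J => ?_⟩
  rw [abs_mul]
  exact mul_le_mul (hC J) (hD J) (abs_nonneg _) ((abs_nonneg _).trans (hC J))

theorem add (hf : BddMeasurable f) (hg : BddMeasurable g) :
    BddMeasurable fun J => f J + g J := by
  obtain ⟨hf, C, hC⟩ := hf
  obtain ⟨hg, D, hD⟩ := hg
  exact ⟨hf.add hg, C + D, fun J => (abs_add_le _ _).trans (add_le_add (hC J) (hD J))⟩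

theorem const_mul (c : ℝ) (hf : BddMeasurable f) : BddMeasurable fun J => c * f J :=
  (const c).mul hf

theorem sub (hf : BddMeasurable f) (hg : BddMeasurable g) :
    BddMeasurable fun J => f J - g J := by
  simpa [sub_eq_add_neg] using hf.add (hg.const_mul (-1))

theorem sum {ι : Type*} {F : ι → Disorder d → ℝ} (S : Finset ι) (h : ∀ i, BddMeasurable (F i)) :
    BddMeasurable fun J => ∑ i ∈ S, F i J := by
  classical
  induction S using Finset.induction_on with
  | empty => simpa using const 0
  | insert i S hi ih =>
    simp only [Finset.sum_insert hi]
    exact (h i).add ih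

theorem memLp (hf : BddMeasurable f) (m : Finset (Site d) → ℝ) (Δ : Finset (Site d) → ℝ≥0) :
    MemLp f 2 (disorderLaw m Δ) := by
  obtain ⟨hf, C, hC⟩ := hf
  exact memLp_two_of_abs_le hf (memLp_const C) hC

theorem integrable (hf : BddMeasurable f) (m : Finset (Site d) → ℝ)
    (Δ : Finset (Site d) → ℝ≥0) : Integrable f (disorderLaw m Δ) :=
  (hf.memLp m Δ).integrable (by norm_num)

end BddMeasurable

theorem bddMeasurable_gibbsState (β : ℝ) (Λ Λ' : Finset (Site d)) (t : ℝ) (f : Config Λ → ℝ) :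
    BddMeasurable (gibbsState β Λ Λ' t f) := by
  obtain ⟨C, hC⟩ := exists_abs_le Λ f
  exact ⟨measurable_gibbsState β Λ Λ' t f, C, fun J => abs_gibbsState_le β Λ Λ' hC t J⟩

theorem bddMeasurable_pairState (β : ℝ) (Λ Λ' : Finset (Site d)) (X Y : Finset (Site d)) (t : ℝ) :
    BddMeasurable (pairState β Λ Λ' X Y t) :=
  bddMeasurable_gibbsState β Λ Λ' t _

variable (m : Finset (Site d) → ℝ) (Δ : Finset (Site d) → ℝ≥0) {f f' f'' : Disorder d → ℝ}

theorem memLp_coupling_sub (X : Finset (Site d)) :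
    MemLp (fun J : Disorder d => J X - m X) 2 (disorderLaw m Δ) :=
  memLp_sub_infinitePi m (fun X => Δ X ^ 2) 2 X

theorem integrable_coupling_mul (X : Finset (Site d)) (hf : BddMeasurable f) :
    Integrable (fun J => (J X - m X) * f J) (disorderLaw m Δ) :=
  (memLp_coupling_sub m Δ X).integrable_mul (hf.memLp m Δ)

/-- Each centred coupling is in L², and a bounded factor preserves this, so the product is
integrable by Cauchy–Schwarz, also when X = Y. -/
theorem integrable_coupling_mul_coupling_mul (X Y : Finset (Site d)) (hf : BddMeasurable f) :
    Integrable (fun J => (J X - m X) * ((J Y - m Y) * f J)) (disorderLaw m Δ) := by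
  obtain ⟨hf, C, hC⟩ := hf
  refine (memLp_coupling_sub m Δ X).integrable_mul (q := 2) ?_
  refine (memLp_coupling_sub m Δ Y).of_le_mul (c := C) ?_ (ae_of_all _ fun J => ?_)
  · exact (((measurable_pi_apply Y).sub_const _).mul hf).aestronglyMeasurable
  · rw [norm_mul, mul_comm]
    exact mul_le_mul_of_nonneg_right (hC J) (norm_nonneg _)

theorem integral_coupling_mul {X : Finset (Site d)} (h : HasCoordDeriv X f f')
    (hf : BddMeasurable f) (hf' : BddMeasurable f') :
    ∫ J, (J X - m X) * f J ∂(disorderLaw m Δ)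
      = ∫ J, (Δ X : ℝ) ^ 2 * f' J ∂(disorderLaw m Δ) := by
  have := integral_sub_mul_infinitePi m (fun X => Δ X ^ 2) h (hf.integrable m Δ)
    (integrable_coupling_mul m Δ X hf) (hf'.integrable m Δ)
  rw [integral_const_mul]
  simpa [disorderLaw] using this

/-- Integrating by parts in J_X differentiates both J_Y − m_Y, which gives the diagonal term, and f;
the latter term is then integrated by parts in J_Y. -/
theorem integral_coupling_mul_coupling_mul {X Y : Finset (Site d)} (h : HasCoordDeriv X f f')
    (h' : HasCoordDeriv Y f' f'') (hf : BddMeasurable f) (hf' : BddMeasurable f')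
    (hf'' : BddMeasurable f'') :
    ∫ J, (J X - m X) * ((J Y - m Y) * f J) ∂(disorderLaw m Δ)
      = ∫ J, ((if X = Y then (Δ X : ℝ) ^ 2 else 0) * f J
          + (Δ X : ℝ) ^ 2 * (Δ Y : ℝ) ^ 2 * f'' J) ∂(disorderLaw m Δ) := by
  have hg := integrable_coupling_mul m Δ Y hf
  have hg' := integrable_coupling_mul m Δ Y hf'
  have hδ : Integrable (fun J => (if X = Y then 1 else 0) * f J) (disorderLaw m Δ) :=
    (hf.integrable m Δ).const_mul _
  have key := integral_sub_mul_infinitePi m (fun X => Δ X ^ 2)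
    ((hasCoordDeriv_sub_const X Y (m Y)).mul h) hg
    (integrable_coupling_mul_coupling_mul m Δ X Y hf) (hδ.add hg')
  change ∫ J, (J X - m X) * ((J Y - m Y) * f J) ∂(disorderLaw m Δ) = _ * ∫ J,
    ((if X = Y then 1 else 0) * f J + (J Y - m Y) * f' J) ∂(disorderLaw m Δ) at key
  rw [key, integral_add hδ hg', integral_coupling_mul m Δ h' hf' hf'',
    integral_add ((hf.integrable m Δ).const_mul _) ((hf''.integrable m Δ).const_mul _)]
  simp only [integral_const_mul]
  push_cast
  split_ifs <;> ring

end IntegrationByParts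

end SpinGlass

namespace SpinGlass

variable {d : ℕ}

/-! ### Derivatives of products of spin averages and second moments of the energies. -/

section Covariances

variable (β : ℝ) (m : Finset (Site d) → ℝ) (Δ : Finset (Site d) → ℝ≥0) (Λ Λ' : Finset (Site d))

/-- The contribution `∑_{X ⊂ Λ'} m_X ω_t(σ_X)` of the means to the energy. -/
noncomputable def meanEnergy (t : ℝ) (J : Disorder d) : ℝ :=
  -(Λ'.card : ℝ) * gibbsState β Λ Λ' t (mag m Λ') J

/-- The contribution `∑_{X ⊂ Λ'} (J_X - m_X) ω_t(σ_X)` of the fluctuations to the energy. -/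
noncomputable def noiseEnergy (t : ℝ) (J : Disorder d) : ℝ :=
  ∑ X ∈ Λ'.powerset, (J X - m X) * gibbsState β Λ Λ' t (spinProd X) J

variable {β m Δ Λ Λ'}

theorem bddMeasurable_overlap (t s : ℝ) : BddMeasurable (overlap β Δ Λ Λ' t s) :=
  BddMeasurable.sum _ fun _ => ((bddMeasurable_gibbsState _ _ _ _ _).mul
    (bddMeasurable_gibbsState _ _ _ _ _)).const_mul _

theorem bddMeasurable_chainOverlap (t s r : ℝ) : BddMeasurable (chainOverlap β Δ Λ Λ' t s r) :=
  BddMeasurable.sum _ fun _ => BddMeasurable.sum _ fun _ =>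
    (((bddMeasurable_gibbsState _ _ _ _ _).mul (bddMeasurable_pairState _ _ _ _ _ _)).mul
    (bddMeasurable_gibbsState _ _ _ _ _)).const_mul _

theorem bddMeasurable_squareOverlap (t s : ℝ) : BddMeasurable (squareOverlap β Δ Λ Λ' t s) :=
  BddMeasurable.sum _ fun _ => BddMeasurable.sum _ fun _ =>
    ((bddMeasurable_pairState _ _ _ _ _ _).mul (bddMeasurable_pairState _ _ _ _ _ _)).const_mul _

theorem bddMeasurable_magOverlap (t s : ℝ) : BddMeasurable (magOverlap β m Δ Λ Λ' t s) :=
  BddMeasurable.sum _ fun _ => ((bddMeasurable_gibbsState _ _ _ _ _).mul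
    (bddMeasurable_gibbsState _ _ _ _ _)).const_mul _

theorem hasCoordDeriv_spin (hsub : Λ' ⊆ Λ) (t : ℝ) (X : Finset (Site d)) {Y : Finset (Site d)}
    (hY : Y ∈ Λ'.powerset) :
    HasCoordDeriv Y (gibbsState β Λ Λ' t (spinProd X))
      (fun J => β * t * (pairState β Λ Λ' X Y t J
        - gibbsState β Λ Λ' t (spinProd X) J * gibbsState β Λ Λ' t (spinProd Y) J)) :=
  hasCoordDeriv_gibbsState β hsub t (spinProd X) hY

theorem pairState_self (X : Finset (Site d)) (t : ℝ) (J : Disorder d) :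
    pairState β Λ Λ' X X t J = if X = ∅ then 0 else 1 := by
  unfold pairState gibbsState
  simp only [spinProd_sq, gibbsAvg_const]

theorem hasCoordDeriv_spin_self (hsub : Λ' ⊆ Λ) (t : ℝ) {X : Finset (Site d)}
    (hX : X ∈ Λ'.powerset) :
    HasCoordDeriv X (gibbsState β Λ Λ' t (spinProd X))
      (fun J => β * t * ((if X = ∅ then 0 else 1) - gibbsState β Λ Λ' t (spinProd X) J ^ 2)) :=
  (hasCoordDeriv_spin hsub t X hX).congr fun J => by rw [pairState_self]; ring

/-- Because σ_Y² is 1, or 0 for empty Y, the three-spin average collapses to a single spin, so no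
correlations beyond pairs ever appear. -/
theorem hasCoordDeriv_pairState (hsub : Λ' ⊆ Λ) (t : ℝ) (X : Finset (Site d))
    {Y : Finset (Site d)} (hY : Y ∈ Λ'.powerset) :
    HasCoordDeriv Y (pairState β Λ Λ' X Y t)
      (fun J => β * t * ((if Y = ∅ then 0 else 1) * gibbsState β Λ Λ' t (spinProd X) J
        - pairState β Λ Λ' X Y t J * gibbsState β Λ Λ' t (spinProd Y) J)) := by
  refine (hasCoordDeriv_gibbsState β hsub t (fun σ => spinProd X σ * spinProd Y σ) hY).congr
    fun J => ?_
  have : (fun σ : Config Λ => spinProd X σ * spinProd Y σ * spinProd Y σ)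
      = fun σ => (if Y = ∅ then 0 else 1) * spinProd X σ := by
    ext σ
    rw [mul_assoc, spinProd_sq, mul_comm]
  rw [this]
  unfold gibbsState pairState
  rw [gibbsAvg_const_mul]
  rfl

/-- The derivative of `ω_t(σ_X) ω_s(σ_Y)` in the direction of `J_X`. -/
noncomputable def spinSpinDeriv (β : ℝ) (Λ Λ' : Finset (Site d)) (t s : ℝ)
    (X Y : Finset (Site d)) (J : Disorder d) : ℝ :=
  β * t * ((if X = ∅ then 0 else 1) - gibbsState β Λ Λ' t (spinProd X) J ^ 2)
      * gibbsState β Λ Λ' s (spinProd Y) J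
    + gibbsState β Λ Λ' t (spinProd X) J * (β * s * (pairState β Λ Λ' X Y s J
        - gibbsState β Λ Λ' s (spinProd Y) J * gibbsState β Λ Λ' s (spinProd X) J))

/-- The mixed second derivative of `ω_t(σ_X) ω_s(σ_Y)` in the directions of `J_X` and `J_Y`. -/
noncomputable def spinSpinDeriv₂ (β : ℝ) (Λ Λ' : Finset (Site d)) (t s : ℝ)
    (X Y : Finset (Site d)) (J : Disorder d) : ℝ :=
  let x := gibbsState β Λ Λ' t (spinProd X) J
  let y := gibbsState β Λ Λ' t (spinProd Y) J
  let x' := gibbsState β Λ Λ' s (spinProd X) J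
  let y' := gibbsState β Λ Λ' s (spinProd Y) J
  let p := pairState β Λ Λ' X Y t J
  let p' := pairState β Λ Λ' X Y s J
  β ^ 2 * (t * s * (((if X = ∅ then 0 else 1) - x * x) * ((if Y = ∅ then 0 else 1) - y' * y'))
    - 2 * t ^ 2 * (x * y' * (p - x * y)) - 2 * s ^ 2 * (x * y' * (p' - x' * y'))
    + t * s * ((p - x * y) * (p' - x' * y')))

theorem bddMeasurable_spinSpinDeriv (t s : ℝ) (X Y : Finset (Site d)) :
    BddMeasurable (spinSpinDeriv β Λ Λ' t s X Y) := by
  have hb : ∀ t X, BddMeasurable (gibbsState β Λ Λ' t (spinProd X)) := fun t X =>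
    bddMeasurable_gibbsState _ _ _ _ _
  have hp : ∀ t, BddMeasurable (pairState β Λ Λ' X Y t) := fun t =>
    bddMeasurable_pairState _ _ _ _ _ _
  unfold spinSpinDeriv
  simp only [sq]
  exact ((((BddMeasurable.const _).sub ((hb _ _).mul (hb _ _))).const_mul _).mul (hb _ _)).add
    ((hb _ _).mul (((hp _).sub ((hb _ _).mul (hb _ _))).const_mul _))

theorem bddMeasurable_spinSpinDeriv₂ (t s : ℝ) (X Y : Finset (Site d)) :
    BddMeasurable (spinSpinDeriv₂ β Λ Λ' t s X Y) := by
  have hb : ∀ t X, BddMeasurable (gibbsState β Λ Λ' t (spinProd X)) := fun t X =>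
    bddMeasurable_gibbsState _ _ _ _ _
  have hp : ∀ t, BddMeasurable (pairState β Λ Λ' X Y t) := fun t =>
    bddMeasurable_pairState _ _ _ _ _ _
  have hq : ∀ t, BddMeasurable fun J => pairState β Λ Λ' X Y t J
      - gibbsState β Λ Λ' t (spinProd X) J * gibbsState β Λ Λ' t (spinProd Y) J := fun t =>
    (hp t).sub ((hb _ _).mul (hb _ _))
  have he : ∀ (c : ℝ) t X, BddMeasurable fun J => c
      - gibbsState β Λ Λ' t (spinProd X) J * gibbsState β Λ Λ' t (spinProd X) J := fun c t X =>
    (BddMeasurable.const c).sub ((hb _ _).mul (hb _ _))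
  unfold spinSpinDeriv₂
  exact ((((((he _ _ _).mul (he _ _ _)).const_mul _).sub
    ((((hb _ _).mul (hb _ _)).mul (hq _)).const_mul _)).sub
    ((((hb _ _).mul (hb _ _)).mul (hq _)).const_mul _)).add
    (((hq _).mul (hq _)).const_mul _)).const_mul _

theorem hasCoordDeriv_spin_mul_spin (hsub : Λ' ⊆ Λ) (t s : ℝ) {X : Finset (Site d)}
    (hX : X ∈ Λ'.powerset) (Y : Finset (Site d)) :
    HasCoordDeriv X
      (fun J => gibbsState β Λ Λ' t (spinProd X) J * gibbsState β Λ Λ' s (spinProd Y) J)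
      (spinSpinDeriv β Λ Λ' t s X Y) := by
  refine ((hasCoordDeriv_spin_self hsub t hX).mul (hasCoordDeriv_spin hsub s Y hX)).congr
    fun J => ?_
  rw [spinSpinDeriv, pairState_comm Y X]

/-- In the s² terms, the indicator of Y ≠ ∅ from the pair state cancels against the one from
differentiating ω_s(σ_Y), which leaves the form symmetric to the t² terms. -/
theorem hasCoordDeriv_spinSpinDeriv (hsub : Λ' ⊆ Λ) (t s : ℝ) (X : Finset (Site d))
    {Y : Finset (Site d)} (hY : Y ∈ Λ'.powerset) :
    HasCoordDeriv Y (spinSpinDeriv β Λ Λ' t s X Y) (spinSpinDeriv₂ β Λ Λ' t s X Y) := by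
  have hx := fun t => hasCoordDeriv_spin (β := β) hsub t X hY
  have hy := fun t => hasCoordDeriv_spin_self (β := β) hsub t hY
  have hp := fun t => hasCoordDeriv_pairState (β := β) hsub t X hY
  unfold spinSpinDeriv
  simp only [sq]
  refine (((((hasCoordDeriv_const Y (if X = ∅ then 0 else 1)).sub ((hx t).mul (hx t))).const_mul
    (β * t)).mul (hy s)).add ((hx t).mul (((hp s).sub ((hy s).mul (hx s))).const_mul
    (β * s)))).congr fun J => ?_
  unfold spinSpinDeriv₂
  ring

/-- The integrand produced by two integrations by parts. -/
noncomputable def noiseIntegrand (β : ℝ) (Δ : Finset (Site d) → ℝ≥0) (Λ Λ' : Finset (Site d))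
    (V t s : ℝ) (J : Disorder d) : ℝ :=
  overlap β Δ Λ Λ' t s J + β ^ 2 *
    (t * s * ((V - overlap β Δ Λ Λ' t t J) * (V - overlap β Δ Λ Λ' s s J))
    - 2 * t ^ 2 * (chainOverlap β Δ Λ Λ' t t s J
        - overlap β Δ Λ Λ' t t J * overlap β Δ Λ Λ' s t J)
    - 2 * s ^ 2 * (chainOverlap β Δ Λ Λ' s s t J
        - overlap β Δ Λ Λ' s s J * overlap β Δ Λ Λ' t s J)
    + t * s * (squareOverlap β Δ Λ Λ' t s J - chainOverlap β Δ Λ Λ' t s t J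
        - chainOverlap β Δ Λ Λ' s t s J + overlap β Δ Λ Λ' t s J * overlap β Δ Λ Λ' s t J))

/-- Each monomial either factorizes into a product of two overlaps or, when it contains a pair
average linking X and Y, sums to a chain or square overlap. The diagonal X = Y yields the isolated
first-order overlap, the only term of lower order in |Λ'|. -/
theorem sum_spinSpinDeriv₂ (t s : ℝ) (J : Disorder d) :
    ∑ X ∈ Λ'.powerset, ∑ Y ∈ Λ'.powerset,
      ((if X = Y then (Δ X : ℝ) ^ 2 else 0) *
          (gibbsState β Λ Λ' t (spinProd X) J * gibbsState β Λ Λ' s (spinProd Y) J)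
        + (Δ X : ℝ) ^ 2 * (Δ Y : ℝ) ^ 2 * spinSpinDeriv₂ β Λ Λ' t s X Y J)
      = noiseIntegrand β Δ Λ Λ'
        (∑ X ∈ Λ'.powerset, (Δ X : ℝ) ^ 2 * (if X = ∅ then 0 else 1)) t s J := by
  have e1 : ∀ t, (∑ X ∈ Λ'.powerset, (Δ X : ℝ) ^ 2 * (if X = ∅ then 0 else 1))
      - overlap β Δ Λ Λ' t t J = ∑ X ∈ Λ'.powerset, (Δ X : ℝ) ^ 2 *
        ((if X = ∅ then 0 else 1) - gibbsState β Λ Λ' t (spinProd X) J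
          * gibbsState β Λ Λ' t (spinProd X) J) := by
    intro t
    simp only [overlap, ← Finset.sum_sub_distrib, mul_sub]
  have e2 : ∑ X ∈ Λ'.powerset, ∑ Y ∈ Λ'.powerset, (if X = Y then (Δ X : ℝ) ^ 2 else 0) *
      (gibbsState β Λ Λ' t (spinProd X) J * gibbsState β Λ Λ' s (spinProd Y) J)
      = overlap β Δ Λ Λ' t s J := by
    refine Finset.sum_congr rfl fun X hX => ?_
    simp only [ite_mul, zero_mul, Finset.sum_ite_eq, if_pos hX]
  simp only [Finset.sum_add_distrib, e2]
  unfold noiseIntegrand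
  rw [e1, e1, chainOverlap_comm s s t, overlap_comm s t, mul_comm (overlap β Δ Λ Λ' s s J)]
  congr 1
  unfold overlap chainOverlap squareOverlap
  simp only [Finset.sum_mul_sum]
  simp only [Finset.mul_sum, ← Finset.sum_add_distrib,
    ← Finset.sum_sub_distrib]
  refine Finset.sum_congr rfl fun X _ => Finset.sum_congr rfl fun Y _ => ?_
  unfold spinSpinDeriv₂
  ring

theorem integral_noiseEnergy_mul (hsub : Λ' ⊆ Λ) (t s : ℝ) :
    ∫ J, noiseEnergy β m Λ Λ' t J * noiseEnergy β m Λ Λ' s J ∂(disorderLaw m Δ)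
      = ∫ J, noiseIntegrand β Δ Λ Λ'
        (∑ X ∈ Λ'.powerset, (Δ X : ℝ) ^ 2 * (if X = ∅ then 0 else 1)) t s J
        ∂(disorderLaw m Δ) := by
  have hb : ∀ X Y, BddMeasurable fun J =>
      gibbsState β Λ Λ' t (spinProd X) J * gibbsState β Λ Λ' s (spinProd Y) J := fun X Y =>
    (bddMeasurable_gibbsState _ _ _ _ _).mul (bddMeasurable_gibbsState _ _ _ _ _)
  have e : ∀ J, noiseEnergy β m Λ Λ' t J * noiseEnergy β m Λ Λ' s J
      = ∑ X ∈ Λ'.powerset, ∑ Y ∈ Λ'.powerset, (J X - m X) * ((J Y - m Y) *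
        (gibbsState β Λ Λ' t (spinProd X) J * gibbsState β Λ Λ' s (spinProd Y) J)) := by
    intro J
    rw [noiseEnergy, noiseEnergy, Finset.sum_mul_sum]
    exact Finset.sum_congr rfl fun X _ => Finset.sum_congr rfl fun Y _ => by ring
  have hr : ∀ X Y, BddMeasurable fun J => (if X = Y then (Δ X : ℝ) ^ 2 else 0) *
          (gibbsState β Λ Λ' t (spinProd X) J * gibbsState β Λ Λ' s (spinProd Y) J)
        + (Δ X : ℝ) ^ 2 * (Δ Y : ℝ) ^ 2 * spinSpinDeriv₂ β Λ Λ' t s X Y J := fun X Y =>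
    ((hb X Y).const_mul _).add ((bddMeasurable_spinSpinDeriv₂ t s X Y).const_mul _)
  simp only [e, ← sum_spinSpinDeriv₂]
  rw [integral_finsetSum _ fun X _ => integrable_finsetSum _ fun Y _ =>
      integrable_coupling_mul_coupling_mul m Δ X Y (hb X Y),
    integral_finsetSum _ fun X _ => integrable_finsetSum _ fun Y _ => (hr X Y).integrable m Δ]
  refine Finset.sum_congr rfl fun X hX => ?_
  rw [integral_finsetSum _ fun Y _ => integrable_coupling_mul_coupling_mul m Δ X Y (hb X Y),
    integral_finsetSum _ fun Y _ => (hr X Y).integrable m Δ]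
  refine Finset.sum_congr rfl fun Y hY => ?_
  exact integral_coupling_mul_coupling_mul m Δ (hasCoordDeriv_spin_mul_spin hsub t s hX Y)
    (hasCoordDeriv_spinSpinDeriv hsub t s X hY) (hb X Y) (bddMeasurable_spinSpinDeriv t s X Y)
    (bddMeasurable_spinSpinDeriv₂ t s X Y)

/-- One integration by parts with a general observable f: taking f = 1 gives the mean of the noise
energy, and f = m gives its covariance with the mean energy. -/
theorem integral_gibbsState_mul_noiseEnergy (hsub : Λ' ⊆ Λ) (f : Config Λ → ℝ) (t s : ℝ) :
    ∫ J, gibbsState β Λ Λ' t f J * noiseEnergy β m Λ Λ' s J ∂(disorderLaw m Δ)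
      = ∫ J, ∑ X ∈ Λ'.powerset, (Δ X : ℝ) ^ 2 *
        (β * s * ((if X = ∅ then 0 else 1) - gibbsState β Λ Λ' s (spinProd X) J ^ 2)
          * gibbsState β Λ Λ' t f J
        + gibbsState β Λ Λ' s (spinProd X) J *
          (β * t * (gibbsState β Λ Λ' t (fun σ => f σ * spinProd X σ) J
            - gibbsState β Λ Λ' t f J * gibbsState β Λ Λ' t (spinProd X) J)))
        ∂(disorderLaw m Δ) := by
  have hg : ∀ t g, BddMeasurable (gibbsState β Λ Λ' t g) := fun t g =>
    bddMeasurable_gibbsState _ _ _ _ _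
  have hb : ∀ X, BddMeasurable fun J =>
      gibbsState β Λ Λ' s (spinProd X) J * gibbsState β Λ Λ' t f J := fun X =>
    (hg _ _).mul (hg _ _)
  have hd : ∀ X, BddMeasurable fun J =>
      (β * s * ((if X = ∅ then 0 else 1) - gibbsState β Λ Λ' s (spinProd X) J ^ 2)
          * gibbsState β Λ Λ' t f J
        + gibbsState β Λ Λ' s (spinProd X) J *
          (β * t * (gibbsState β Λ Λ' t (fun σ => f σ * spinProd X σ) J
            - gibbsState β Λ Λ' t f J * gibbsState β Λ Λ' t (spinProd X) J))) := by
    intro X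
    simp only [sq]
    exact ((((BddMeasurable.const _).sub ((hg _ _).mul (hg _ _))).const_mul _).mul (hg _ _)).add
      ((hg _ _).mul (((hg _ _).sub ((hg _ _).mul (hg _ _))).const_mul _))
  have e : ∀ J, gibbsState β Λ Λ' t f J * noiseEnergy β m Λ Λ' s J
      = ∑ X ∈ Λ'.powerset, (J X - m X) *
        (gibbsState β Λ Λ' s (spinProd X) J * gibbsState β Λ Λ' t f J) := by
    intro J
    rw [noiseEnergy, Finset.mul_sum]
    exact Finset.sum_congr rfl fun X _ => by ring
  simp only [e]
  rw [integral_finsetSum _ fun X _ => integrable_coupling_mul m Δ X (hb X),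
    integral_finsetSum _ fun X _ => ((hd X).const_mul _).integrable m Δ]
  refine Finset.sum_congr rfl fun X hX => ?_
  exact integral_coupling_mul m Δ ((hasCoordDeriv_spin_self hsub s hX).mul
    (hasCoordDeriv_gibbsState β hsub t f hX)) (hb X) (hd X)

end Covariances

end SpinGlass

namespace SpinGlass

variable {d : ℕ}

/-! ### Bookkeeping for expectations. -/

section HasMean

/-- `f` is integrable with integral `a`. -/
def HasMean {Ω : Type*} [MeasurableSpace Ω] (P : Measure Ω) (f : Ω → ℝ) (a : ℝ) : Prop :=
  Integrable f P ∧ ∫ ω, f ω ∂P = a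

namespace HasMean

variable {Ω : Type*} [MeasurableSpace Ω] {P : Measure Ω} {f g : Ω → ℝ} {a b : ℝ}

theorem add (hf : HasMean P f a) (hg : HasMean P g b) :
    HasMean P (fun ω => f ω + g ω) (a + b) :=
  ⟨hf.1.add hg.1, by rw [integral_add hf.1 hg.1, hf.2, hg.2]⟩

theorem sub (hf : HasMean P f a) (hg : HasMean P g b) :
    HasMean P (fun ω => f ω - g ω) (a - b) :=
  ⟨hf.1.sub hg.1, by rw [integral_sub hf.1 hg.1, hf.2, hg.2]⟩

theorem const_mul (c : ℝ) (hf : HasMean P f a) : HasMean P (fun ω => c * f ω) (c * a) :=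
  ⟨hf.1.const_mul c, by rw [integral_const_mul, hf.2]⟩

theorem const [IsProbabilityMeasure P] (c : ℝ) : HasMean P (fun _ => c) c :=
  ⟨integrable_const c, by simp⟩

theorem integral_eq (hf : HasMean P f a) (h : ∀ ω, g ω = f ω) (hab : a = b) :
    ∫ ω, g ω ∂P = b := by
  rw [← hab, ← hf.2]
  exact integral_congr_ae (ae_of_all _ h)

end HasMean

end HasMean

/-! ### Covariances of the energies in terms of quenched replica averages. -/

section QuenchedCovariances

variable {β : ℝ} {m : Finset (Site d) → ℝ} {Δ : Finset (Site d) → ℝ≥0} {Λ Λ' : Finset (Site d)}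

theorem BddMeasurable.hasMean {f : Disorder d → ℝ} (hf : BddMeasurable f) (c : ℝ) (hc : c ≠ 0)
    {k : ℕ} {t : Fin k → ℝ} {F : (Fin k → Config Λ) → ℝ}
    (h : ∀ J, randomState β Λ Λ' J t F = f J / c) :
    HasMean (disorderLaw m Δ) f (c * quenched β m Δ Λ Λ' t F) := by
  refine ⟨hf.integrable m Δ, ?_⟩
  unfold quenched
  simp only [h]
  rw [integral_div]
  field_simp

theorem hasMean_overlap (hN : (Λ'.card : ℝ) ≠ 0) (t s : ℝ) :
    HasMean (disorderLaw m Δ) (overlap β Δ Λ Λ' t s)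
      (Λ'.card * quenched β m Δ Λ Λ' ![t, s] (fun σ => cov Δ Λ' (σ 0) (σ 1))) :=
  (bddMeasurable_overlap t s).hasMean _ hN fun J => randomState_cov J t s

theorem hasMean_overlap_mul (hN : (Λ'.card : ℝ) ≠ 0) (t s r q : ℝ) :
    HasMean (disorderLaw m Δ) (fun J => overlap β Δ Λ Λ' t s J * overlap β Δ Λ Λ' r q J)
      ((Λ'.card : ℝ) ^ 2 * quenched β m Δ Λ Λ' ![t, s, r, q]
        (fun σ => cov Δ Λ' (σ 0) (σ 1) * cov Δ Λ' (σ 2) (σ 3))) :=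
  ((bddMeasurable_overlap t s).mul (bddMeasurable_overlap r q)).hasMean _ (pow_ne_zero 2 hN)
    fun J => randomState_cov_mul_cov J t s r q

theorem hasMean_chainOverlap (hN : (Λ'.card : ℝ) ≠ 0) (t s r : ℝ) :
    HasMean (disorderLaw m Δ) (chainOverlap β Δ Λ Λ' t s r)
      ((Λ'.card : ℝ) ^ 2 * quenched β m Δ Λ Λ' ![t, s, r]
        (fun σ => cov Δ Λ' (σ 0) (σ 1) * cov Δ Λ' (σ 1) (σ 2))) :=
  (bddMeasurable_chainOverlap t s r).hasMean _ (pow_ne_zero 2 hN)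
    fun J => randomState_cov_chain J t s r

theorem hasMean_squareOverlap (hN : (Λ'.card : ℝ) ≠ 0) (t s : ℝ) :
    HasMean (disorderLaw m Δ) (squareOverlap β Δ Λ Λ' t s)
      ((Λ'.card : ℝ) ^ 2 * quenched β m Δ Λ Λ' ![t, s]
        (fun σ => cov Δ Λ' (σ 0) (σ 1) ^ 2)) :=
  (bddMeasurable_squareOverlap t s).hasMean _ (pow_ne_zero 2 hN)
    fun J => randomState_cov_sq J t s

theorem hasMean_magOverlap (hN : (Λ'.card : ℝ) ≠ 0) (t s : ℝ) :
    HasMean (disorderLaw m Δ) (magOverlap β m Δ Λ Λ' t s)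
      (Λ'.card * quenched β m Δ Λ Λ' ![t, s]
        (fun σ => mag m Λ' (σ 0) * cov Δ Λ' (σ 0) (σ 1))) :=
  (bddMeasurable_magOverlap t s).hasMean _ hN fun J => randomState_mag_cov J t s

theorem hasMean_mag_mul_overlap (hN : (Λ'.card : ℝ) ≠ 0) (t s r : ℝ) :
    HasMean (disorderLaw m Δ)
      (fun J => gibbsState β Λ Λ' t (mag m Λ') J * overlap β Δ Λ Λ' s r J)
      (Λ'.card * quenched β m Δ Λ Λ' ![t, s, r]
        (fun σ => mag m Λ' (σ 0) * cov Δ Λ' (σ 1) (σ 2))) :=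
  ((bddMeasurable_gibbsState _ _ _ _ _).mul (bddMeasurable_overlap s r)).hasMean _ hN
    fun J => randomState_mag_mul_cov J t s r

theorem hasMean_mag (t : ℝ) :
    HasMean (disorderLaw m Δ) (gibbsState β Λ Λ' t (mag m Λ'))
      (quenched β m Δ Λ Λ' ![t] (fun σ => mag m Λ' (σ 0))) := by
  have := (bddMeasurable_gibbsState β Λ Λ' t (mag m Λ')).hasMean (m := m) (Δ := Δ) 1 one_ne_zero
    (t := ![t]) (F := fun σ => mag m Λ' (σ 0)) fun J => by rw [randomState_one, div_one]
  rwa [one_mul] at this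

theorem hasMean_mag_mul_mag (t s : ℝ) :
    HasMean (disorderLaw m Δ)
      (fun J => gibbsState β Λ Λ' t (mag m Λ') J * gibbsState β Λ Λ' s (mag m Λ') J)
      (quenched β m Δ Λ Λ' ![t, s] (fun σ => mag m Λ' (σ 0) * mag m Λ' (σ 1))) := by
  have := ((bddMeasurable_gibbsState β Λ Λ' t (mag m Λ')).mul
    (bddMeasurable_gibbsState β Λ Λ' s (mag m Λ'))).hasMean (m := m) (Δ := Δ) 1 one_ne_zero
    (t := ![t, s]) (F := fun σ => mag m Λ' (σ 0) * mag m Λ' (σ 1))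
    fun J => by rw [randomState_two, div_one]
  rwa [one_mul] at this

theorem memLp_noiseEnergy (t : ℝ) : MemLp (noiseEnergy β m Λ Λ' t) 2 (disorderLaw m Δ) := by
  refine memLp_finsetSum _ fun X _ => ?_
  refine (memLp_coupling_sub m Δ X).of_le_mul (c := 1) ?_ (ae_of_all _ fun J => ?_)
  · exact (((measurable_pi_apply X).sub_const _).mul
      (measurable_gibbsState β Λ Λ' t _)).aestronglyMeasurable
  · rw [norm_mul, mul_comm]
    exact mul_le_mul_of_nonneg_right (abs_gibbsState_le β Λ Λ' (abs_spinProd_le X) t J)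
      (norm_nonneg _)

theorem bddMeasurable_meanEnergy (t : ℝ) : BddMeasurable (meanEnergy β m Λ Λ' t) :=
  (bddMeasurable_gibbsState _ _ _ _ _).const_mul _

theorem integral_noiseEnergy (hN : (Λ'.card : ℝ) ≠ 0) (hsub : Λ' ⊆ Λ) (t : ℝ) :
    ∫ J, noiseEnergy β m Λ Λ' t J ∂(disorderLaw m Δ)
      = β * t * ((∑ X ∈ Λ'.powerset, (Δ X : ℝ) ^ 2 * (if X = ∅ then 0 else 1))
        - Λ'.card * quenched β m Δ Λ Λ' ![t, t] (fun σ => cov Δ Λ' (σ 0) (σ 1))) := by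
  have h := integral_gibbsState_mul_noiseEnergy (β := β) (m := m) (Δ := Δ) hsub (fun _ => 1) t t
  have h1 : ∀ J, gibbsState β Λ Λ' t (fun _ => 1) J = 1 := fun J => gibbsAvg_const _ 1
  simp only [h1, one_mul, mul_one, sub_self, mul_zero, add_zero] at h
  rw [h]
  refine (((HasMean.const (∑ X ∈ Λ'.powerset, (Δ X : ℝ) ^ 2 * (if X = ∅ then 0 else 1))).sub
    (hasMean_overlap hN t t)).const_mul (β * t)).integral_eq (fun J => ?_) rfl
  unfold overlap
  rw [← Finset.sum_sub_distrib, Finset.mul_sum]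
  exact Finset.sum_congr rfl fun X _ => by ring

/-- The product of the two means cancels the V² term and the terms linear in V, where V is the sum
of Δ_X² over nonempty X ⊆ Λ'; only replica averages survive. -/
theorem covariance_noise_noise (hN : (Λ'.card : ℝ) ≠ 0) (hsub : Λ' ⊆ Λ) (t s : ℝ) :
    cov[noiseEnergy β m Λ Λ' t, noiseEnergy β m Λ Λ' s; disorderLaw m Δ]
      = Λ'.card * quenched β m Δ Λ Λ' ![t, s] (fun σ => cov Δ Λ' (σ 0) (σ 1))
        + β ^ 2 * (Λ'.card : ℝ) ^ 2 *
        (t * s * (quenched β m Δ Λ Λ' ![t, t, s, s]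
            (fun σ => cov Δ Λ' (σ 0) (σ 1) * cov Δ Λ' (σ 2) (σ 3))
          - quenched β m Δ Λ Λ' ![t, t] (fun σ => cov Δ Λ' (σ 0) (σ 1))
            * quenched β m Δ Λ Λ' ![s, s] (fun σ => cov Δ Λ' (σ 0) (σ 1)))
        - 2 * (t ^ 2 * (quenched β m Δ Λ Λ' ![t, t, s]
            (fun σ => cov Δ Λ' (σ 0) (σ 1) * cov Δ Λ' (σ 1) (σ 2))
          - quenched β m Δ Λ Λ' ![t, t, s, t]
            (fun σ => cov Δ Λ' (σ 0) (σ 1) * cov Δ Λ' (σ 2) (σ 3))))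
        - 2 * (s ^ 2 * (quenched β m Δ Λ Λ' ![s, s, t]
            (fun σ => cov Δ Λ' (σ 0) (σ 1) * cov Δ Λ' (σ 1) (σ 2))
          - quenched β m Δ Λ Λ' ![s, s, t, s]
            (fun σ => cov Δ Λ' (σ 0) (σ 1) * cov Δ Λ' (σ 2) (σ 3))))
        + t * s * (quenched β m Δ Λ Λ' ![t, s] (fun σ => cov Δ Λ' (σ 0) (σ 1) ^ 2)
          + quenched β m Δ Λ Λ' ![t, s, s, t]
            (fun σ => cov Δ Λ' (σ 0) (σ 1) * cov Δ Λ' (σ 2) (σ 3)))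
        - t * s * quenched β m Δ Λ Λ' ![t, s, t]
            (fun σ => cov Δ Λ' (σ 0) (σ 1) * cov Δ Λ' (σ 1) (σ 2))
        - s * t * quenched β m Δ Λ Λ' ![s, t, s]
            (fun σ => cov Δ Λ' (σ 0) (σ 1) * cov Δ Λ' (σ 1) (σ 2))) := by
  rw [covariance_eq_sub (memLp_noiseEnergy t) (memLp_noiseEnergy s), integral_noiseEnergy hN hsub,
    integral_noiseEnergy hN hsub]
  simp only [Pi.mul_apply]
  rw [integral_noiseEnergy_mul hsub]
  set V := ∑ X ∈ Λ'.powerset, (Δ X : ℝ) ^ 2 * (if X = ∅ then 0 else 1)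
  have ho := hasMean_overlap (β := β) (m := m) (Δ := Δ) (Λ := Λ) hN
  have hm := hasMean_overlap_mul (β := β) (m := m) (Δ := Δ) (Λ := Λ) hN
  have hc := hasMean_chainOverlap (β := β) (m := m) (Δ := Δ) (Λ := Λ) hN
  have hs := hasMean_squareOverlap (β := β) (m := m) (Δ := Δ) (Λ := Λ) hN
  have h := (ho t s).add (((((((((HasMean.const (V ^ 2)).sub ((ho t t).const_mul V)).sub
      ((ho s s).const_mul V)).add (hm t t s s)).const_mul (t * s)).sub
      (((hc t t s).sub (hm t t s t)).const_mul (2 * t ^ 2))).sub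
      (((hc s s t).sub (hm s s t s)).const_mul (2 * s ^ 2))).add
      (((((hs t s).sub (hc t s t)).sub (hc s t s)).add (hm t s s t)).const_mul
        (t * s))).const_mul (β ^ 2))
  rw [h.integral_eq (g := noiseIntegrand β Δ Λ Λ' V t s) (fun J => ?_) rfl]
  · ring
  · unfold noiseIntegrand
    ring

theorem covariance_mean_mean (t s : ℝ) :
    cov[meanEnergy β m Λ Λ' t, meanEnergy β m Λ Λ' s; disorderLaw m Δ]
      = (Λ'.card : ℝ) ^ 2 * (quenched β m Δ Λ Λ' ![t, s] (fun σ => mag m Λ' (σ 0) * mag m Λ' (σ 1))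
        - quenched β m Δ Λ Λ' ![t] (fun σ => mag m Λ' (σ 0))
          * quenched β m Δ Λ Λ' ![s] (fun σ => mag m Λ' (σ 0))) := by
  rw [covariance_eq_sub ((bddMeasurable_meanEnergy t).memLp m Δ)
    ((bddMeasurable_meanEnergy s).memLp m Δ)]
  have h1 := fun t => ((hasMean_mag (β := β) (m := m) (Δ := Δ) (Λ := Λ) (Λ' := Λ') t).const_mul
    (-(Λ'.card : ℝ))).2
  have h2 := ((hasMean_mag_mul_mag (β := β) (m := m) (Δ := Δ) (Λ := Λ) (Λ' := Λ') t s).const_mul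
    ((Λ'.card : ℝ) ^ 2)).integral_eq
      (g := fun J => meanEnergy β m Λ Λ' t J * meanEnergy β m Λ Λ' s J)
      (fun J => by unfold meanEnergy; ring) rfl
  simp only [Pi.mul_apply]
  rw [h2]
  unfold meanEnergy
  rw [h1, h1]
  ring

/-- Here too V multiplies the same average ⟨m⟩_t in the mixed moment and in the product of means, so
it disappears. -/
theorem covariance_mean_noise (hN : (Λ'.card : ℝ) ≠ 0) (hsub : Λ' ⊆ Λ) (t s : ℝ) :
    cov[meanEnergy β m Λ Λ' t, noiseEnergy β m Λ Λ' s; disorderLaw m Δ]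
      = (Λ'.card : ℝ) ^ 2 * β *
        (s * (quenched β m Δ Λ Λ' ![t, s, s] (fun σ => mag m Λ' (σ 0) * cov Δ Λ' (σ 1) (σ 2)))
        + t * (quenched β m Δ Λ Λ' ![t, s, t] (fun σ => mag m Λ' (σ 0) * cov Δ Λ' (σ 1) (σ 2)))
        - t * (quenched β m Δ Λ Λ' ![t, s] (fun σ => mag m Λ' (σ 0) * cov Δ Λ' (σ 0) (σ 1)))
        - s * (quenched β m Δ Λ Λ' ![s, s] (fun σ => cov Δ Λ' (σ 0) (σ 1))
          * quenched β m Δ Λ Λ' ![t] (fun σ => mag m Λ' (σ 0)))) := by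
  rw [covariance_eq_sub ((bddMeasurable_meanEnergy t).memLp m Δ) (memLp_noiseEnergy s),
    integral_noiseEnergy hN hsub]
  have h1 := ((hasMean_mag (β := β) (m := m) (Δ := Δ) (Λ := Λ) (Λ' := Λ') t).const_mul
    (-(Λ'.card : ℝ))).2
  set V := ∑ X ∈ Λ'.powerset, (Δ X : ℝ) ^ 2 * (if X = ∅ then 0 else 1) with hV
  have h2 : ∫ J, meanEnergy β m Λ Λ' t J * noiseEnergy β m Λ Λ' s J ∂(disorderLaw m Δ)
      = -(Λ'.card : ℝ) * ∫ J, gibbsState β Λ Λ' t (mag m Λ') J * noiseEnergy β m Λ Λ' s J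
        ∂(disorderLaw m Δ) := by
    rw [← integral_const_mul]
    simp only [meanEnergy, mul_assoc]
  have ho := hasMean_magOverlap (β := β) (m := m) (Δ := Δ) (Λ := Λ) hN
  have hm := hasMean_mag_mul_overlap (β := β) (m := m) (Δ := Δ) (Λ := Λ) hN
  have h3 := ((((hasMean_mag (β := β) (m := m) (Δ := Δ) (Λ := Λ) (Λ' := Λ') t).const_mul V).sub
    (hm t s s)).const_mul (β * s)).add (((ho t s).sub (hm t s t)).const_mul (β * t))
  simp only [Pi.mul_apply]
  rw [h2, integral_gibbsState_mul_noiseEnergy hsub, h3.integral_eq (fun J => ?_) rfl]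
  · unfold meanEnergy
    rw [h1]
    ring
  · rw [hV, Finset.sum_mul]
    unfold overlap magOverlap
    simp only [Finset.mul_sum, ← Finset.sum_sub_distrib, ← Finset.sum_add_distrib]
    exact Finset.sum_congr rfl fun X _ => by ring

theorem continuous_quenched {k : ℕ} (f : (Fin k → Config Λ) → ℝ) :
    Continuous fun t => quenched β m Δ Λ Λ' t f := by
  obtain ⟨C, hC⟩ : ∃ C, ∀ σ, |f σ| ≤ C :=
    ⟨∑ τ, |f τ|, fun σ => Finset.single_le_sum (f := fun τ => |f τ|) (fun _ _ => abs_nonneg _)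
      (Finset.mem_univ σ)⟩
  unfold quenched
  refine continuous_of_dominated (bound := fun _ => C) (fun t => ?_)
    (fun t => ae_of_all _ fun J => abs_randomState_le J t hC) (integrable_const C)
    (ae_of_all _ fun J => ?_)
  · have h : Continuous fun J => randomState β Λ Λ' J t f :=
      Continuous.comp (g := fun p : (Fin k → ℝ) × Disorder d => randomState β Λ Λ' p.2 p.1 f)
        (f := fun J => (t, J)) (continuous_randomState f) (by fun_prop)
    exact h.measurable.aestronglyMeasurable
  · exact Continuous.comp (g := fun p : (Fin k → ℝ) × Disorder d => randomState β Λ Λ' p.2 p.1 f)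
      (f := fun t => (t, J)) (continuous_randomState f) (by fun_prop)

theorem abs_quenched_le {k : ℕ} (t : Fin k → ℝ) {f : (Fin k → Config Λ) → ℝ} {C : ℝ}
    (hf : ∀ σ, |f σ| ≤ C) : |quenched β m Δ Λ Λ' t f| ≤ C := by
  unfold quenched
  simpa using norm_integral_le_of_norm_le_const (μ := disorderLaw m Δ)
    (f := fun J => randomState β Λ Λ' J t f) (ae_of_all _ fun J => abs_randomState_le J t hf)

end QuenchedCovariances

end SpinGlass

namespace SpinGlass

variable {d : ℕ}

/-! ### Integration over the interpolation: the variance identity and its upper bound. -/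

section Integrated

variable {β : ℝ} {m : Finset (Site d) → ℝ} {Δ : Finset (Site d) → ℝ≥0} {Λ Λ' : Finset (Site d)}

theorem covariance_intervalIntegral {Ω : Type*} [MeasurableSpace Ω] {P : Measure Ω}
    [IsProbabilityMeasure P] {φ ψ : ℝ → Ω → ℝ} (hφ : Measurable (Function.uncurry φ))
    (hψ : Measurable (Function.uncurry ψ)) {G : Ω → ℝ} (hG : MemLp G 2 P)
    (hφG : ∀ t ω, |φ t ω| ≤ G ω) (hψG : ∀ t ω, |ψ t ω| ≤ G ω) :
    cov[fun ω => ∫ t in (-1 : ℝ)..1, φ t ω, fun ω => ∫ s in (-1 : ℝ)..1, ψ s ω; P]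
      = squareIntegral fun t s => cov[φ t, ψ s; P] := by
  simp only [squareIntegral, intervalIntegral.integral_of_le (show (-1 : ℝ) ≤ 1 by norm_num)]
  exact covariance_integral hφ hψ hG hφG hψG

theorem memLp_intervalIntegral {Ω : Type*} [MeasurableSpace Ω] {P : Measure Ω}
    [IsProbabilityMeasure P] {φ : ℝ → Ω → ℝ} (hφ : Measurable (Function.uncurry φ)) {G : Ω → ℝ}
    (hG : MemLp G 2 P) (hφG : ∀ t ω, |φ t ω| ≤ G ω) :
    MemLp (fun ω => ∫ t in (-1 : ℝ)..1, φ t ω) 2 P := by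
  simp only [intervalIntegral.integral_of_le (show (-1 : ℝ) ≤ 1 by norm_num)]
  exact memLp_integral_param hφ hG hφG

theorem continuous_noiseEnergy :
    Continuous fun p : ℝ × Disorder d => noiseEnergy β m Λ Λ' p.1 p.2 := by
  unfold noiseEnergy
  refine continuous_finsetSum _ fun X _ => Continuous.mul (by fun_prop) ?_
  exact continuous_gibbsState β Λ Λ' _

theorem continuous_meanEnergy :
    Continuous fun p : ℝ × Disorder d => meanEnergy β m Λ Λ' p.1 p.2 :=
  continuous_const.mul (continuous_gibbsState β Λ Λ' _)

theorem measurable_noiseEnergy : Measurable (Function.uncurry (noiseEnergy β m Λ Λ')) :=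
  continuous_noiseEnergy.measurable

theorem measurable_meanEnergy : Measurable (Function.uncurry (meanEnergy β m Λ Λ')) :=
  continuous_meanEnergy.measurable

/-- A single square-integrable majorant, uniform in t, justifies exchanging the parameter integrals
with the disorder average. -/
theorem exists_energy_bound : ∃ G : Disorder d → ℝ, MemLp G 2 (disorderLaw m Δ) ∧
    (∀ t J, |noiseEnergy β m Λ Λ' t J| ≤ G J) ∧ (∀ t J, |meanEnergy β m Λ Λ' t J| ≤ G J) := by
  obtain ⟨C, hC⟩ := exists_abs_le Λ (mag m Λ')
  have hC' : ∀ t J, |meanEnergy β m Λ Λ' t J| ≤ Λ'.card * C := fun t J => by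
    rw [meanEnergy, abs_mul, abs_neg, Nat.abs_cast]
    exact mul_le_mul_of_nonneg_left (abs_gibbsState_le β Λ Λ' hC t J) (Nat.cast_nonneg _)
  have hn : ∀ t J, |noiseEnergy β m Λ Λ' t J| ≤ ∑ X ∈ Λ'.powerset, |J X - m X| := fun t J => by
    refine (Finset.abs_sum_le_sum_abs _ _).trans (Finset.sum_le_sum fun X _ => ?_)
    rw [abs_mul]
    exact mul_le_of_le_one_right (abs_nonneg _)
      (abs_gibbsState_le β Λ Λ' (abs_spinProd_le X) t J)
  refine ⟨fun J => ∑ X ∈ Λ'.powerset, |J X - m X| + Λ'.card * C, ?_, fun t J => ?_, fun t J => ?_⟩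
  · exact (memLp_finsetSum _ fun X _ => (memLp_coupling_sub m Δ X).abs).add (memLp_const _)
  · exact (hn t J).trans (le_add_of_nonneg_right ((abs_nonneg _).trans (hC' t J)))
  · exact (hC' t J).trans (le_add_of_nonneg_left ((abs_nonneg _).trans (hn t J)))

variable (β m Λ Λ') in
/-- The integral of `meanEnergy` over `t`. -/
noncomputable def meanPart (J : Disorder d) : ℝ := ∫ t in (-1 : ℝ)..1, meanEnergy β m Λ Λ' t J

variable (β m Λ Λ') in
/-- The integral of `noiseEnergy` over `t`. -/
noncomputable def noisePart (J : Disorder d) : ℝ := ∫ t in (-1 : ℝ)..1, noiseEnergy β m Λ Λ' t J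

theorem memLp_meanPart : MemLp (meanPart β m Λ Λ') 2 (disorderLaw m Δ) := by
  obtain ⟨G, hG, _, h⟩ := exists_energy_bound (β := β) (m := m) (Δ := Δ) (Λ := Λ) (Λ' := Λ')
  exact memLp_intervalIntegral measurable_meanEnergy hG h

theorem memLp_noisePart : MemLp (noisePart β m Λ Λ') 2 (disorderLaw m Δ) := by
  obtain ⟨G, hG, h, _⟩ := exists_energy_bound (β := β) (m := m) (Δ := Δ) (Λ := Λ) (Λ' := Λ')
  exact memLp_intervalIntegral measurable_noiseEnergy hG h

theorem continuous_quenched_one {f : (Fin 1 → Config Λ) → ℝ} {a : ℝ × ℝ → ℝ}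
    (ha : Continuous a) : Continuous fun p => quenched β m Δ Λ Λ' ![a p] f :=
  (continuous_quenched f).comp (by fun_prop : Continuous fun p => ![a p])

theorem continuous_quenched_two {f : (Fin 2 → Config Λ) → ℝ} {a b : ℝ × ℝ → ℝ}
    (ha : Continuous a) (hb : Continuous b) :
    Continuous fun p => quenched β m Δ Λ Λ' ![a p, b p] f :=
  (continuous_quenched f).comp (by fun_prop : Continuous fun p => ![a p, b p])

theorem continuous_quenched_three {f : (Fin 3 → Config Λ) → ℝ} {a b c : ℝ × ℝ → ℝ}
    (ha : Continuous a) (hb : Continuous b) (hc : Continuous c) :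
    Continuous fun p => quenched β m Δ Λ Λ' ![a p, b p, c p] f :=
  (continuous_quenched f).comp (by fun_prop : Continuous fun p => ![a p, b p, c p])

theorem continuous_quenched_four {f : (Fin 4 → Config Λ) → ℝ} {a b c e : ℝ × ℝ → ℝ}
    (ha : Continuous a) (hb : Continuous b) (hc : Continuous c) (he : Continuous e) :
    Continuous fun p => quenched β m Δ Λ Λ' ![a p, b p, c p, e p] f :=
  (continuous_quenched f).comp (by fun_prop : Continuous fun p => ![a p, b p, c p, e p])

/-- Exchanging t and s under the double integral merges the t² and s² terms, which gives the
coefficient 4, and merges the two mixed chain terms, which gives the 2 in Q. -/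
theorem variance_noisePart (hN : (Λ'.card : ℝ) ≠ 0) (hsub : Λ' ⊆ Λ) :
    β ^ 2 * Var[noisePart β m Λ Λ'; disorderLaw m Δ]
      = (Λ'.card : ℝ) ^ 2 * quarticTerms β m Δ Λ Λ'
        + Λ'.card * β ^ 2 * squareIntegral fun t s =>
          quenched β m Δ Λ Λ' ![t, s] (fun σ => cov Δ Λ' (σ 0) (σ 1)) := by
  obtain ⟨G, hG, h, _⟩ := exists_energy_bound (β := β) (m := m) (Δ := Δ) (Λ := Λ) (Λ' := Λ')
  rw [← covariance_self memLp_noisePart.aestronglyMeasurable.aemeasurable]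
  unfold noisePart
  rw [covariance_intervalIntegral measurable_noiseEnergy measurable_noiseEnergy hG h h]
  simp only [covariance_noise_noise hN hsub]
  set o : ℝ → ℝ → ℝ := fun t s =>
    quenched β m Δ Λ Λ' ![t, s] (fun σ => cov Δ Λ' (σ 0) (σ 1)) with ho
  set k : ℝ → ℝ → ℝ := fun t s => t * s * (quenched β m Δ Λ Λ' ![t, t, s, s]
      (fun σ => cov Δ Λ' (σ 0) (σ 1) * cov Δ Λ' (σ 2) (σ 3))
    - quenched β m Δ Λ Λ' ![t, t] (fun σ => cov Δ Λ' (σ 0) (σ 1))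
      * quenched β m Δ Λ Λ' ![s, s] (fun σ => cov Δ Λ' (σ 0) (σ 1))) with hk
  set l : ℝ → ℝ → ℝ := fun t s => t ^ 2 * (quenched β m Δ Λ Λ' ![t, t, s]
      (fun σ => cov Δ Λ' (σ 0) (σ 1) * cov Δ Λ' (σ 1) (σ 2))
    - quenched β m Δ Λ Λ' ![t, t, s, t]
      (fun σ => cov Δ Λ' (σ 0) (σ 1) * cov Δ Λ' (σ 2) (σ 3))) with hl
  set u : ℝ → ℝ → ℝ := fun t s => t * s * (quenched β m Δ Λ Λ' ![t, s]
      (fun σ => cov Δ Λ' (σ 0) (σ 1) ^ 2)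
    + quenched β m Δ Λ Λ' ![t, s, s, t]
      (fun σ => cov Δ Λ' (σ 0) (σ 1) * cov Δ Λ' (σ 2) (σ 3))) with hu
  set r : ℝ → ℝ → ℝ := fun t s => t * s * quenched β m Δ Λ Λ' ![t, s, t]
      (fun σ => cov Δ Λ' (σ 0) (σ 1) * cov Δ Λ' (σ 1) (σ 2)) with hr
  have co : Continuous (Function.uncurry o) := continuous_quenched_two continuous_fst continuous_snd
  have ck : Continuous (Function.uncurry k) :=
    (continuous_fst.mul continuous_snd).mul ((continuous_quenched_four continuous_fst continuous_fst
      continuous_snd continuous_snd).sub ((continuous_quenched_two continuous_fst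
      continuous_fst).mul (continuous_quenched_two continuous_snd continuous_snd)))
  have cl : Continuous (Function.uncurry l) :=
    (continuous_fst.pow 2).mul ((continuous_quenched_three continuous_fst continuous_fst
      continuous_snd).sub (continuous_quenched_four continuous_fst continuous_fst
      continuous_snd continuous_fst))
  have cu : Continuous (Function.uncurry u) :=
    (continuous_fst.mul continuous_snd).mul ((continuous_quenched_two continuous_fst
      continuous_snd).add (continuous_quenched_four continuous_fst continuous_snd
      continuous_snd continuous_fst))
  have cr : Continuous (Function.uncurry r) :=
    (continuous_fst.mul continuous_snd).mul (continuous_quenched_three continuous_fst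
      continuous_snd continuous_fst)
  have cl' : Continuous (Function.uncurry fun t s => l s t) := cl.comp continuous_swap
  have cr' : Continuous (Function.uncurry fun t s => r s t) := cr.comp continuous_swap
  have c1 : Continuous (Function.uncurry fun t s => 2 * l t s) := continuous_const.mul cl
  have c2 : Continuous (Function.uncurry fun t s => 2 * l s t) := continuous_const.mul cl'
  have c3 : Continuous (Function.uncurry fun t s => k t s - 2 * l t s) := ck.sub c1
  have c4 : Continuous (Function.uncurry fun t s => k t s - 2 * l t s - 2 * l s t) := c3.sub c2
  have c5 : Continuous (Function.uncurry fun t s => k t s - 2 * l t s - 2 * l s t + u t s) :=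
    c4.add cu
  have c6 : Continuous (Function.uncurry fun t s =>
    k t s - 2 * l t s - 2 * l s t + u t s - r t s) := c5.sub cr
  have c7 : Continuous (Function.uncurry fun t s => Λ'.card * o t s) := continuous_const.mul co
  have c8 : Continuous (Function.uncurry fun t s => β ^ 2 * (Λ'.card : ℝ) ^ 2 *
    (k t s - 2 * l t s - 2 * l s t + u t s - r t s - r s t)) :=
    continuous_const.mul (c6.sub cr')
  have c9 : Continuous (Function.uncurry fun t s => 2 * r t s) := continuous_const.mul cr
  have e1 : squareIntegral (fun t s => Λ'.card * o t s + β ^ 2 * (Λ'.card : ℝ) ^ 2 *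
      (k t s - 2 * l t s - 2 * l s t + u t s - r t s - r s t))
      = Λ'.card * squareIntegral o + β ^ 2 * (Λ'.card : ℝ) ^ 2 *
        (squareIntegral k - 4 * squareIntegral l + squareIntegral u - 2 * squareIntegral r) := by
    rw [squareIntegral_add c7 c8, squareIntegral_const_mul, squareIntegral_const_mul,
      squareIntegral_sub c6 cr', squareIntegral_sub c5 cr, squareIntegral_add c4 cu,
      squareIntegral_sub c3 c2, squareIntegral_sub ck c1, squareIntegral_const_mul,
      squareIntegral_const_mul, squareIntegral_swap cl, squareIntegral_swap cr]
    ring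
  have e2 : quarticTerms β m Δ Λ Λ' = β ^ 4 * squareIntegral k - 4 * β ^ 4 * squareIntegral l
      + β ^ 4 * (squareIntegral u - 2 * squareIntegral r) := by
    rw [← squareIntegral_const_mul 2 r, ← squareIntegral_sub cu c9]
    unfold quarticTerms squareIntegral
    congr 2
    refine intervalIntegral.integral_congr fun t _ => intervalIntegral.integral_congr fun s _ => ?_
    simp only [hu, hr]
    ring
  refine (congrArg (β ^ 2 * ·) e1).trans ?_
  rw [e2]
  ring

/-- Matching with the magnetic terms needs the exchange of t and s for the summands weighted by s,
and the vanishing by oddness of the d_{Λ'} term. -/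
theorem variance_meanPart_add (hN : (Λ'.card : ℝ) ≠ 0) (hsub : Λ' ⊆ Λ) :
    β ^ 2 * Var[meanPart β m Λ Λ'; disorderLaw m Δ]
      + 2 * β ^ 2 * cov[meanPart β m Λ Λ', noisePart β m Λ Λ'; disorderLaw m Δ]
      = (Λ'.card : ℝ) ^ 2 * magneticTerms β m Δ Λ Λ' := by
  obtain ⟨G, hG, h, h'⟩ := exists_energy_bound (β := β) (m := m) (Δ := Δ) (Λ := Λ) (Λ' := Λ')
  rw [← covariance_self memLp_meanPart.aestronglyMeasurable.aemeasurable]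
  unfold meanPart noisePart
  rw [covariance_intervalIntegral measurable_meanEnergy measurable_meanEnergy hG h' h',
    covariance_intervalIntegral measurable_meanEnergy measurable_noiseEnergy hG h' h]
  simp only [covariance_mean_mean, covariance_mean_noise hN hsub]
  set w : ℝ → ℝ := fun s => quenched β m Δ Λ Λ' ![s] (fun σ => mag m Λ' (σ 0)) with hw
  set a₁ : ℝ → ℝ → ℝ := fun t s => s * (quenched β m Δ Λ Λ' ![t, s, s]
    (fun σ => mag m Λ' (σ 0) * cov Δ Λ' (σ 1) (σ 2))) with h1
  set a₂ : ℝ → ℝ → ℝ := fun t s => t * (quenched β m Δ Λ Λ' ![t, s, t]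
    (fun σ => mag m Λ' (σ 0) * cov Δ Λ' (σ 1) (σ 2))) with h2
  set a₃ : ℝ → ℝ → ℝ := fun t s => t * (quenched β m Δ Λ Λ' ![t, s]
    (fun σ => mag m Λ' (σ 0) * cov Δ Λ' (σ 0) (σ 1))) with h3
  set a₄ : ℝ → ℝ → ℝ := fun t s => s * (quenched β m Δ Λ Λ' ![s, s]
    (fun σ => cov Δ Λ' (σ 0) (σ 1)) * w t) with h4
  have c1 : Continuous (Function.uncurry a₁) := continuous_snd.mul
    (continuous_quenched_three continuous_fst continuous_snd continuous_snd)
  have c2 : Continuous (Function.uncurry a₂) := continuous_fst.mul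
    (continuous_quenched_three continuous_fst continuous_snd continuous_fst)
  have c3 : Continuous (Function.uncurry a₃) := continuous_fst.mul
    (continuous_quenched_two continuous_fst continuous_snd)
  have c4 : Continuous (Function.uncurry a₄) := continuous_snd.mul
    ((continuous_quenched_two continuous_snd continuous_snd).mul
      (continuous_quenched_one continuous_fst))
  have c1' : Continuous (Function.uncurry fun t s => a₁ s t) := c1.comp continuous_swap
  have c4' : Continuous (Function.uncurry fun t s => a₄ s t) := c4.comp continuous_swap
  have c0 : Continuous (Function.uncurry fun t s => varDensity Δ Λ' * (t * w s)) :=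
    continuous_const.mul (continuous_fst.mul (continuous_quenched_one continuous_snd))
  have c12 : Continuous (Function.uncurry fun t s => a₁ t s + a₂ t s) := c1.add c2
  have c123 : Continuous (Function.uncurry fun t s => a₁ t s + a₂ t s - a₃ t s) := c12.sub c3
  have c21 : Continuous (Function.uncurry fun t s => a₂ t s + a₁ s t) := c2.add c1'
  have e1 : squareIntegral (fun t s => (Λ'.card : ℝ) ^ 2 * β *
      (a₁ t s + a₂ t s - a₃ t s - a₄ t s)) = (Λ'.card : ℝ) ^ 2 * β *
      (squareIntegral a₁ + squareIntegral a₂ - squareIntegral a₃ - squareIntegral a₄) := by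
    rw [squareIntegral_const_mul, squareIntegral_sub c123 c4, squareIntegral_sub c12 c3,
      squareIntegral_add c1 c2]
  have e2 : squareIntegral (fun t s => a₃ t s + a₄ s t)
      = squareIntegral a₃ + squareIntegral a₄ := by
    rw [squareIntegral_add c3 c4', squareIntegral_swap c4]
  have e3 : squareIntegral (fun t s => a₂ t s + a₁ s t - varDensity Δ Λ' * (t * w s))
      = squareIntegral a₂ + squareIntegral a₁ := by
    rw [squareIntegral_sub c21 c0, squareIntegral_add c2 c1', squareIntegral_swap c1,
      squareIntegral_const_mul, squareIntegral_mul_eq_zero, mul_zero, sub_zero]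
  have e4 : magneticTerms β m Δ Λ Λ' = β ^ 2 * squareIntegral (fun t s =>
      quenched β m Δ Λ Λ' ![t, s] (fun σ => mag m Λ' (σ 0) * mag m Λ' (σ 1)) - w t * w s)
      - 2 * β ^ 3 * squareIntegral (fun t s => a₃ t s + a₄ s t)
      + 2 * β ^ 3 * squareIntegral (fun t s =>
        a₂ t s + a₁ s t - varDensity Δ Λ' * (t * w s)) := by
    unfold magneticTerms squareIntegral
    congr 2
    · congr 1
      refine intervalIntegral.integral_congr fun t _ =>
        intervalIntegral.integral_congr fun s _ => ?_
      simp only [h3, h4]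
      ring
    · refine intervalIntegral.integral_congr fun t _ =>
        intervalIntegral.integral_congr fun s _ => ?_
      simp only [h1, h2]
      ring
  rw [e4, e2, e3, squareIntegral_const_mul]
  refine (congrArg (fun z => _ + 2 * β ^ 2 * z) e1).trans ?_
  ring

theorem logPartition_sub (hN : (Λ'.card : ℝ) ≠ 0) (J : Disorder d) :
    logPartition β Λ Λ' 1 J - logPartition β Λ Λ' (-1) J
      = β * meanPart β m Λ Λ' J + β * noisePart β m Λ Λ' J := by
  rw [logPartition_sub_eq_integral, ← mul_add, meanPart, noisePart,
    ← intervalIntegral.integral_add, intervalIntegral.integral_const_mul]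
  · congr 1
    refine intervalIntegral.integral_congr fun t _ => ?_
    have hmag : (mag m Λ' : Config Λ → ℝ)
        = fun σ => ∑ X ∈ Λ'.powerset, (-(m X / Λ'.card)) * spinProd X σ := by
      ext σ
      rw [mag, ← Finset.sum_neg_distrib, Finset.sum_div]
      exact Finset.sum_congr rfl fun X _ => by ring
    simp only [meanEnergy, noiseEnergy]
    rw [hmag]
    unfold gibbsState
    rw [gibbsAvg_sum, Finset.mul_sum, ← Finset.sum_add_distrib]
    refine Finset.sum_congr rfl fun X _ => ?_
    rw [gibbsAvg_const_mul]
    field_simp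
    ring
  · exact (Continuous.comp (g := fun p : ℝ × Disorder d => meanEnergy β m Λ Λ' p.1 p.2)
      (f := fun t => (t, J)) continuous_meanEnergy (by fun_prop)).intervalIntegrable _ _
  · exact (Continuous.comp (g := fun p : ℝ × Disorder d => noiseEnergy β m Λ Λ' p.1 p.2)
      (f := fun t => (t, J)) continuous_noiseEnergy (by fun_prop)).intervalIntegrable _ _

/-- Changing one coupling by δ moves every exponent by at most |β| |δ|, because the weights t and 1
and the spin products are at most 1 in modulus. Efron–Stein then adds the contributions. -/
theorem variance_logPartition_le (hsub : Λ' ⊆ Λ) {t : ℝ} (ht : |t| ≤ 1) :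
    MemLp (logPartition β Λ Λ' t) 2 (disorderLaw m Δ) ∧
    Var[logPartition β Λ Λ' t; disorderLaw m Δ]
      ≤ β ^ 2 * ∑ X ∈ Λ.powerset, (Δ X : ℝ) ^ 2 := by
  have hmeas : Measurable (logPartition β Λ Λ' t) :=
    (Continuous.comp (g := fun p : ℝ × Disorder d => logPartition β Λ Λ' p.1 p.2)
      (f := fun J => (t, J)) (continuous_logPartition β Λ Λ') (by fun_prop)).measurable
  have h := variance_le_of_coord_lipschitz m (fun X => Δ X ^ 2) (fun _ => |β|) Λ.powerset
    (logPartition β Λ Λ' t) hmeas ?_ ?_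
  · refine ⟨h.1, h.2.trans (le_of_eq ?_)⟩
    rw [Finset.mul_sum]
    exact Finset.sum_congr rfl fun X _ => by rw [sq_abs]; push_cast; ring
  · intro J J' hJ
    unfold logPartition
    congr 1
    ext σ
    rw [hamLinear_eq hsub, hamLinear_eq hsub]
    congr 2
    exact Finset.sum_congr rfl fun X hX => by rw [hJ X hX]
  · intro J X y y'
    refine abs_logPart_sub_le fun σ => ?_
    rw [← mul_sub, hamLinear_update_sub hsub, abs_mul, abs_neg]
    refine mul_le_mul_of_nonneg_left ?_ (abs_nonneg β)
    split_ifs with hX h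
    · rw [abs_neg, abs_mul, abs_mul]
      refine mul_le_of_le_one_right (abs_nonneg _) ?_
      exact mul_le_one₀ ht (abs_nonneg _) (abs_spinProd_le X σ)
    · rw [abs_neg, abs_mul, one_mul]
      exact mul_le_of_le_one_right (abs_nonneg _) (abs_spinProd_le X σ)
    · rw [abs_zero]
      exact abs_nonneg _

theorem variance_logPartition_sub_le (hsub : Λ' ⊆ Λ) :
    Var[fun J => logPartition β Λ Λ' 1 J - logPartition β Λ Λ' (-1) J; disorderLaw m Δ]
      ≤ 4 * (β ^ 2 * ∑ X ∈ Λ.powerset, (Δ X : ℝ) ^ 2) := by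
  obtain ⟨i1, v1⟩ := variance_logPartition_le (β := β) (m := m) (Δ := Δ) hsub (t := 1) (by simp)
  obtain ⟨i2, v2⟩ := variance_logPartition_le (β := β) (m := m) (Δ := Δ) hsub (t := -1) (by simp)
  linarith [variance_sub_le i1 i2]

theorem variance_logPartition_sub (hN : (Λ'.card : ℝ) ≠ 0) (hsub : Λ' ⊆ Λ) :
    Var[fun J => logPartition β Λ Λ' 1 J - logPartition β Λ Λ' (-1) J; disorderLaw m Δ]
      = (Λ'.card : ℝ) ^ 2 * (magneticTerms β m Δ Λ Λ' + quarticTerms β m Δ Λ Λ')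
        + Λ'.card * β ^ 2 * squareIntegral fun t s =>
          quenched β m Δ Λ Λ' ![t, s] (fun σ => cov Δ Λ' (σ 0) (σ 1)) := by
  have h1 := variance_noisePart (β := β) (m := m) (Δ := Δ) hN hsub
  have h2 := variance_meanPart_add (β := β) (m := m) (Δ := Δ) hN hsub
  simp only [logPartition_sub (β := β) (Λ := Λ) (m := m) hN]
  rw [variance_fun_add (memLp_meanPart.const_mul _) (memLp_noisePart.const_mul _),
    variance_const_mul, variance_const_mul, covariance_const_mul_left, covariance_const_mul_right]
  linear_combination h1 + h2

end Integrated

end SpinGlass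

namespace SpinGlass

variable {d : ℕ}

/-! ### Dependence on the mean parameter μ and concentration of the magnetization. -/

section Shift

variable (β : ℝ) (m m' : Finset (Site d) → ℝ) (Δ : Finset (Site d) → ℝ≥0) (Λ Λ' : Finset (Site d))

/-- Moves the means from the law into the integrand: μ then acts over a fixed probability space,
where convexity and continuity in μ make sense pointwise in the noise. -/
theorem measurePreserving_add_mean :
    MeasurePreserving (fun (g : Disorder d) X => g X + m X) (disorderLaw (fun _ => 0) Δ)
      (disorderLaw m Δ) := by
  refine ⟨by fun_prop, ?_⟩
  unfold disorderLaw
  rw [Measure.infinitePi_map_pi (f := fun X y => y + m X) _ fun X => by fun_prop]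
  simp only [gaussianReal_map_add_const, zero_add]

/-- The variance of `ω_t(m_{Λ'})`, for the magnetization with means `m'`, when the means of the
couplings in `Λ'` are `μ m'_X`. -/
noncomputable def magVariance (t μ : ℝ) : ℝ :=
  Var[gibbsState β Λ Λ' t (mag m' Λ'); disorderLaw (paramMean m m' Λ' μ) Δ]

variable {β m m' Δ Λ Λ'}

theorem magVariance_nonneg (t μ : ℝ) : 0 ≤ magVariance β m m' Δ Λ Λ' t μ := variance_nonneg _ _

theorem magVariance_eq (t μ : ℝ) : magVariance β m m' Δ Λ Λ' t μ
    = Var[fun g => gibbsState β Λ Λ' t (mag m' Λ') fun X => g X + paramMean m m' Λ' μ X;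
        disorderLaw (fun _ => 0) Δ] :=
  ((measurePreserving_add_mean (paramMean m m' Λ' μ) Δ).variance_fun_comp
    (measurable_gibbsState β Λ Λ' t _).aemeasurable).symm

theorem magVariance_le {C : ℝ} (hC : ∀ σ : Config Λ, |mag m' Λ' σ| ≤ C) (t μ : ℝ) :
    magVariance β m m' Δ Λ Λ' t μ ≤ C ^ 2 := by
  refine (variance_le_expectation_sq
    (measurable_gibbsState β Λ Λ' t _).aestronglyMeasurable).trans ?_
  have h : ∀ J, gibbsState β Λ Λ' t (mag m' Λ') J ^ 2 ≤ C ^ 2 := fun J => by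
    have := pow_le_pow_left₀ (abs_nonneg _) (abs_gibbsState_le β Λ Λ' hC t J) 2
    rwa [sq_abs] at this
  have h2 := integral_mono (μ := disorderLaw (paramMean m m' Λ' μ) Δ)
    ((bddMeasurable_gibbsState β Λ Λ' t (mag m' Λ')).memLp _ Δ).integrable_sq
    (integrable_const (C ^ 2)) h
  simpa using! h2

theorem continuous_paramMean_add :
    Continuous fun p : (ℝ × ℝ) × Disorder d =>
      ((p.1.1, fun X => p.2 X + paramMean m m' Λ' p.1.2 X) : ℝ × Disorder d) := by
  refine (by fun_prop : Continuous fun p : (ℝ × ℝ) × Disorder d => p.1.1).prodMk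
    (continuous_pi fun X => ?_)
  unfold paramMean
  split_ifs <;> fun_prop

theorem continuous_magVariance :
    Continuous fun p : ℝ × ℝ => magVariance β m m' Δ Λ Λ' p.1 p.2 := by
  obtain ⟨C, hC⟩ := exists_abs_le Λ (mag m' Λ')
  set φ : ℝ × ℝ → Disorder d → ℝ := fun p g =>
    gibbsState β Λ Λ' p.1 (mag m' Λ') fun X => g X + paramMean m m' Λ' p.2 X with hφ
  have hc : Continuous (Function.uncurry φ) :=
    Continuous.comp (g := fun q : ℝ × Disorder d => gibbsState β Λ Λ' q.1 (mag m' Λ') q.2)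
      (f := fun p : (ℝ × ℝ) × Disorder d =>
        ((p.1.1, fun X => p.2 X + paramMean m m' Λ' p.1.2 X) : ℝ × Disorder d))
      (continuous_gibbsState β Λ Λ' (mag m' Λ')) continuous_paramMean_add
  have hb : ∀ p g, |φ p g| ≤ C := fun p g => abs_gibbsState_le β Λ Λ' hC _ _
  have hm : ∀ p, Continuous (φ p) := fun p =>
    Continuous.comp (g := Function.uncurry φ) (f := fun g => (p, g)) hc (by fun_prop)
  have hp : ∀ g, Continuous fun p => φ p g := fun g =>
    Continuous.comp (g := Function.uncurry φ) (f := fun p => (p, g)) hc (by fun_prop)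
  have h1 : Continuous fun p => ∫ g, φ p g ∂(disorderLaw (fun _ => 0) Δ) :=
    continuous_of_dominated (bound := fun _ => C)
      (fun p => (hm p).measurable.aestronglyMeasurable)
      (fun p => ae_of_all _ fun g => hb p g) (integrable_const C) (ae_of_all _ hp)
  have h2 : Continuous fun p => ∫ g, φ p g ^ 2 ∂(disorderLaw (fun _ => 0) Δ) :=
    continuous_of_dominated (bound := fun _ => C ^ 2)
      (fun p => ((hm p).pow 2).measurable.aestronglyMeasurable)
      (fun p => ae_of_all _ fun g => by
        rw [norm_pow]
        exact pow_le_pow_left₀ (norm_nonneg _) (hb p g) 2) (integrable_const _)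
      (ae_of_all _ fun g => (hp g).pow 2)
  have e : ∀ p : ℝ × ℝ, magVariance β m m' Δ Λ Λ' p.1 p.2
      = ∫ g, φ p g ^ 2 ∂(disorderLaw (fun _ => 0) Δ)
        - (∫ g, φ p g ∂(disorderLaw (fun _ => 0) Δ)) ^ 2 := by
    intro p
    rw [magVariance_eq]
    exact variance_eq_sub (memLp_two_of_abs_le (hm p).measurable (memLp_const C) (hb p))
  simp only [e]
  exact h2.sub (h1.pow 2)

theorem continuous_magVariance_left (μ : ℝ) :
    Continuous fun t => magVariance β m m' Δ Λ Λ' t μ :=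
  Continuous.comp (g := fun p : ℝ × ℝ => magVariance β m m' Δ Λ Λ' p.1 p.2)
    (f := fun t => (t, μ)) continuous_magVariance (by fun_prop)

theorem continuous_magVariance_right (t : ℝ) :
    Continuous fun μ => magVariance β m m' Δ Λ Λ' t μ :=
  Continuous.comp (g := fun p : ℝ × ℝ => magVariance β m m' Δ Λ Λ' p.1 p.2)
    (f := fun μ => (t, μ)) continuous_magVariance (by fun_prop)

theorem mag_paramMean (μ : ℝ) (σ : Config Λ) :
    mag (paramMean m m' Λ' μ) Λ' σ = μ * mag m' Λ' σ := by
  unfold mag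
  rw [mul_div_assoc', mul_neg, Finset.mul_sum]
  congr 2
  refine Finset.sum_congr rfl fun X hX => ?_
  rw [paramMean, if_pos (Finset.mem_powerset.1 hX)]
  ring

theorem variance_meanEnergy (t μ : ℝ) :
    Var[meanEnergy β (paramMean m m' Λ' μ) Λ Λ' t; disorderLaw (paramMean m m' Λ' μ) Δ]
      = (Λ'.card : ℝ) ^ 2 * μ ^ 2 * magVariance β m m' Δ Λ Λ' t μ := by
  have e : meanEnergy β (paramMean m m' Λ' μ) Λ Λ' t
      = fun J => (-(Λ'.card : ℝ) * μ) * gibbsState β Λ Λ' t (mag m' Λ') J := by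
    ext J
    have : (mag (paramMean m m' Λ' μ) Λ' : Config Λ → ℝ) = fun σ => μ * mag m' Λ' σ :=
      funext fun σ => mag_paramMean μ σ
    rw [meanEnergy, this]
    unfold gibbsState
    rw [gibbsAvg_const_mul, mul_assoc]
  rw [e, variance_const_mul, magVariance]
  ring

/-- Nonnegativity of Var(E_t − E_s) bounds each covariance by half the sum of the variances; the
outer factor 2 is the side length of the square. -/
theorem variance_meanPart_le (μ : ℝ) :
    Var[meanPart β (paramMean m m' Λ' μ) Λ Λ'; disorderLaw (paramMean m m' Λ' μ) Δ]
      ≤ 2 * ((Λ'.card : ℝ) ^ 2 * μ ^ 2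
        * ∫ t in (-1 : ℝ)..1, magVariance β m m' Δ Λ Λ' t μ) := by
  set M := paramMean m m' Λ' μ with hM
  obtain ⟨G, hG, _, h'⟩ := exists_energy_bound (β := β) (m := M) (Δ := Δ) (Λ := Λ) (Λ' := Λ')
  rw [← covariance_self memLp_meanPart.aestronglyMeasurable.aemeasurable]
  unfold meanPart
  rw [covariance_intervalIntegral measurable_meanEnergy measurable_meanEnergy hG h' h']
  set w : ℝ → ℝ := fun t => (Λ'.card : ℝ) ^ 2 * μ ^ 2 * magVariance β m m' Δ Λ Λ' t μ with hw
  have hwc : Continuous w :=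
    continuous_const.mul (continuous_magVariance_left μ)
  have hE : ∀ t, MemLp (meanEnergy β M Λ Λ' t) 2 (disorderLaw M Δ) := fun t =>
    (bddMeasurable_meanEnergy t).memLp M Δ
  have hle : ∀ t s, cov[meanEnergy β M Λ Λ' t, meanEnergy β M Λ Λ' s; disorderLaw M Δ]
      ≤ 1 / 2 * w t + 1 / 2 * w s := by
    intro t s
    have h1 := variance_fun_sub (hE t) (hE s)
    have h2 := variance_nonneg (fun J => meanEnergy β M Λ Λ' t J - meanEnergy β M Λ Λ' s J)
      (disorderLaw M Δ)
    rw [hM, variance_meanEnergy, variance_meanEnergy, ← hM] at h1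
    simp only [hw]
    linarith
  have hc1 : Continuous (Function.uncurry fun t s : ℝ => 1 / 2 * w t) := by
    unfold Function.uncurry; fun_prop
  have hc2 : Continuous (Function.uncurry fun t s : ℝ => 1 / 2 * w s) := by
    unfold Function.uncurry; fun_prop
  have hcc : Continuous (Function.uncurry fun t s =>
      cov[meanEnergy β M Λ Λ' t, meanEnergy β M Λ Λ' s; disorderLaw M Δ]) := by
    simp only [covariance_mean_mean]
    exact continuous_const.mul ((continuous_quenched_two continuous_fst continuous_snd).sub
      ((continuous_quenched_one continuous_fst).mul (continuous_quenched_one continuous_snd)))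
  have hc3 : Continuous (Function.uncurry fun t s : ℝ => 1 / 2 * w t + 1 / 2 * w s) := hc1.add hc2
  refine (squareIntegral_mono hcc hc3 hle).trans (le_of_eq ?_)
  refine (squareIntegral_add hc1 hc2).trans ?_
  simp only [squareIntegral, intervalIntegral.integral_const, intervalIntegral.integral_const_mul,
    hw, smul_eq_mul]
  ring

/-- The magnetization has small fluctuations on average over `μ`. -/
theorem integral_magVariance_le (hN : (Λ'.card : ℝ) ≠ 0) (hsub : Λ' ⊆ Λ) {C : ℝ}
    (hC : ∀ σ : Config Λ, |mag m' Λ' σ| ≤ C) {t : ℝ} (ht : |t| ≤ 1) {μ₁ μ₂ : ℝ} (hμ : μ₁ ≤ μ₂)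
    {h : ℝ} (hh : 0 < h) :
    (β * t * Λ'.card) ^ 2 * ∫ μ in μ₁..μ₂, magVariance β m m' Δ Λ Λ' t μ
      ≤ 8 * (β ^ 2 * ∑ X ∈ Λ.powerset, (Δ X : ℝ) ^ 2) / h ^ 2 * (μ₂ - μ₁)
        + 8 * (|β| * Λ'.card * C) ^ 2 * h := by
  set J : ℝ → Disorder d → Disorder d := fun x g X => g X + paramMean m m' Λ' x X with hJ
  have hmp : ∀ x, MeasurePreserving (J x) (disorderLaw (fun _ => 0) Δ)
      (disorderLaw (paramMean m m' Λ' x) Δ) := fun x => measurePreserving_add_mean _ Δ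
  set F : ℝ → Disorder d → ℝ := fun x g => logPartition β Λ Λ' t (J x g) with hF
  -- The candidate tangent slope of log Z in the parameter x; by `hham` the exponent is affine in x,
  -- so the log-partition function lies above these tangents.
  set F' : ℝ → Disorder d → ℝ := fun x g =>
    -(β * t * Λ'.card) * gibbsState β Λ Λ' t (mag m' Λ') (J x g) with hF'
  have hvar : ∀ x, Var[F' x; disorderLaw (fun _ => 0) Δ]
      = (β * t * Λ'.card) ^ 2 * magVariance β m m' Δ Λ Λ' t x := by
    intro x
    rw [hF', variance_const_mul, magVariance_eq, neg_sq]
  have hham : ∀ x y g (σ : Config Λ), -β * hamLinear Λ' (J y g) t σ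
      = -β * hamLinear Λ' (J x g) t σ + ((y - x) * -(β * t * Λ'.card)) * mag m' Λ' σ := by
    intro x y g σ
    have h1 : hamOutside Λ' (J y g) σ = hamOutside Λ' (J x g) σ := by
      unfold hamOutside
      congr 1
      refine Finset.sum_congr rfl fun X hX => ?_
      simp only [hJ, paramMean, if_neg (Finset.mem_filter.1 hX).2]
    have h2 : hamInside Λ' (J y g) σ = hamInside Λ' (J x g) σ
        + (y - x) * Λ'.card * mag m' Λ' σ := by
      unfold hamInside mag
      rw [mul_assoc, mul_div_cancel₀ _ hN, mul_neg, Finset.mul_sum, ← neg_add,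
        ← Finset.sum_add_distrib]
      congr 1
      refine Finset.sum_congr rfl fun X hX => ?_
      simp only [hJ, paramMean, if_pos (Finset.mem_powerset.1 hX)]
      ring
    rw [hamLinear, hamLinear, h1, h2]
    ring
  have key := integral_variance_deriv_le (P := disorderLaw (fun _ => 0) Δ) (F := F) (F' := F')
    (L := |β| * Λ'.card * C) (V := β ^ 2 * ∑ X ∈ Λ.powerset, (Δ X : ℝ) ^ 2)
    (fun x => (variance_logPartition_le hsub ht).1.comp_measurePreserving (hmp x))
    (fun x => ((measurable_gibbsState β Λ Λ' t _).comp (hmp x).measurable).const_mul _)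
    (fun x y g => ?_) (fun x g => ?_) (fun x => ?_) ?_ hμ hh
  · simp only [hvar, intervalIntegral.integral_const_mul] at key
    exact key
  · have h1 := logPart_add_gibbsAvg_le (fun σ : Config Λ => -β * hamLinear Λ' (J x g) t σ)
      (fun σ => ((y - x) * -(β * t * Λ'.card)) * mag m' Λ' σ)
    rw [gibbsAvg_const_mul, mul_assoc] at h1
    simp only [← hham x y g] at h1
    exact h1
  · have h1 := abs_gibbsState_le β Λ Λ' hC t (J x g)
    have h2 : |-(β * t * (Λ'.card : ℝ))| ≤ |β| * Λ'.card := by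
      rw [abs_neg, abs_mul, abs_mul, Nat.abs_cast]
      gcongr
      exact mul_le_of_le_one_right (abs_nonneg _) ht
    rw [hF', abs_mul]
    exact mul_le_mul h2 h1 (abs_nonneg _) (by positivity)
  · have h1 := variance_logPartition_le (β := β) (m := paramMean m m' Λ' x) (Δ := Δ) hsub ht
    exact ((hmp x).variance_fun_comp h1.1.aestronglyMeasurable.aemeasurable).trans_le h1.2
  · simp only [hvar]
    exact continuous_const.mul (continuous_magVariance_right t)

end Shift

end SpinGlass

namespace SpinGlass

variable {d : ℕ}

/-! ### Finite-volume bounds. -/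

section Bounds

variable {β : ℝ} {m : Finset (Site d) → ℝ} {Δ : Finset (Site d) → ℝ≥0} {Λ Λ' : Finset (Site d)}

theorem abs_cov_le {c : ℝ} (hc : (∑ X ∈ Λ'.powerset, (Δ X : ℝ) ^ 2) / (Λ'.card : ℝ) ≤ c)
    (σ τ : Config Λ) : |cov Δ Λ' σ τ| ≤ c := by
  refine le_trans ?_ hc
  rw [cov, abs_div, Nat.abs_cast]
  gcongr
  refine (Finset.abs_sum_le_sum_abs _ _).trans (Finset.sum_le_sum fun X _ => ?_)
  rw [mul_assoc, abs_mul, abs_mul, abs_of_nonneg (sq_nonneg (Δ X : ℝ))]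
  exact mul_le_of_le_one_right (sq_nonneg _)
    (mul_le_one₀ (abs_spinProd_le X σ) (abs_nonneg _) (abs_spinProd_le X τ))

theorem abs_mag_le {c : ℝ} (hc : (∑ X ∈ Λ'.powerset, |m X|) / (Λ'.card : ℝ) ≤ c)
    (σ : Config Λ) : |mag m Λ' σ| ≤ c := by
  refine le_trans ?_ hc
  rw [mag, abs_div, Nat.abs_cast, abs_neg]
  gcongr
  refine (Finset.abs_sum_le_sum_abs _ _).trans (Finset.sum_le_sum fun X _ => ?_)
  rw [abs_mul]
  exact mul_le_of_le_one_right (abs_nonneg _) (abs_spinProd_le X σ)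

/-- Solving the variance identity for Y: the upper bound uses the variance estimate, the lower one
only V ≥ 0. The 4 is the area of the square; k absorbs the constants of both applications, 4 and 8.
-/
theorem abs_le_of_scaled_eq {Y O V b c l N e : ℝ} (hN : 0 < N) (hc : 0 ≤ c) (hl : 0 ≤ l)
    (hV : 0 ≤ V) (hO : |O| ≤ 4 * c) (hY : V = N ^ 2 * Y + N * b ^ 2 * O) {k : ℝ}
    (hk : 4 ≤ k) (hVle : V ≤ k * (b ^ 2 * (c * l)) + e * N ^ 2) :
    |Y| ≤ k * b ^ 2 * c * (l / N ^ 2 + 1 / N) + e := by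
  have hYeq : Y = V / N ^ 2 - b ^ 2 * O / N := by
    rw [hY]
    field_simp
    ring
  have h5 : V / N ^ 2 ≤ k * b ^ 2 * c * (l / N ^ 2) + e := by
    rw [div_le_iff₀ (by positivity)]
    refine hVle.trans (le_of_eq ?_)
    field_simp
  have h6 : |b ^ 2 * O / N| ≤ k * b ^ 2 * c * (1 / N) := by
    rw [abs_div, abs_of_pos hN, abs_mul, abs_of_nonneg (sq_nonneg b), mul_one_div]
    refine div_le_div_of_nonneg_right ?_ hN.le
    calc b ^ 2 * |O| ≤ b ^ 2 * (4 * c) := by gcongr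
      _ ≤ b ^ 2 * (k * c) := by gcongr
      _ = k * b ^ 2 * c := by ring
  have h7 := abs_le.1 h6
  have h8 : 0 ≤ V / N ^ 2 := by positivity
  have hk0 : 0 ≤ k := by linarith
  have h9 : 0 ≤ k * b ^ 2 * c * (l / N ^ 2) := by positivity
  rw [abs_le, hYeq, mul_add]
  constructor <;> linarith [h7.1, h7.2]

theorem abs_magneticTerms_add_quarticTerms_le (hne : Λ'.Nonempty) (hsub : Λ' ⊆ Λ) {c : ℝ}
    (hcov : (∑ X ∈ Λ'.powerset, (Δ X : ℝ) ^ 2) / (Λ'.card : ℝ) ≤ c)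
    (hsum : ∑ X ∈ Λ.powerset, (Δ X : ℝ) ^ 2 ≤ c * Λ.card) :
    |magneticTerms β m Δ Λ Λ' + quarticTerms β m Δ Λ Λ'|
      ≤ 4 * β ^ 2 * c * ((Λ.card : ℝ) / (Λ'.card : ℝ) ^ 2 + 1 / Λ'.card) := by
  have hN : 0 < (Λ'.card : ℝ) := by exact_mod_cast hne.card_pos
  have h1 := variance_logPartition_sub (β := β) (m := m) (Δ := Δ) hN.ne' hsub
  have h2 := variance_logPartition_sub_le (β := β) (m := m) (Δ := Δ) hsub
  have h3 := variance_nonneg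
    (fun J => logPartition β Λ Λ' 1 J - logPartition β Λ Λ' (-1) J) (disorderLaw m Δ)
  have h4 := (abs_squareIntegral_le (F := fun t s =>
    quenched β m Δ Λ Λ' ![t, s] (fun σ => cov Δ Λ' (σ 0) (σ 1)))
    fun t s => abs_quenched_le (![t, s]) fun σ => abs_cov_le hcov (σ 0) (σ 1))
  have hc0 : 0 ≤ c := le_trans (by positivity) hcov
  have h5 := h2.trans (c := 4 * (β ^ 2 * (c * Λ.card)) + 0 * (Λ'.card : ℝ) ^ 2)
    (by rw [zero_mul, add_zero]; gcongr)
  simpa using abs_le_of_scaled_eq hN hc0 (Nat.cast_nonneg Λ.card) h3 h4 h1 le_rfl h5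

/-- The noise part is the full difference minus the mean part, up to the factor β. Splitting the
variance this way doubles both estimates, hence the constants 8 = 2·4 and 4 = 2·2. -/
theorem abs_quarticTerms_le {m' : Finset (Site d) → ℝ} (hne : Λ'.Nonempty) (hsub : Λ' ⊆ Λ) {c : ℝ}
    (hcov : (∑ X ∈ Λ'.powerset, (Δ X : ℝ) ^ 2) / (Λ'.card : ℝ) ≤ c)
    (hsum : ∑ X ∈ Λ.powerset, (Δ X : ℝ) ^ 2 ≤ c * Λ.card) (μ : ℝ) :
    |quarticTerms β (paramMean m m' Λ' μ) Δ Λ Λ'|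
      ≤ 8 * β ^ 2 * c * ((Λ.card : ℝ) / (Λ'.card : ℝ) ^ 2 + 1 / Λ'.card)
        + 4 * μ ^ 2 * (β ^ 2 * ∫ t in (-1 : ℝ)..1, magVariance β m m' Δ Λ Λ' t μ) := by
  set M := paramMean m m' Λ' μ with hM
  have hN : 0 < (Λ'.card : ℝ) := by exact_mod_cast hne.card_pos
  have h1 := variance_noisePart (β := β) (m := M) (Δ := Δ) hN.ne' hsub
  have h2 := variance_logPartition_sub_le (β := β) (m := M) (Δ := Δ) hsub
  have h3 := variance_nonneg (noisePart β M Λ Λ') (disorderLaw M Δ)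
  have h4 := (abs_squareIntegral_le (F := fun t s =>
    quenched β M Δ Λ Λ' ![t, s] (fun σ => cov Δ Λ' (σ 0) (σ 1)))
    fun t s => abs_quenched_le (![t, s]) fun σ => abs_cov_le hcov (σ 0) (σ 1))
  have hdec : (fun J => (logPartition β Λ Λ' 1 J - logPartition β Λ Λ' (-1) J)
      - β * meanPart β M Λ Λ' J) = fun J => β * noisePart β M Λ Λ' J := by
    ext J
    rw [logPartition_sub hN.ne', add_sub_cancel_left]
  have hP : MemLp (fun J => logPartition β Λ Λ' 1 J - logPartition β Λ Λ' (-1) J) 2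
      (disorderLaw M Δ) :=
    (variance_logPartition_le hsub (by simp)).1.sub (variance_logPartition_le hsub (by simp)).1
  have hv := variance_sub_le hP
    ((memLp_meanPart (β := β) (m := M) (Δ := Δ) (Λ := Λ) (Λ' := Λ')).const_mul β)
  rw [hdec, variance_const_mul, variance_const_mul] at hv
  have hm := variance_meanPart_le (β := β) (m := m) (m' := m') (Δ := Δ) (Λ := Λ) (Λ' := Λ') μ
  rw [← hM] at hm
  have hI : 0 ≤ ∫ t in (-1 : ℝ)..1, magVariance β m m' Δ Λ Λ' t μ :=
    intervalIntegral.integral_nonneg (by norm_num) fun t _ => magVariance_nonneg t μ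
  have hc0 : 0 ≤ c := le_trans (by positivity) hcov
  refine abs_le_of_scaled_eq hN hc0 (Nat.cast_nonneg Λ.card)
    (mul_nonneg (sq_nonneg β) h3) h4 h1 (by norm_num) (hv.trans ?_)
  calc _ ≤ 2 * (4 * (β ^ 2 * (c * Λ.card)))
        + 2 * (β ^ 2 * (2 * ((Λ'.card : ℝ) ^ 2 * μ ^ 2
          * ∫ t in (-1 : ℝ)..1, magVariance β m m' Δ Λ Λ' t μ))) := by
        have h2' := h2.trans (b := 4 * (β ^ 2 * ∑ X ∈ Λ.powerset, (Δ X : ℝ) ^ 2))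
          (c := 4 * (β ^ 2 * (c * Λ.card))) (by gcongr)
        gcongr
    _ = _ := by ring

end Bounds

/-! ### Growth of the volumes. -/

section Limits

variable {Λ Λ' : ℕ → Finset (Site d)}

theorem tendsto_card_atTop (hd : 1 ≤ d) (hΛ' : Tendsto Λ' atTop atTop) :
    Tendsto (fun n => ((Λ' n).card : ℝ)) atTop atTop := by
  have : Nonempty (Fin d) := ⟨⟨0, hd⟩⟩
  have : Infinite (Site d) := Pi.infinite_of_right
  refine tendsto_natCast_atTop_atTop.comp (tendsto_atTop.2 fun k => ?_)
  obtain ⟨s, hs⟩ := Infinite.exists_subset_card_eq (Site d) k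
  filter_upwards [hΛ'.eventually_ge_atTop s] with n hn
  exact hs ▸ Finset.card_le_card hn

theorem tendsto_card_div_sq {a : ℝ} (ha : 0 < a)
    (hN : Tendsto (fun n => ((Λ' n).card : ℝ)) atTop atTop)
    (hratio : Tendsto (fun n => ((Λ' n).card : ℝ) / ((Λ n).card : ℝ)) atTop (𝓝 a)) :
    Tendsto (fun n => ((Λ n).card : ℝ) / ((Λ' n).card : ℝ) ^ 2) atTop (𝓝 0) := by
  have h := (hratio.inv₀ ha.ne').mul (tendsto_inv_atTop_zero.comp hN)
  rw [mul_zero] at h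
  refine h.congr fun n => ?_
  simp only [Function.comp_apply, inv_div]
  rw [sq, ← div_eq_mul_inv, div_div]

end Limits

/-! ### Vanishing of the averaged magnetization fluctuations. -/

section MagnetizationLimit

variable {β : ℝ} {m m' : Finset (Site d) → ℝ} {Δ : Finset (Site d) → ℝ≥0}
  {Λ Λ' : ℕ → Finset (Site d)}

/-- Arithmetic of the choice of step w with w² = q and |Λ| = q²N²: after division by (tN)² the two
errors are of order q and w. The letter h stands for the length of the μ-interval. -/
theorem mul_le_of_scaled_le {b t N I S q w c c' h : ℝ} (hN : 0 < N) (hq : 0 < q) (ht : t ≠ 0)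
    (hh : 0 ≤ h) (hS : S ≤ c * (q * q * N ^ 2))
    (hI : (b * t * N) ^ 2 * I ≤ 8 * (b ^ 2 * S) / q * h + 8 * (|b| * N * c') ^ 2 * w) :
    b ^ 2 * I ≤ (t ^ 2)⁻¹ * (8 * b ^ 2 * c * h * q + 8 * b ^ 2 * c' ^ 2 * w) := by
  have h1 : (b * t * N) ^ 2 * I
      ≤ N ^ 2 * (8 * b ^ 2 * c * h * q + 8 * b ^ 2 * c' ^ 2 * w) := by
    calc (b * t * N) ^ 2 * I
        ≤ 8 * (b ^ 2 * (c * (q * q * N ^ 2))) / q * h + 8 * (|b| * N * c') ^ 2 * w := by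
          refine hI.trans ?_
          gcongr
      _ = _ := by
          rw [mul_pow, mul_pow, sq_abs]
          field_simp
  rw [inv_mul_eq_div, le_div_iff₀ (by positivity)]
  refine le_of_mul_le_mul_left (le_trans (le_of_eq ?_) h1) (by positivity : 0 < N ^ 2)
  ring

theorem tendsto_integral_magVariance (hsub : ∀ n, Λ' n ⊆ Λ n) {c c' : ℝ}
    (hne : ∀ᶠ n in atTop, (Λ' n).Nonempty)
    (hsum : ∀ᶠ n in atTop, ∑ X ∈ (Λ n).powerset, (Δ X : ℝ) ^ 2 ≤ c * (Λ n).card)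
    (hmag : ∀ᶠ n in atTop, ∀ σ : Config (Λ n), |mag m' (Λ' n) σ| ≤ c')
    (hr : Tendsto (fun n => ((Λ n).card : ℝ) / ((Λ' n).card : ℝ) ^ 2) atTop (𝓝 0))
    {μ₁ μ₂ : ℝ} (hμ : μ₁ ≤ μ₂) {t : ℝ} (ht : |t| ≤ 1) (ht0 : t ≠ 0) :
    Tendsto (fun n => ∫ μ in μ₁..μ₂, β ^ 2 * magVariance β m m' Δ (Λ n) (Λ' n) t μ)
      atTop (𝓝 0) := by
  set r : ℕ → ℝ := fun n => ((Λ n).card : ℝ) / ((Λ' n).card : ℝ) ^ 2 with hrdef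
  -- The step of the convexity estimate is r^{1/4}, with r = |Λ|/|Λ'|². Any step h with h → 0 and
  -- r/h² → 0 would serve.
  have hub : Tendsto (fun n => (t ^ 2)⁻¹ * (8 * β ^ 2 * c * (μ₂ - μ₁) * √(r n)
      + 8 * β ^ 2 * c' ^ 2 * √(√(r n)))) atTop (𝓝 0) := by
    have h1 : Tendsto (fun n => √(r n)) atTop (𝓝 0) := by simpa using hr.sqrt
    have h2 : Tendsto (fun n => √(√(r n))) atTop (𝓝 0) := by simpa using h1.sqrt
    simpa using ((h1.const_mul (8 * β ^ 2 * c * (μ₂ - μ₁))).add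
      (h2.const_mul (8 * β ^ 2 * c' ^ 2))).const_mul (t ^ 2)⁻¹
  refine tendsto_of_tendsto_of_tendsto_of_le_of_le' tendsto_const_nhds hub
    (Eventually.of_forall fun n => intervalIntegral.integral_nonneg hμ fun μ _ =>
      mul_nonneg (sq_nonneg β) (magVariance_nonneg t μ)) ?_
  filter_upwards [hne, hsum, hmag] with n hn hs hm
  have hN : 0 < ((Λ' n).card : ℝ) := by exact_mod_cast hn.card_pos
  have hL : 0 < ((Λ n).card : ℝ) := by exact_mod_cast (hn.mono (hsub n)).card_pos
  have hrp : 0 < r n := by positivity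
  have hq : 0 < √(r n) := Real.sqrt_pos.2 hrp
  have hh : 0 < √(√(r n)) := Real.sqrt_pos.2 hq
  have key := integral_magVariance_le (β := β) (m := m) (m' := m') (Δ := Δ) hN.ne' (hsub n) hm ht
    hμ hh
  rw [Real.sq_sqrt hq.le] at key
  rw [intervalIntegral.integral_const_mul]
  have hrr : ((Λ n).card : ℝ) = √(r n) * √(r n) * ((Λ' n).card : ℝ) ^ 2 := by
    rw [Real.mul_self_sqrt hrp.le]
    exact (div_mul_cancel₀ _ (pow_ne_zero 2 hN.ne')).symm
  exact mul_le_of_scaled_le hN hq ht0 (sub_nonneg.2 hμ) (hrr ▸ hs) key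

theorem tendsto_integral_integral_magVariance (hsub : ∀ n, Λ' n ⊆ Λ n) {c c' : ℝ}
    (hne : ∀ᶠ n in atTop, (Λ' n).Nonempty)
    (hsum : ∀ᶠ n in atTop, ∑ X ∈ (Λ n).powerset, (Δ X : ℝ) ^ 2 ≤ c * (Λ n).card)
    (hmag : ∀ᶠ n in atTop, ∀ σ : Config (Λ n), |mag m' (Λ' n) σ| ≤ c')
    (hr : Tendsto (fun n => ((Λ n).card : ℝ) / ((Λ' n).card : ℝ) ^ 2) atTop (𝓝 0))
    {μ₁ μ₂ : ℝ} (hμ : μ₁ ≤ μ₂) :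
    Tendsto (fun n => ∫ μ in μ₁..μ₂, ∫ t in (-1 : ℝ)..1,
      β ^ 2 * magVariance β m m' Δ (Λ n) (Λ' n) t μ) atTop (𝓝 0) := by
  have hcont : ∀ n, Continuous (Function.uncurry fun t μ =>
      β ^ 2 * magVariance β m m' Δ (Λ n) (Λ' n) t μ) := fun n =>
    continuous_const.mul continuous_magVariance
  have hswap : ∀ n, ∫ μ in μ₁..μ₂, ∫ t in (-1 : ℝ)..1,
      β ^ 2 * magVariance β m m' Δ (Λ n) (Λ' n) t μ
      = ∫ t in (-1 : ℝ)..1, ∫ μ in μ₁..μ₂,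
        β ^ 2 * magVariance β m m' Δ (Λ n) (Λ' n) t μ := fun n =>
    (intervalIntegral_intervalIntegral_swap
      (((hcont n).continuousOn.integrableOn_compact (isCompact_uIcc.prod isCompact_uIcc)).mono_set
        (Set.prod_mono Set.uIoc_subset_uIcc Set.uIoc_subset_uIcc))).symm
  simp only [hswap]
  have h := intervalIntegral.tendsto_integral_filter_of_dominated_convergence
    (μ := volume) (a := (-1 : ℝ)) (b := 1) (l := atTop)
    (F := fun n t => ∫ μ in μ₁..μ₂, β ^ 2 * magVariance β m m' Δ (Λ n) (Λ' n) t μ)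
    (f := fun _ => 0) (fun _ => β ^ 2 * c' ^ 2 * |μ₂ - μ₁|) ?_ ?_ (by simp) ?_
  · simpa using h
  · exact Eventually.of_forall fun n =>
      (intervalIntegral.continuous_parametric_intervalIntegral_of_continuous' (hcont n) _
        _).aestronglyMeasurable
  · filter_upwards [hmag] with n hm
    refine ae_of_all _ fun t _ => intervalIntegral.norm_integral_le_of_norm_le_const fun μ _ => ?_
    rw [Real.norm_eq_abs, abs_of_nonneg (mul_nonneg (sq_nonneg β) (magVariance_nonneg t μ))]
    exact mul_le_mul_of_nonneg_left (magVariance_le hm t μ) (sq_nonneg β)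
  -- The pointwise bound blows up like t⁻² at t = 0, where log Z does not see the means inside Λ';
  -- that single point is negligible.
  · have h0 : ∀ᵐ t : ℝ, t ≠ 0 := by
      simp [ae_iff]
    filter_upwards [h0] with t ht0 ht
    refine tendsto_integral_magVariance hsub hne hsum hmag hr hμ ?_ ht0
    rw [Set.uIoc_of_le (by norm_num)] at ht
    exact abs_le.2 ⟨ht.1.le, ht.2⟩

theorem continuous_integral_magVariance {Λ Λ' : Finset (Site d)} :
    Continuous fun μ => ∫ t in (-1 : ℝ)..1, β ^ 2 * magVariance β m m' Δ Λ Λ' t μ := by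
  refine intervalIntegral.continuous_parametric_intervalIntegral_of_continuous' (μ := volume)
    (f := fun μ t => β ^ 2 * magVariance β m m' Δ Λ Λ' t μ) ?_ (-1) 1
  exact continuous_const.mul (Continuous.comp
    (g := Function.uncurry fun t μ => magVariance β m m' Δ Λ Λ' t μ) (f := Prod.swap)
    continuous_magVariance continuous_swap)

end MagnetizationLimit

end SpinGlass

theorem mainTheorem6 {d : ℕ} (hd : 1 ≤ d) (β : ℝ)
    (m : Finset (SpinGlass.Site d) → ℝ) (Δ : Finset (SpinGlass.Site d) → ℝ≥0)
    (hstable : SpinGlass.ThermodynamicallyStable m Δ)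
    (a : ℝ) (ha : 0 < a)
    (Λ Λ' : ℕ → Finset (SpinGlass.Site d)) (hsub : ∀ n, Λ' n ⊆ Λ n)
    (hΛ : Tendsto Λ atTop atTop) (hΛ' : Tendsto Λ' atTop atTop)
    (hratio : Tendsto (fun n => ((Λ' n).card : ℝ) / ((Λ n).card : ℝ)) atTop (𝓝 a)) :
    Tendsto (fun n => SpinGlass.magneticTerms β m Δ (Λ n) (Λ' n)
        + SpinGlass.quarticTerms β m Δ (Λ n) (Λ' n)) atTop (𝓝 0) ∧
    ∀ m' : Finset (SpinGlass.Site d) → ℝ, SpinGlass.ThermodynamicallyStable m' Δ →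
      ∀ μ₁ μ₂ : ℝ, μ₁ ≤ μ₂ →
        Tendsto (fun n => ∫ μ in μ₁..μ₂,
          SpinGlass.quarticTerms β (SpinGlass.paramMean m m' (Λ' n) μ) Δ (Λ n) (Λ' n))
          atTop (𝓝 0) := by
  obtain ⟨c, hc⟩ := hstable
  have hN := SpinGlass.tendsto_card_atTop hd hΛ'
  have hr := SpinGlass.tendsto_card_div_sq ha hN hratio
  have hρ : Tendsto (fun n => ((Λ n).card : ℝ) / ((Λ' n).card : ℝ) ^ 2 + 1 / (Λ' n).card)
      atTop (𝓝 0) := by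
    simpa using hr.add (tendsto_inv_atTop_zero.comp hN)
  have hne : ∀ᶠ n in atTop, (Λ' n).Nonempty := by
    filter_upwards [hN.eventually_gt_atTop 0] with n hn
    exact Finset.card_pos.1 (by exact_mod_cast hn)
  have hsum' : ∀ n, (Λ' n).Nonempty →
      ∑ X ∈ (Λ n).powerset, (Δ X : ℝ) ^ 2 ≤ c * (Λ n).card := by
    intro n hn
    have hL : 0 < ((Λ n).card : ℝ) := by exact_mod_cast (hn.mono (hsub n)).card_pos
    exact (div_le_iff₀ hL).1 (hc (Λ n) (hn.mono (hsub n))).2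
  refine ⟨?_, fun m' hm' μ₁ μ₂ hμ => ?_⟩
  · refine squeeze_zero_norm' (a := fun n => 4 * β ^ 2 * c *
      (((Λ n).card : ℝ) / ((Λ' n).card : ℝ) ^ 2 + 1 / (Λ' n).card)) ?_
      (by simpa using hρ.const_mul (4 * β ^ 2 * c))
    filter_upwards [hne] with n hn
    exact SpinGlass.abs_magneticTerms_add_quarticTerms_le hn (hsub n) (hc _ hn).2 (hsum' n hn)
  · obtain ⟨c', hc'⟩ := hm'
    have hmag : ∀ᶠ n in atTop, ∀ σ : SpinGlass.Config (Λ n), |SpinGlass.mag m' (Λ' n) σ| ≤ c' := by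
      filter_upwards [hne] with n hn
      exact SpinGlass.abs_mag_le (hc' _ hn).1
    have hW := SpinGlass.tendsto_integral_integral_magVariance (β := β) (m := m) (m' := m') (Δ := Δ) hsub hne
      (hne.mono hsum') hmag hr hμ
    -- K bounds |μ| on the interval, so the weight μ² in the bound for Q(μ) can be taken out of the
    -- integral.
    set K := max |μ₁| |μ₂|
    refine squeeze_zero_norm' (a := fun n => (μ₂ - μ₁) * (8 * β ^ 2 * c *
      (((Λ n).card : ℝ) / ((Λ' n).card : ℝ) ^ 2 + 1 / (Λ' n).card))
      + 4 * K ^ 2 * ∫ μ in μ₁..μ₂, ∫ t in (-1 : ℝ)..1,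
        β ^ 2 * SpinGlass.magVariance β m m' Δ (Λ n) (Λ' n) t μ) ?_ ?_
    · filter_upwards [hne] with n hn
      have hI := SpinGlass.continuous_integral_magVariance (β := β) (m := m) (m' := m') (Δ := Δ)
        (Λ := Λ n) (Λ' := Λ' n)
      have hi := (hI.const_mul (4 * K ^ 2)).intervalIntegrable (μ := volume) μ₁ μ₂
      refine (intervalIntegral.norm_integral_le_of_norm_le (g := fun μ => 8 * β ^ 2 * c *
        (((Λ n).card : ℝ) / ((Λ' n).card : ℝ) ^ 2 + 1 / (Λ' n).card)
        + 4 * K ^ 2 * ∫ t in (-1 : ℝ)..1, β ^ 2 * SpinGlass.magVariance β m m' Δ (Λ n) (Λ' n) t μ)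
        hμ (ae_of_all _ fun μ hμ' => ?_) (intervalIntegrable_const.add hi)).trans (le_of_eq ?_)
      · refine (SpinGlass.abs_quarticTerms_le hn (hsub n) (hc _ hn).2 (hsum' n hn) μ).trans ?_
        rw [intervalIntegral.integral_const_mul]
        have hI0 : 0 ≤ ∫ t in (-1 : ℝ)..1, SpinGlass.magVariance β m m' Δ (Λ n) (Λ' n) t μ :=
          intervalIntegral.integral_nonneg (by norm_num) fun t _ => SpinGlass.magVariance_nonneg t μ
        have hK : μ ^ 2 ≤ K ^ 2 := by
          rw [← sq_abs]
          exact pow_le_pow_left₀ (abs_nonneg _) (abs_le_max_abs_abs hμ'.1.le hμ'.2) 2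
        gcongr
      · rw [intervalIntegral.integral_add (by simp) hi, intervalIntegral.integral_const,
          intervalIntegral.integral_const_mul, smul_eq_mul]
    · simpa using ((hρ.const_mul (8 * β ^ 2 * c)).const_mul (μ₂ - μ₁)).add (hW.const_mul (4 * K ^ 2))
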